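/- A tree-like tableau is a Young diagram with points in some of its cells such that (1) the top left cell contains a point, the root; (2) every other point has either a point above it in its column or a point to its left in its row, but not both; (3) every row and every column contains a point. Its size is its number of points; the empty tableau is the only one of size $0$. A non-ambiguous tree of height $h$ and width $w$ is a tree-like tableau whose shape is the rectangle with $h+1$ rows and $w+1$ columns. A corner is a cell of the diagram with no cell of the diagram directly below it or directly to its right. An ascending run of size $1$ in a permutation $\sigma$ of $[n]=\{1,\dots,n\}$ is a position $k\in[n]$ with $\sigma_{k-1}>\sigma_k>\sigma_{k+1}$, where $\sigma_0=n+1$ and $\sigma_{n+1}=0$. "Corners in tree-like tableaux of size $n$" are pairs (tableau, corner of it), and "runs of size $1$ in permutations of $[n]$" are pairs (permutation, run of it). Theorem. Let $n\ge 1$. Corners in tree-like tableaux of size $n$ are in bijection with ascending runs of size $1$ in permutations of $[n]$. More precisely: (a) Cutting a tableau $T$ along the bottom and right edges of its corner $c=(i,j)$ (row $i$, column $j$, numbered from $0$) gives a bijection from the corners in tree-like tableaux of size $n$ onto the triples $(T_l,T_r,nat)$ where $T_l,T_r$ are tree-like tableaux of sizes $n_l,n_r\ge 0$ with $n_l+n_r+1=n$,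 and $nat$ is a non-ambiguous tree whose height is the number of points in the first column of $T_r$ and whose width is the number of points in the first row of $T_l$. Here, with $M$ the part of $T$ in rows $0,\dots,i$ and columns $0,\dots,j$: $T_l$ is the part of $T$ below row $i$ with an added first row of $j$ cells, pointed in the columns in which $M$ has a point; $T_r$ is the part of $T$ to the right of column $j$ with an added first column of $i$ cells, pointed in the rows in which $M$ has a point; and $nat$ is $M$ with its empty rows and columns removed. (b) There are, for all $m,h,w\ge 0$, bijections $T\mapsto l\sigma$ and $T\mapsto r\sigma$ from tree-like tableaux of size $m$ to permutations of $[m]$ such that the number of cycles of $l\sigma$ (resp. $r\sigma$) is the number of points in the first row (resp. first column) of $T$, and bijections from non-ambiguous trees of height $h$ and width $w$ to the words in which each of the blue letters $1,\dots,h$ and the red letters $0,\dots,w$ occurs once, the last letter is red, and two consecutive letters of the same colour increase, for which the following defines a bijection $\Phi$ from the corners in tree-like tableaux of size $n$ onto the ascending runs of size $1$ in permutations of $[n]$. Let a corner have triple $(T_l,T_r,nat)$, and let $m$ be the word of $nat$. If the letter after the red $0$ is blue, write $m=u\,0\,a_1b_1\cdots a_pb_p$ with maximal blue blocks $a_i$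 and maximal red blocks $b_i$, and put $m^*=u\,0\,b_1a_1\cdots b_pa_p$; otherwise put $m^*=m$. Write each cycle of $l\sigma$ (the permutation of $T_l$) as the word starting with its largest element $x$ and continuing $l\sigma(x),l\sigma^2(x),\dots$, and let $L_1,L_2,\dots$ be these words in increasing order of largest element; let $R_1,R_2,\dots$ be obtained in the same way from $r\sigma$ (the permutation of $T_r$), all values being increased by $n_l+1$. In $m^*$ replace the red $0$ by $n_l+1$, each red $i\ge1$ by $L_i$ and each blue $i$ by $R_i$. The result is the one-line word of the permutation $\sigma$, and the run is the entry $\sigma_k=n_l+1$. (c) The number of corners in tree-like tableaux of size $n$ is $n!\,\frac{n+4}{6}$ for $n\ge 2$, and it is $1$ for $n=1$. -/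

import Mathlib

namespace TreeLike

/-! ### Tree-like tableaux

A diagram without empty rows and columns is a `YoungDiagram`; cells are pairs `(row, column)`,
numbered from `0`, rows downwards and columns rightwards. -/

/-- A tree-like tableau: a Young diagram with points in some of its cells. The empty tableau, of
size `0`, is allowed; it is the only tableau without a root point, and it is not in
`Tableaux n` for `n ≥ 1`. -/
@[ext]
structure Tableau where
  shape : YoungDiagram
  points : Finset (ℕ × ℕ)
  points_subset : points ⊆ shape.cells
  root : shape ≠ ⊥ → (0, 0) ∈ points
  /-- A non-root point has a point above it or a point to its left, but not both. -/
  parent : ∀ i j : ℕ, (i, j) ∈ points → (i, j) ≠ (0, 0) →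
    Xor (∃ i' < i, (i', j) ∈ points) (∃ j' < j, (i, j') ∈ points)
  row_nonempty : ∀ i j : ℕ, (i, j) ∈ shape → ∃ j' : ℕ, (i, j') ∈ points
  col_nonempty : ∀ i j : ℕ, (i, j) ∈ shape → ∃ i' : ℕ, (i', j) ∈ points

/-- The size of a tree-like tableau is its number of points. -/
def Tableau.size (T : Tableau) : ℕ := T.points.card

/-- The number of points in the first row (the root included). -/
def Tableau.firstRow (T : Tableau) : ℕ := (T.points.filter fun c => c.1 = 0).card

/-- The number of points in the first column (the root included). -/
def Tableau.firstCol (T : Tableau) : ℕ := (T.points.filter fun c => c.2 = 0).card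

/-- The tree-like tableaux of size `n`. -/
def Tableaux (n : ℕ) : Type := {T : Tableau // T.size = n}

/-- A corner of a diagram: a cell whose bottom and right edges are on the border. -/
def IsCorner (D : YoungDiagram) (c : ℕ × ℕ) : Prop :=
  c ∈ D ∧ (c.1 + 1, c.2) ∉ D ∧ (c.1, c.2 + 1) ∉ D

/-- The corners in the tree-like tableaux of size `n`: pairs of a tableau and one of its
corners. -/
def Corners (n : ℕ) : Type := {p : Tableau × (ℕ × ℕ) // p.1.size = n ∧ IsCorner p.1.shape p.2}

/-- A non-ambiguous tree of height `h` and width `w`: a tree-like tableau whose shape is the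
rectangle with `h + 1` rows and `w + 1` columns. -/
def NonAmbiguousTree (h w : ℕ) : Type :=
  {T : Tableau // ∀ i j : ℕ, (i, j) ∈ T.shape ↔ i ≤ h ∧ j ≤ w}

/-! ### Cutting a tableau at a corner -/

/-- The triples `(T_l, T_r, nat)` that correspond to the corners in size `n`. -/
structure Triple (n : ℕ) where
  left : Tableau
  right : Tableau
  tree : NonAmbiguousTree right.firstCol left.firstRow
  size_add : left.size + right.size + 1 = n

/-- `IsCut T (i, j) t`: cutting `T` along the lines of the bottom and the right edge of its corner
`(i, j)` gives the triple `t`. The middle part is the rectangle of the cells `(a, b)` with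
`a ≤ i`, `b ≤ j`.
* `t.left` is the bottom part with a first row of `j` cells added above it, which has points in
  the cells below the non-empty columns of the middle part;
* `t.right` is the right part with a first column of `i` cells added to its left, which has points
  in the cells to the right of the non-empty rows of the middle part;
* `t.tree` is the middle part with its empty rows and empty columns removed. -/
def IsCut {n : ℕ} (T : Tableau) (c : ℕ × ℕ) (t : Triple n) : Prop :=
  (∀ b, (0, b) ∈ t.left.shape ↔ b < c.2) ∧
  (∀ a b, (a + 1, b) ∈ t.left.shape ↔ (c.1 + 1 + a, b) ∈ T.shape) ∧
  (∀ b, (0, b) ∈ t.left.points ↔ b < c.2 ∧ ∃ a ≤ c.1, (a, b) ∈ T.points) ∧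
  (∀ a b, (a + 1, b) ∈ t.left.points ↔ (c.1 + 1 + a, b) ∈ T.points) ∧
  (∀ a, (a, 0) ∈ t.right.shape ↔ a < c.1) ∧
  (∀ a b, (a, b + 1) ∈ t.right.shape ↔ (a, c.2 + 1 + b) ∈ T.shape) ∧
  (∀ a, (a, 0) ∈ t.right.points ↔ a < c.1 ∧ ∃ b ≤ c.2, (a, b) ∈ T.points) ∧
  (∀ a b, (a, b + 1) ∈ t.right.points ↔ (a, c.2 + 1 + b) ∈ T.points) ∧
  (∀ x y, (x, y) ∈ t.tree.1.points ↔
    ∃ a ≤ c.1, ∃ b ≤ c.2, (a, b) ∈ T.points ∧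
      {a' | a' < a ∧ ∃ b' ≤ c.2, (a', b') ∈ T.points}.ncard = x ∧
      {b' | b' < b ∧ ∃ a' ≤ c.1, (a', b') ∈ T.points}.ncard = y)

/-! ### Permutations, runs and cycles

A permutation of `{1, …, n}` is an element of `Equiv.Perm (Fin n)`, the index `i : Fin n`
standing for `i + 1`. -/

/-- The `i`-th letter `σ_i` of a permutation of `{1, …, n}` for `1 ≤ i ≤ n`, with the conventions
`σ_0 = n + 1` and `σ_{n+1} = 0`. -/
def letter {n : ℕ} (σ : Equiv.Perm (Fin n)) (i : ℕ) : ℕ :=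
  if i = 0 then n + 1 else if h : i - 1 < n then (σ ⟨i - 1, h⟩ : ℕ) + 1 else 0

/-- The word `σ_1 ⋯ σ_n`. -/
def oneLine {n : ℕ} (σ : Equiv.Perm (Fin n)) : List ℕ :=
  (List.range n).map fun i => letter σ (i + 1)

/-- `(σ_m, …, σ_{m+r-1})` is an ascending run of length `r` of `σ`. -/
def IsAscendingRun {n : ℕ} (σ : Equiv.Perm (Fin n)) (m r : ℕ) : Prop :=
  1 ≤ r ∧ 1 ≤ m ∧ m + r - 1 ≤ n ∧ letter σ m < letter σ (m - 1) ∧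
    (∀ i, m ≤ i → i + 1 ≤ m + r - 1 → letter σ i < letter σ (i + 1)) ∧
    letter σ (m + r) < letter σ (m + r - 1)

/-- The ascending runs of size `1` in the permutations of `{1, …, n}`: pairs of a permutation and
the position of a run of size `1` in it. -/
def RunsOne (n : ℕ) : Type := {p : Equiv.Perm (Fin n) × ℕ // IsAscendingRun p.1 p.2 1}

/-- The number of cycles of a permutation, fixed points included. -/
noncomputable def numCycles {m : ℕ} (π : Equiv.Perm (Fin m)) : ℕ :=
  Nat.card (Quotient (Equiv.Perm.SameCycle.setoid π))

open Classical in
/-- The cycles of `π`, each written as the word `M, π(M), π(π(M)), …` that starts with the largest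
element `M` of the cycle, in increasing order of their largest elements. All values are those of
`{1, …, m}`, shifted by `s`. -/
noncomputable def cycleWords {m : ℕ} (s : ℕ) (π : Equiv.Perm (Fin m)) : List (List ℕ) :=
  ((List.finRange m).filter fun M => ∀ x, π.SameCycle M x → x ≤ M).map fun M =>
    (List.range (Function.minimalPeriod π M)).map fun t => s + (((π ^ t) M : Fin m) : ℕ) + 1

/-! ### The words that encode non-ambiguous trees -/

/-- Letters are blue numbers (not pointed) and red numbers (pointed). -/
inductive Letter where
  | blue (i : ℕ)
  | red (i : ℕ)
  deriving DecidableEq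

def Letter.isRed : Letter → Bool
  | blue _ => false
  | red _ => true

def Letter.val : Letter → ℕ
  | blue i => i
  | red i => i

/-- The arrangements of the blue letters `1, …, p` and the red letters `0, …, q` into a word that
ends with a red letter and in which consecutive letters of the same colour increase. -/
def Words (p q : ℕ) : Type :=
  {m : List Letter // m.Nodup ∧ (∀ i, Letter.blue i ∈ m ↔ 1 ≤ i ∧ i ≤ p) ∧
    (∀ i, Letter.red i ∈ m ↔ i ≤ q) ∧ (∃ i, m.getLast? = some (Letter.red i)) ∧
    m.IsChain fun x y => x.isRed = y.isRed → x.val < y.val}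

/-- `a₁, b₁, a₂, b₂, …` becomes `b₁, a₁, b₂, a₂, …`. -/
def swapPairs {α : Type*} : List α → List α
  | a :: b :: l => b :: a :: swapPairs l
  | l => l

/-- If the letter after the red `0` is blue, so that `m = u 0 a₁ b₁ ⋯ a_k b_k` with maximal blue
blocks `a_i` and maximal red blocks `b_i`, the result is `u 0 b₁ a₁ ⋯ b_k a_k`. Otherwise `m` is
unchanged. -/
def swapBlocks (m : List Letter) : List Letter :=
  let u := m.takeWhile fun x => x ≠ Letter.red 0
  let v := (m.dropWhile fun x => x ≠ Letter.red 0).tail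
  match v with
  | Letter.blue _ :: _ =>
    u ++ Letter.red 0 :: (swapPairs (v.splitBy fun x y => x.isRed == y.isRed)).flatten
  | _ => m

/-- Substitute the number `s` for the red `0`, the `i`-th word of `L` for the red `i ≥ 1`, and the
`i`-th word of `R` for the blue `i`. -/
def substitute (s : ℕ) (L R : List (List ℕ)) (m : List Letter) : List ℕ :=
  m.flatMap fun x => match x with
    | Letter.red 0 => [s]
    | Letter.red (i + 1) => L.getD i []
    | Letter.blue i => R.getD (i - 1) []

/-- The word assembled from permutations `lσ` of `{1, …, a}` and `rσ` of `{1, …, b}` and a word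
`m`: after the block exchange, the red `0` is replaced by `a + 1`, the other red letters by the
cycles of `lσ`, and the blue letters by the cycles of `rσ`, shifted by `a + 1`. -/
noncomputable def assemble {a b : ℕ} (lσ : Equiv.Perm (Fin a)) (rσ : Equiv.Perm (Fin b))
    (m : List Letter) : List ℕ :=
  substitute (a + 1) (cycleWords 0 lσ) (cycleWords (a + 1) rσ) (swapBlocks m)

end TreeLike

open TreeLike

namespace TreeLike

/-! Cutting. Below the row of a corner (p, q) only columns left of q survive, and to the right of
its column only rows above p. So a tableau consists of the rectangle of cells weakly above and left
of the corner, a part below and a part to the right. A point outside the rectangle sees the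
rectangle only through the question whether its column (or row) has a point there, and the added
first row or column records exactly this. Deleting empty rows and columns keeps the relative order
of the points, so the rectangle becomes a tableau of rectangular shape. The corner's own row and
column are never empty, which gives the `+ 1` in each dimension. Both directions are stated as one
relation, and `exists_equiv_of_rel` turns existence and uniqueness on both sides into a bijection
(`exists_cutEquiv`).

Encoding the components. Only the existence of the three families of bijections is needed, so
equality of counts suffices. A tableau of size n + 1 comes from exactly one pair of a tableau of
size n and a set S of points in its first column: S empty adds a row, S non-empty splits the column
(`exists_growEquiv`). Hence the polynomial of first-column points satisfies P_{n+1}(X) = X P_n(X +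
1), and it is the rising factorial, like the cycle polynomial of permutations. Using splits only,
non-ambiguous trees are counted by iterating the operator `mergeSum`. Words are counted by iterating
the same operator, because the largest blue letter and the red block after it contract to a single
red letter. The roles of height and width are exchanged, which transposition repairs.

Assembling. Let s = n_l + 1. A word of distinct numbers is cut uniquely into pieces: first into
blocks of letters all below, equal to or above s, then each block at its left-to-right maxima. By
Foata's correspondence the pieces below s are the cycles of one permutation and those above s the
cycles of another. The order of the pieces is a word in red and blue letters in which neighbours of
the same colour increase. The entry s is a run of size one when nothing smaller stands just before
it and nothing larger just after it. The first condition is automatic, as red 0 is the smallest red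
letter; the second says that no blue letter follows red 0. The words of trees have a different
condition, a red last letter, and exchanging neighbouring blocks after red 0 translates one into the
other: a tail running from blue to red becomes one running from red to blue.

Counting. Runs of size one are counted position by position: each of the two ends contributes n!/2
and each of the n - 2 inner positions n!/6. -/

theorem exists_equiv_of_rel {α β : Type*} (R : α → β → Prop)
    (h₁ : ∀ a, ∃ b, R a b) (h₂ : ∀ b, ∃ a, R a b)
    (u₁ : ∀ a b b', R a b → R a b' → b = b') (u₂ : ∀ a a' b, R a b → R a' b → a = a') :
    ∃ e : α ≃ β, ∀ a, R a (e a) := by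
  choose f hf using h₁
  choose g hg using h₂
  exact ⟨⟨f, g, fun a => u₂ _ _ _ (hg _) (hf _), fun b => u₁ _ _ _ (hf _) (hg _)⟩, hf⟩

/-! ### Building tableaux from predicates -/

namespace Tableau

theorem ext_mem {T T' : Tableau} (hs : ∀ i j, (i, j) ∈ T.shape ↔ (i, j) ∈ T'.shape)
    (hp : ∀ i j, (i, j) ∈ T.points ↔ (i, j) ∈ T'.points) : T = T' := by
  apply Tableau.ext
  · exact SetLike.ext fun ⟨i, j⟩ => hs i j
  · exact Finset.ext fun ⟨i, j⟩ => hp i j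

theorem mem_shape_of_mem_points (T : Tableau) {i j : ℕ} (h : (i, j) ∈ T.points) :
    (i, j) ∈ T.shape := (YoungDiagram.mem_cells _).1 (T.points_subset h)

theorem root_mem (T : Tableau) {i j : ℕ} (h : (i, j) ∈ T.shape) : (0, 0) ∈ T.points := by
  apply T.root
  intro h0
  rw [h0] at h
  exact YoungDiagram.notMem_bot _ h

theorem exists_bound (T : Tableau) : ∃ N, ∀ i j, (i, j) ∈ T.shape → i < N ∧ j < N := by
  refine ⟨T.shape.cells.sup Prod.fst + T.shape.cells.sup Prod.snd + 1, fun i j h => ?_⟩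
  have h' := (YoungDiagram.mem_cells _).2 h
  have h1 : i ≤ T.shape.cells.sup Prod.fst := Finset.le_sup (f := Prod.fst) h'
  have h2 : j ≤ T.shape.cells.sup Prod.snd := Finset.le_sup (f := Prod.snd) h'
  omega

/-- Construction of a tableau from the predicates describing its cells and its points. -/
theorem exists_of_pred (D P : ℕ → ℕ → Prop) (hfin : ∃ N, ∀ i j, D i j → i < N ∧ j < N)
    (hlow : ∀ i j i' j', i' ≤ i → j' ≤ j → D i j → D i' j') (hPD : ∀ i j, P i j → D i j)
    (hroot : ∀ i j, D i j → P 0 0)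
    (hparent : ∀ i j, P i j → (i, j) ≠ (0, 0) → Xor (∃ i' < i, P i' j) (∃ j' < j, P i j'))
    (hrow : ∀ i j, D i j → ∃ j', P i j') (hcol : ∀ i j, D i j → ∃ i', P i' j) :
    ∃ T : Tableau, (∀ i j, (i, j) ∈ T.shape ↔ D i j) ∧ ∀ i j, (i, j) ∈ T.points ↔ P i j := by
  classical
  obtain ⟨N, hN⟩ := hfin
  let box := Finset.range N ×ˢ Finset.range N
  let Y : YoungDiagram := ⟨box.filter fun c => D c.1 c.2, by
    rintro ⟨i, j⟩ ⟨i', j'⟩ ⟨h1, h2⟩ h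
    have h3 : D i j := (Finset.mem_filter.1 (Finset.mem_coe.1 h)).2
    have h4 := hlow _ _ _ _ h1 h2 h3
    have := hN _ _ h4
    simp [box, h4, this]⟩
  have hY : ∀ i j, (i, j) ∈ Y ↔ D i j := by
    intro i j
    rw [← YoungDiagram.mem_cells]
    simp only [Y, box, Finset.mem_filter, Finset.mem_product, Finset.mem_range]
    exact ⟨fun h => h.2, fun h => ⟨hN _ _ h, h⟩⟩
  let Q := box.filter fun c => P c.1 c.2
  have hQ : ∀ i j, (i, j) ∈ Q ↔ P i j := by
    intro i j
    simp only [Q, box, Finset.mem_filter, Finset.mem_product, Finset.mem_range]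
    exact ⟨fun h => h.2, fun h => ⟨hN _ _ (hPD _ _ h), h⟩⟩
  refine ⟨⟨Y, Q, ?_, ?_, ?_, ?_, ?_⟩, hY, hQ⟩
  · rintro ⟨i, j⟩ h
    exact (YoungDiagram.mem_cells _).2 ((hY i j).2 (hPD _ _ ((hQ i j).1 h)))
  · intro h
    rw [hQ]
    by_contra hne
    apply h
    refine SetLike.ext fun ⟨i, j⟩ => ?_
    rw [hY]
    exact ⟨fun hd => (hne (hroot _ _ hd)).elim, fun hb => (YoungDiagram.notMem_bot _ hb).elim⟩
  · simpa only [hQ] using hparent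
  · simpa only [hQ, hY] using hrow
  · simpa only [hQ, hY] using hcol

/-! ### Transposition -/

theorem exists_transpose (T : Tableau) : ∃ T' : Tableau,
    (∀ i j, (i, j) ∈ T'.shape ↔ (j, i) ∈ T.shape) ∧
      ∀ i j, (i, j) ∈ T'.points ↔ (j, i) ∈ T.points := by
  obtain ⟨N, hN⟩ := T.exists_bound
  refine exists_of_pred (fun i j => (j, i) ∈ T.shape) (fun i j => (j, i) ∈ T.points)
    ⟨N, fun i j h => (hN _ _ h).symm⟩
    (fun i j i' j' hi hj h => T.shape.up_left_mem hj hi h)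
    (fun i j h => T.mem_shape_of_mem_points h) (fun i j h => T.root_mem h) ?_
    (fun i j h => T.col_nonempty j i h) (fun i j h => T.row_nonempty j i h)
  intro i j h h0
  refine (xor_comm _ _).mp (T.parent j i h ?_)
  simp only [ne_eq, Prod.mk.injEq] at h0 ⊢
  tauto

/-- The transposed tableau. -/
noncomputable def transpose (T : Tableau) : Tableau := T.exists_transpose.choose

@[simp]
theorem mem_shape_transpose (T : Tableau) (i j : ℕ) :
    (i, j) ∈ T.transpose.shape ↔ (j, i) ∈ T.shape := T.exists_transpose.choose_spec.1 i j

@[simp]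
theorem mem_points_transpose (T : Tableau) (i j : ℕ) :
    (i, j) ∈ T.transpose.points ↔ (j, i) ∈ T.points := T.exists_transpose.choose_spec.2 i j

@[simp]
theorem transpose_transpose (T : Tableau) : T.transpose.transpose = T :=
  ext_mem (by simp) (by simp)

theorem points_transpose (T : Tableau) :
    T.transpose.points = T.points.map (Equiv.prodComm ℕ ℕ).toEmbedding := by
  ext ⟨i, j⟩
  simp

@[simp]
theorem size_transpose (T : Tableau) : T.transpose.size = T.size := by
  rw [size, points_transpose, Finset.card_map, size]

@[simp]
theorem firstCol_transpose (T : Tableau) : T.transpose.firstCol = T.firstRow := by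
  rw [firstCol, points_transpose, Finset.filter_map, Finset.card_map, firstRow]
  rfl

@[simp]
theorem firstRow_transpose (T : Tableau) : T.transpose.firstRow = T.firstCol := by
  rw [← firstCol_transpose, transpose_transpose]

/-! ### Growth -/

/-- The rows of the points in the first column. -/
def firstColRows (T : Tableau) : Finset ℕ := (T.points.filter fun c => c.2 = 0).image Prod.fst

@[simp]
theorem mem_firstColRows (T : Tableau) (a : ℕ) : a ∈ T.firstColRows ↔ (a, 0) ∈ T.points := by
  simp [firstColRows]

theorem card_firstColRows (T : Tableau) : T.firstColRows.card = T.firstCol := by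
  rw [firstColRows, Finset.card_image_of_injOn, firstCol]
  rintro ⟨a, b⟩ h ⟨a', b'⟩ h' hh
  simp at h h' hh
  simp [h, h', hh]

/-- `T'` is obtained from `T` by adding a pointed row of length one. -/
def IsAddRow (T T' : Tableau) : Prop :=
  (∀ a b, (a, b) ∈ T'.shape ↔ (a, b) ∈ T.shape ∨ (a = T.shape.colLen 0 ∧ b = 0)) ∧
    ∀ a b, (a, b) ∈ T'.points ↔ (a, b) ∈ T.points ∨ (a = T.shape.colLen 0 ∧ b = 0)

/-- `T'` is obtained from `T` by doubling the first column; the second copy of it gets the points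
in the rows in `S`, and the first one the other points together with the topmost point of `S`. -/
def IsSplit (T : Tableau) (S : Finset ℕ) (T' : Tableau) : Prop :=
  (∀ a, (a, 0) ∈ T'.shape ↔ (a, 0) ∈ T.shape) ∧
  (∀ a b, (a, b + 1) ∈ T'.shape ↔ (a, b) ∈ T.shape) ∧
  (∀ a, (a, 0) ∈ T'.points ↔ (a, 0) ∈ T.points ∧ (a ∈ S → ∀ s ∈ S, a ≤ s)) ∧
  (∀ a, (a, 1) ∈ T'.points ↔ a ∈ S) ∧
  ∀ a b, (a, b + 2) ∈ T'.points ↔ (a, b + 1) ∈ T.points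

theorem lt_colLen (T : Tableau) (a b : ℕ) : a < T.shape.colLen b ↔ (a, b) ∈ T.shape :=
  YoungDiagram.mem_iff_lt_colLen.symm

/-- The new cell is at the bottom of the first column, so it has the root above it and nothing to
its left. For the empty tableau it is the root itself. No old point lies in the new row, so old
parents are unaffected. -/
theorem exists_isAddRow (T : Tableau) : ∃ T', IsAddRow T T' := by
  obtain ⟨N, hN⟩ := T.exists_bound
  have hlen := T.lt_colLen
  obtain ⟨r, hr⟩ : ∃ r, r = T.shape.colLen 0 := ⟨_, rfl⟩
  unfold IsAddRow
  rw [← hr]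
  replace hlen : ∀ a, a < r ↔ (a, 0) ∈ T.shape := fun a => hr ▸ hlen a 0
  clear hr
  refine exists_of_pred _ _ ⟨N + r + 1, ?_⟩ ?_ ?_ ?_ ?_ ?_ ?_
  · rintro i j (h | ⟨rfl, rfl⟩)
    · have := hN _ _ h; omega
    · omega
  · rintro i j i' j' hi hj (h | ⟨rfl, rfl⟩)
    · exact Or.inl (T.shape.up_left_mem hi hj h)
    · rcases hi.lt_or_eq with h | h
      · left
        have : j' = 0 := by omega
        subst this
        exact (hlen _).1 h
      · right; omega
  · rintro i j (h | h)
    · exact Or.inl (T.mem_shape_of_mem_points h)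
    · exact Or.inr h
  · rintro i j (h | ⟨rfl, rfl⟩)
    · exact Or.inl (T.root_mem h)
    · rcases Nat.eq_zero_or_pos i with h | h
      · right; omega
      · left
        exact T.root_mem ((hlen 0).1 (by omega))
  · rintro i j (h | ⟨rfl, rfl⟩) h0
    · have h1 := T.parent i j h h0
      have hs := T.mem_shape_of_mem_points h
      have hi : i < r := by rw [hlen]; exact T.shape.up_left_mem le_rfl (Nat.zero_le _) hs
      have e1 : (∃ i' < i, (i', j) ∈ T.points ∨ i' = r ∧ j = 0) ↔ ∃ i' < i, (i', j) ∈ T.points := by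
        constructor
        · rintro ⟨i', h, h' | h'⟩
          · exact ⟨i', h, h'⟩
          · omega
        · rintro ⟨i', h, h'⟩
          exact ⟨i', h, Or.inl h'⟩
      have e2 : (∃ j' < j, (i, j') ∈ T.points ∨ i = r ∧ j' = 0) ↔ ∃ j' < j, (i, j') ∈ T.points := by
        constructor
        · rintro ⟨i', h, h' | h'⟩
          · exact ⟨i', h, h'⟩
          · omega
        · rintro ⟨i', h, h'⟩
          exact ⟨i', h, Or.inl h'⟩
      rw [e1, e2]
      exact h1
    · left
      have hi : 0 < i := by simp at h0; omega
      refine ⟨⟨0, hi, Or.inl (T.root_mem ((hlen 0).1 (by omega)))⟩, ?_⟩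
      rintro ⟨j', h, -⟩
      omega
  · rintro i j (h | ⟨rfl, rfl⟩)
    · obtain ⟨j', h'⟩ := T.row_nonempty i j h
      exact ⟨j', Or.inl h'⟩
    · exact ⟨0, Or.inr ⟨rfl, rfl⟩⟩
  · rintro i j (h | ⟨rfl, rfl⟩)
    · obtain ⟨j', h'⟩ := T.col_nonempty i j h
      exact ⟨j', Or.inl h'⟩
    · exact ⟨i, Or.inr ⟨rfl, rfl⟩⟩

/-- The topmost point `μ` of `S` is kept in both copies of the column. In the second copy it is the
only point with nothing above it, and also the only one with a point to its left. Points further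
right keep their parents, because a row is pointed in the old column exactly when it is pointed in
one of the two copies. -/
theorem exists_isSplit (T : Tableau) {S : Finset ℕ} (hS : S ⊆ T.firstColRows) (hne : S.Nonempty) :
    ∃ T', IsSplit T S T' := by
  obtain ⟨N, hN⟩ := T.exists_bound
  have hSp : ∀ a ∈ S, (a, 0) ∈ T.points := fun a h => (T.mem_firstColRows a).1 (hS h)
  obtain ⟨μ, hm, hmle⟩ : ∃ μ ∈ S, ∀ s ∈ S, μ ≤ s :=
    ⟨S.min' hne, S.min'_mem hne, fun s hs => S.min'_le s hs⟩
  have hle : ∀ a, (∀ s ∈ S, a ≤ s) ↔ a ≤ μ :=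
    fun a => ⟨fun h => h _ hm, fun h s hs => h.trans (hmle s hs)⟩
  have hroot : (0, 0) ∈ T.points := T.root_mem (T.mem_shape_of_mem_points (hSp _ hm))
  -- Truncated subtraction sends columns 0 and 1 both to the old column 0, which doubles it.
  let D : ℕ → ℕ → Prop := fun a b => (a, b - 1) ∈ T.shape
  let P : ℕ → ℕ → Prop := fun a b =>
    match b with
    | 0 => (a, 0) ∈ T.points ∧ (a ∈ S → ∀ s ∈ S, a ≤ s)
    | 1 => a ∈ S
    | b + 2 => (a, b + 1) ∈ T.points
  have hleft : ∀ a b, (∃ j' < b + 2, P a j') ↔ ∃ j' < b + 1, (a, j') ∈ T.points := by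
    intro a b
    constructor
    · rintro ⟨_ | _ | j, hj, h⟩
      · exact ⟨0, by omega, h.1⟩
      · exact ⟨0, by omega, hSp _ h⟩
      · exact ⟨j + 1, by omega, h⟩
    · rintro ⟨_ | j, hj, h⟩
      · by_cases ha : a ∈ S
        · exact ⟨1, by omega, ha⟩
        · exact ⟨0, by omega, h, fun h => (ha h).elim⟩
      · exact ⟨j + 2, by omega, h⟩
  refine Exists.imp (fun T' h => ⟨fun a => h.1 a 0, fun a b => h.1 a (b + 1), fun a => h.2 a 0,
    fun a => h.2 a 1, fun a b => h.2 a (b + 2)⟩) (exists_of_pred D P ?_ ?_ ?_ ?_ ?_ ?_ ?_)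
  · refine ⟨N + 1, fun i j h => ?_⟩
    have := hN _ _ h
    omega
  · intro i j i' j' hi hj h
    exact T.shape.up_left_mem hi (by omega) h
  · rintro i (_ | _ | j) h
    · exact T.mem_shape_of_mem_points h.1
    · exact T.mem_shape_of_mem_points (hSp _ h)
    · exact T.mem_shape_of_mem_points h
  · intro i j h
    exact ⟨hroot, fun _ s _ => Nat.zero_le s⟩
  · rintro i (_ | _ | j) h h0
    · left
      have hi : 0 < i := by simp at h0; omega
      refine ⟨⟨0, hi, hroot, fun _ s _ => Nat.zero_le s⟩, ?_⟩
      rintro ⟨j', h, -⟩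
      omega
    · have e1 : (∃ i' < i, P i' 1) ↔ i ≠ μ := by
        constructor
        · rintro ⟨i', hi, h'⟩ rfl
          have := hmle _ h'
          omega
        · intro hne
          have := hmle _ h
          exact ⟨μ, by omega, hm⟩
      have e2 : (∃ j' < 1, P i j') ↔ i = μ := by
        constructor
        · rintro ⟨j', hj, h'⟩
          have : j' = 0 := by omega
          subst this
          exact le_antisymm (h'.2 h _ hm) (hmle _ h)
        · rintro rfl
          exact ⟨0, by omega, hSp _ h, fun _ => hmle⟩
      change Xor (∃ i' < i, P i' 1) (∃ j' < 1, P i j')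
      rw [e1, e2]
      by_cases h : i = μ
      · exact Or.inr ⟨h, fun h' => h' h⟩
      · exact Or.inl ⟨h, h⟩
    · change Xor (∃ i' < i, (i', j + 1) ∈ T.points) (∃ j' < j + 2, P i j')
      rw [hleft]
      exact T.parent i (j + 1) h (by simp)
  · intro i j h
    obtain ⟨j', h'⟩ := T.row_nonempty _ _ h
    obtain ⟨k, -, hk⟩ := (hleft i j').2 ⟨j', by omega, h'⟩
    exact ⟨k, hk⟩
  · rintro i (_ | _ | j) h
    · exact ⟨0, hroot, fun _ s _ => Nat.zero_le s⟩
    · exact ⟨μ, hm⟩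
    · exact T.col_nonempty _ _ h

end Tableau
end TreeLike

/-! ### Undoing a growth step -/

namespace TreeLike
namespace Tableau

/-- A bottom row of length one consists of a single pointed cell, with nothing below it or to its
right, so no other point has it as parent. Deleting it is harmless: the first column, if anything
remains of it, still contains the root. -/
theorem exists_isAddRow_right (T' : Tableau) {r : ℕ} (hr : (r, 0) ∈ T'.shape)
    (hr1 : (r, 1) ∉ T'.shape) (hr0 : (r + 1, 0) ∉ T'.shape) : ∃ T, IsAddRow T T' := by
  obtain ⟨N, hN⟩ := T'.exists_bound
  have hlt : ∀ a b, (a, b) ∈ T'.shape → a ≤ r := fun a b h => by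
    by_contra hlt
    exact hr0 (T'.shape.up_left_mem (by omega) (Nat.zero_le _) h)
  have hrow : ∀ b, (r, b) ∈ T'.shape → b = 0 := fun b h => by
    by_contra hlt
    exact hr1 (T'.shape.up_left_mem le_rfl (by omega) h)
  have hrp : (r, 0) ∈ T'.points := by
    obtain ⟨j, h⟩ := T'.row_nonempty _ _ hr
    rwa [hrow _ (T'.mem_shape_of_mem_points h)] at h
  have hroot := T'.root_mem hr
  obtain ⟨T, h1, h2⟩ : ∃ T : Tableau, (∀ i j, (i, j) ∈ T.shape ↔ (i, j) ∈ T'.shape ∧ i < r) ∧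
      ∀ i j, (i, j) ∈ T.points ↔ (i, j) ∈ T'.points ∧ i < r := by
    refine exists_of_pred _ _ ⟨N, fun i j h => hN _ _ h.1⟩ ?_ ?_ ?_ ?_ ?_ ?_
    · exact fun i j i' j' hi hj h => ⟨T'.shape.up_left_mem hi hj h.1, by omega⟩
    · exact fun i j h => ⟨T'.mem_shape_of_mem_points h.1, h.2⟩
    · exact fun i j h => ⟨hroot, by omega⟩
    · rintro i j ⟨h, hi⟩ h0
      have e1 : (∃ i' < i, (i', j) ∈ T'.points ∧ i' < r) ↔ ∃ i' < i, (i', j) ∈ T'.points :=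
        exists_congr fun k => ⟨fun h => ⟨h.1, h.2.1⟩, fun h => ⟨h.1, h.2, by omega⟩⟩
      simp only [e1, hi, and_true]
      exact T'.parent i j h h0
    · rintro i j ⟨h, hi⟩
      obtain ⟨k, hk⟩ := T'.row_nonempty _ _ h
      exact ⟨k, hk, hi⟩
    · rintro i j ⟨h, hi⟩
      obtain ⟨k, hk⟩ := T'.col_nonempty _ _ h
      rcases (hlt _ _ (T'.mem_shape_of_mem_points hk)).lt_or_eq with h' | rfl
      · exact ⟨k, hk, h'⟩
      · rw [hrow _ (T'.mem_shape_of_mem_points hk)]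
        exact ⟨0, hroot, by omega⟩
  have hlen : T.shape.colLen 0 = r := by
    refine eq_of_forall_lt_iff fun a => ?_
    rw [lt_colLen, h1]
    exact ⟨fun h => h.2, fun h => ⟨T'.shape.up_left_mem h.le le_rfl hr, h⟩⟩
  refine ⟨T, fun a b => ?_, fun a b => ?_⟩
  · rw [hlen, h1]
    constructor
    · intro h
      rcases (hlt _ _ h).lt_or_eq with h' | rfl
      · exact Or.inl ⟨h, h'⟩
      · exact Or.inr ⟨rfl, hrow _ h⟩
    · rintro (h | ⟨rfl, rfl⟩)
      exacts [h.1, hr]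
  · rw [hlen, h2]
    constructor
    · intro h
      rcases (hlt _ _ (T'.mem_shape_of_mem_points h)).lt_or_eq with h' | rfl
      · exact Or.inl ⟨h, h'⟩
      · exact Or.inr ⟨rfl, hrow _ (T'.mem_shape_of_mem_points h)⟩
    · rintro (h | ⟨rfl, rfl⟩)
      exacts [h.1, hrp]

/-- First columns of equal length can be merged. A row pointed in both has a point of column 1 with
a point to its left, hence none above it; conversely the topmost point of column 1 has nothing above
it, hence a left neighbour. So the doubly pointed row is exactly the topmost row of `S`, the set of
rows pointed in column 1. -/
theorem exists_isSplit_right (T' : Tableau) (h0 : (0, 0) ∈ T'.shape)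
    (hcols : ∀ a, (a, 0) ∈ T'.shape → (a, 1) ∈ T'.shape) :
    ∃ T S, S ⊆ T.firstColRows ∧ S.Nonempty ∧ IsSplit T S T' := by
  obtain ⟨N, hN⟩ := T'.exists_bound
  have hroot := T'.root_mem h0
  let P : ℕ → ℕ → Prop := fun a b =>
    match b with
    | 0 => (a, 0) ∈ T'.points ∨ (a, 1) ∈ T'.points
    | b + 1 => (a, b + 2) ∈ T'.points
  have hleft : ∀ a b, (∃ j' < b + 1, P a j') ↔ ∃ j' < b + 2, (a, j') ∈ T'.points := by
    intro a b
    constructor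
    · rintro ⟨_ | j, hj, h⟩
      · rcases h with h | h
        · exact ⟨0, by omega, h⟩
        · exact ⟨1, by omega, h⟩
      · exact ⟨j + 2, by omega, h⟩
    · rintro ⟨_ | _ | j, hj, h⟩
      · exact ⟨0, by omega, Or.inl h⟩
      · exact ⟨0, by omega, Or.inr h⟩
      · exact ⟨j + 1, by omega, h⟩
  obtain ⟨T, h1, h2⟩ : ∃ T : Tableau, (∀ i j, (i, j) ∈ T.shape ↔ (i, j + 1) ∈ T'.shape) ∧
      ∀ i j, (i, j) ∈ T.points ↔ P i j := by
    refine exists_of_pred _ _ ⟨N, fun i j h => ?_⟩ ?_ ?_ ?_ ?_ ?_ ?_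
    · have := hN _ _ h
      omega
    · exact fun i j i' j' hi hj h => T'.shape.up_left_mem hi (by omega) h
    · rintro i (_ | j) h
      · rcases h with h | h
        · exact hcols _ (T'.mem_shape_of_mem_points h)
        · exact T'.mem_shape_of_mem_points h
      · exact T'.mem_shape_of_mem_points h
    · exact fun i j h => Or.inl hroot
    · rintro i (_ | j) h hne
      · left
        have hi : 0 < i := by simp at hne; omega
        refine ⟨⟨0, hi, Or.inl hroot⟩, ?_⟩
        rintro ⟨j', h, -⟩
        omega
      · rw [hleft]
        exact T'.parent i (j + 2) h (by simp)
    · intro i j h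
      obtain ⟨k, hk⟩ := T'.row_nonempty _ _ h
      obtain ⟨k', -, h'⟩ := (hleft i k).2 ⟨k, by omega, hk⟩
      exact ⟨k', h'⟩
    · rintro i (_ | j) h
      · exact ⟨0, Or.inl hroot⟩
      · exact T'.col_nonempty _ _ h
  let S : Finset ℕ := (T'.points.filter fun c => c.2 = 1).image Prod.fst
  have hS : ∀ a, a ∈ S ↔ (a, 1) ∈ T'.points := fun a => by simp [S]
  refine ⟨T, S, fun a ha => ?_, ?_, fun a => ?_, fun a b => ?_, fun a => ?_, fun a => ?_,
    fun a b => ?_⟩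
  · rw [mem_firstColRows, h2]
    exact Or.inr ((hS a).1 ha)
  · obtain ⟨i, hi⟩ := T'.col_nonempty _ _ (hcols _ h0)
    exact ⟨i, (hS i).2 hi⟩
  · rw [h1]
    exact ⟨hcols a, fun h => T'.shape.up_left_mem le_rfl (Nat.zero_le _) h⟩
  · rw [h1]
  · rw [h2, hS]
    constructor
    · refine fun h => ⟨Or.inl h, fun h' s hs => ?_⟩
      by_contra hlt
      have hx := T'.parent a 1 h' (by simp)
      rcases hx with hx | hx
      · exact hx.2 ⟨0, by omega, h⟩
      · exact hx.2 ⟨s, by omega, (hS s).1 hs⟩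
    · rintro ⟨h | h, h'⟩
      · exact h
      · have hx := T'.parent a 1 h (by simp)
        rcases hx with ⟨⟨i, hi, hx⟩, -⟩ | ⟨⟨j, hj, hx⟩, -⟩
        · have := h' h i ((hS i).2 hx)
          omega
        · have : j = 0 := by omega
          rwa [this] at hx
  · exact (hS a).symm
  · rw [h2]

theorem IsAddRow.right_unique {T T₁ T₂ : Tableau} (h₁ : IsAddRow T T₁) (h₂ : IsAddRow T T₂) :
    T₁ = T₂ :=
  ext_mem (fun a b => by rw [h₁.1, h₂.1]) (fun a b => by rw [h₁.2, h₂.2])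

theorem IsAddRow.left_unique {T₁ T₂ T : Tableau} (h₁ : IsAddRow T₁ T) (h₂ : IsAddRow T₂ T) :
    T₁ = T₂ := by
  have hlen : ∀ T₁, IsAddRow T₁ T → T.shape.colLen 0 = T₁.shape.colLen 0 + 1 := by
    intro T₁ h₁
    refine eq_of_forall_lt_iff fun a => ?_
    rw [lt_colLen, h₁.1, ← lt_colLen]
    omega
  have hr : T₁.shape.colLen 0 = T₂.shape.colLen 0 := by
    have := hlen _ h₁
    have := hlen _ h₂
    omega
  have hn : ∀ T₁ : Tableau, (T₁.shape.colLen 0, 0) ∉ T₁.shape := fun T₁ => by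
    rw [← lt_colLen]; exact lt_irrefl _
  have hn₁ := hn T₁
  have hn₂ := hn T₂
  obtain ⟨a1, b1⟩ := h₁
  obtain ⟨a2, b2⟩ := h₂
  rw [← hr] at a2 b2 hn₂
  refine ext_mem (fun a b => ?_) (fun a b => ?_)
  · have h3 := a1 a b
    rw [a2] at h3
    by_cases h : a = T₁.shape.colLen 0 ∧ b = 0
    · obtain ⟨rfl, rfl⟩ := h
      exact iff_of_false hn₁ hn₂
    · simpa [h] using h3.symm
  · have h3 := b1 a b
    rw [b2] at h3
    by_cases h : a = T₁.shape.colLen 0 ∧ b = 0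
    · obtain ⟨rfl, rfl⟩ := h
      exact iff_of_false (fun h => hn₁ (mem_shape_of_mem_points _ h))
        (fun h => hn₂ (mem_shape_of_mem_points _ h))
    · simpa [h] using h3.symm

theorem IsSplit.right_unique {T T₁ T₂ : Tableau} {S : Finset ℕ} (h₁ : IsSplit T S T₁)
    (h₂ : IsSplit T S T₂) : T₁ = T₂ := by
  obtain ⟨a1, a2, a3, a4, a5⟩ := h₁
  obtain ⟨b1, b2, b3, b4, b5⟩ := h₂
  refine ext_mem (fun a b => ?_) (fun a b => ?_)
  · rcases b with _ | b
    · rw [a1, b1]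
    · rw [a2, b2]
  · rcases b with _ | _ | b
    · rw [a3, b3]
    · rw [a4, b4]
    · rw [a5, b5]

theorem IsSplit.mem_points_iff {T T' : Tableau} {S : Finset ℕ} (h : IsSplit T S T')
    (hS : S ⊆ T.firstColRows) (a : ℕ) :
    (a, 0) ∈ T.points ↔ (a, 0) ∈ T'.points ∨ a ∈ S := by
  rw [h.2.2.1]
  have := @hS a
  rw [mem_firstColRows] at this
  tauto

theorem IsSplit.left_unique {T₁ T₂ T : Tableau} {S₁ S₂ : Finset ℕ} (h₁ : IsSplit T₁ S₁ T)
    (h₂ : IsSplit T₂ S₂ T) (hS₁ : S₁ ⊆ T₁.firstColRows) (hS₂ : S₂ ⊆ T₂.firstColRows) :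
    T₁ = T₂ ∧ S₁ = S₂ := by
  have hS : S₁ = S₂ := Finset.ext fun a => by rw [← h₁.2.2.2.1, h₂.2.2.2.1]
  subst hS
  refine ⟨ext_mem (fun a b => ?_) (fun a b => ?_), rfl⟩
  · rw [← h₁.2.1, h₂.2.1]
  · rcases b with _ | b
    · rw [h₁.mem_points_iff hS₁, h₂.mem_points_iff hS₂]
    · rw [← h₁.2.2.2.2, h₂.2.2.2.2]

theorem IsSplit.mem_shape {T T' : Tableau} {S : Finset ℕ} (h : IsSplit T S T') {a : ℕ}
    (ha : (a, 0) ∈ T'.shape) : (a, 1) ∈ T'.shape := by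
  rwa [h.2.1, ← h.1]

/-- Together with `IsSplit.mem_shape` this makes the two growth steps exclusive: the shape of the
result reveals which one was used. -/
theorem IsAddRow.exists_notMem_shape {T T' : Tableau} (h : IsAddRow T T') :
    ∃ a, (a, 0) ∈ T'.shape ∧ (a, 1) ∉ T'.shape := by
  refine ⟨T.shape.colLen 0, (h.1 _ _).2 (Or.inr ⟨rfl, rfl⟩), ?_⟩
  rw [h.1]
  rintro (h | h)
  · have := T.shape.up_left_mem le_rfl (Nat.zero_le 1) h
    rw [← lt_colLen] at this
    omega
  · omega

theorem IsAddRow.points_eq {T T' : Tableau} (h : IsAddRow T T') :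
    T'.points = insert (T.shape.colLen 0, 0) T.points := by
  ext ⟨a, b⟩
  rw [h.2, Finset.mem_insert, Prod.mk.injEq, or_comm]

theorem colLen_notMem_points (T : Tableau) : (T.shape.colLen 0, 0) ∉ T.points := by
  intro h
  have := T.mem_shape_of_mem_points h
  rw [← lt_colLen] at this
  omega

theorem IsAddRow.size_eq {T T' : Tableau} (h : IsAddRow T T') : T'.size = T.size + 1 := by
  rw [size, h.points_eq, Finset.card_insert_of_notMem T.colLen_notMem_points, size]

theorem IsAddRow.firstCol_eq {T T' : Tableau} (h : IsAddRow T T') :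
    T'.firstCol = T.firstCol + 1 := by
  rw [firstCol, h.points_eq, Finset.filter_insert, if_pos rfl, Finset.card_insert_of_notMem,
    firstCol]
  exact fun h => T.colLen_notMem_points (Finset.mem_filter.1 h).1

/-- The new first column and `S` together cover the old first column and meet only in the topmost
row of `S`, so this is inclusion–exclusion. The additive form avoids truncated subtraction. -/
theorem IsSplit.firstCol_add {T T' : Tableau} {S : Finset ℕ} (h : IsSplit T S T')
    (hS : S ⊆ T.firstColRows) (hne : S.Nonempty) : T'.firstCol + S.card = T.firstCol + 1 := by
  rw [← card_firstColRows, ← card_firstColRows]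
  have h1 : T'.firstColRows ∪ S = T.firstColRows := by
    ext a
    rw [Finset.mem_union, mem_firstColRows, mem_firstColRows, ← h.mem_points_iff hS]
  have h2 : T'.firstColRows ∩ S = {S.min' hne} := by
    ext a
    rw [Finset.mem_inter, mem_firstColRows, Finset.mem_singleton, h.2.2.1]
    constructor
    · rintro ⟨⟨_, h⟩, h'⟩
      exact le_antisymm (h h' _ (S.min'_mem hne)) (S.min'_le _ h')
    · rintro rfl
      exact ⟨⟨(T.mem_firstColRows _).1 (hS (S.min'_mem hne)), fun _ s hs => S.min'_le _ hs⟩,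
        S.min'_mem hne⟩
  have := Finset.card_union_add_card_inter T'.firstColRows S
  rw [h1, h2, Finset.card_singleton] at this
  exact this.symm

/-- Column 1 has |S| points and all further columns are shifted copies. What the first column loses
is |S| - 1, so the net gain is one point. -/
theorem IsSplit.size_eq {T T' : Tableau} {S : Finset ℕ} (h : IsSplit T S T')
    (hS : S ⊆ T.firstColRows) (hne : S.Nonempty) : T'.size = T.size + 1 := by
  have e1 : T.size = T.firstCol + (T.points.filter fun c => ¬ c.2 = 0).card :=
    (Finset.card_filter_add_card_filter_not _).symm
  have e2 : T'.size = T'.firstCol + (T'.points.filter fun c => ¬ c.2 = 0).card :=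
    (Finset.card_filter_add_card_filter_not _).symm
  have e3 : (T'.points.filter fun c => ¬ c.2 = 0) =
      S.image (fun a => (a, 1)) ∪
        (T.points.filter fun c => ¬ c.2 = 0).image (fun c => (c.1, c.2 + 1)) := by
    ext ⟨a, b⟩
    rcases b with _ | _ | b
    · simp
    · simp [h.2.2.2.1]
    · have := h.2.2.2.2 a b
      simp [this]
  have e4 : (T'.points.filter fun c => ¬ c.2 = 0).card =
      S.card + (T.points.filter fun c => ¬ c.2 = 0).card := by
    rw [e3, Finset.card_union_of_disjoint, Finset.card_image_of_injective,
      Finset.card_image_of_injective]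
    · intro a b h
      simpa [Prod.ext_iff] using h
    · intro a b h
      simpa using h
    · rw [Finset.disjoint_left]
      rintro ⟨a, b⟩ h1 h2
      simp only [Finset.mem_image, Finset.mem_filter, Prod.mk.injEq] at h1 h2
      grind
  have := h.firstCol_add hS hne
  omega

/-- `T'` is obtained from `T` by adding a pointed row if `S` is empty, and by splitting the first
column along `S` otherwise. -/
def IsGrow (T : Tableau) (S : Finset ℕ) (T' : Tableau) : Prop :=
  (S = ∅ → IsAddRow T T') ∧ (S.Nonempty → IsSplit T S T')

end Tableau

/-! ### The growth bijections -/

open Tableau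

/-- The shape decides how the last step is undone: either the first two columns have equal length
and are merged, or the bottom row has length one and is removed. The formula for `firstCol` covers
both cases, since S = ∅ adds one point to the column. -/
theorem exists_growEquiv (n : ℕ) :
    ∃ e : (Σ T : Tableaux n, {S : Finset ℕ // S ⊆ T.1.firstColRows}) ≃ Tableaux (n + 1),
      ∀ x, (e x).1.firstCol + x.2.1.card = x.1.1.firstCol + 1 := by
  have hsize : ∀ {T T' : Tableau} {S : Finset ℕ}, S ⊆ T.firstColRows → IsGrow T S T' →
      T'.size = T.size + 1 := by
    intro T T' S hS h
    rcases S.eq_empty_or_nonempty with h' | h'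
    · exact (h.1 h').size_eq
    · exact (h.2 h').size_eq hS h'
  refine (exists_equiv_of_rel
    (α := Σ T : Tableaux n, {S : Finset ℕ // S ⊆ T.1.firstColRows}) (β := Tableaux (n + 1))
    (fun x T' => IsGrow x.1.1 x.2.1 T'.1) ?_ ?_ ?_ ?_).imp fun e he => ?_
  rotate_right
  · intro x
    rcases x.2.1.eq_empty_or_nonempty with h' | h'
    · rw [h', ((he x).1 h').firstCol_eq, Finset.card_empty, add_zero]
    · exact ((he x).2 h').firstCol_add x.2.2 h'
  · rintro ⟨⟨T, hT⟩, S, hS⟩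
    rcases S.eq_empty_or_nonempty with h' | h'
    · obtain ⟨T', hT'⟩ := T.exists_isAddRow
      exact ⟨⟨T', hT ▸ hT'.size_eq⟩, fun _ => hT', fun h => (h.ne_empty h').elim⟩
    · obtain ⟨T', hT'⟩ := T.exists_isSplit hS h'
      exact ⟨⟨T', hT ▸ hT'.size_eq hS h'⟩, fun h => (h'.ne_empty h).elim, fun _ => hT'⟩
  · rintro ⟨T', hT'⟩
    have h00 : (0, 0) ∈ T'.shape := by
      obtain ⟨⟨i, j⟩, hij⟩ : T'.points.Nonempty := by
        rw [← Finset.card_pos]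
        change 0 < T'.size
        omega
      exact T'.shape.up_left_mem (Nat.zero_le _) (Nat.zero_le _) (T'.mem_shape_of_mem_points hij)
    by_cases hcols : ∀ a, (a, 0) ∈ T'.shape → (a, 1) ∈ T'.shape
    · obtain ⟨T, S, hS, hne, h⟩ := T'.exists_isSplit_right h00 hcols
      have hg : IsGrow T S T' := ⟨fun h => (hne.ne_empty h).elim, fun _ => h⟩
      have := hsize hS hg
      exact ⟨⟨⟨T, by omega⟩, S, hS⟩, hg⟩
    · push Not at hcols
      obtain ⟨a, ha, ha1⟩ := hcols
      -- Here `r` is the bottom row. Some row `a ≤ r` does not reach column 1, and rows get no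
      -- longer downwards, so the bottom row has length one.
      obtain ⟨r, hr⟩ : ∃ r, T'.shape.colLen 0 = r + 1 :=
        Nat.exists_eq_add_one_of_ne_zero (Nat.pos_iff_ne_zero.1 ((T'.lt_colLen 0 0).2 h00))
      have har : a ≤ r := by
        have := (T'.lt_colLen a 0).2 ha
        omega
      obtain ⟨T, h⟩ := T'.exists_isAddRow_right (r := r) ((T'.lt_colLen _ _).1 (by omega))
        (fun h => ha1 (T'.shape.up_left_mem har le_rfl h))
        (fun h => by have := (T'.lt_colLen _ _).2 h; omega)
      have hg : IsGrow T ∅ T' := ⟨fun _ => h, fun h => (h.ne_empty rfl).elim⟩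
      have := hsize (Finset.empty_subset _) hg
      exact ⟨⟨⟨T, by omega⟩, ∅, Finset.empty_subset _⟩, hg⟩
  · rintro ⟨⟨T, hT⟩, S, hS⟩ ⟨T₁, _⟩ ⟨T₂, _⟩ h₁ h₂
    apply Subtype.ext
    rcases S.eq_empty_or_nonempty with h' | h'
    · exact (h₁.1 h').right_unique (h₂.1 h')
    · exact (h₁.2 h').right_unique (h₂.2 h')
  · rintro ⟨⟨T₁, hT₁⟩, S₁, hS₁⟩ ⟨⟨T₂, hT₂⟩, S₂, hS₂⟩ ⟨T, _⟩ h₁ h₂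
    have key : T₁ = T₂ ∧ S₁ = S₂ := by
      rcases S₁.eq_empty_or_nonempty with h | h <;> rcases S₂.eq_empty_or_nonempty with h' | h'
      · exact ⟨(h₁.1 h).left_unique (h₂.1 h'), h.trans h'.symm⟩
      · obtain ⟨a, ha, ha'⟩ := (h₁.1 h).exists_notMem_shape
        exact (ha' ((h₂.2 h').mem_shape ha)).elim
      · obtain ⟨a, ha, ha'⟩ := (h₂.1 h').exists_notMem_shape
        exact (ha' ((h₁.2 h).mem_shape ha)).elim
      · exact (h₁.2 h).left_unique (h₂.2 h') hS₁ hS₂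
    obtain ⟨rfl, rfl⟩ := key
    rfl

theorem Tableau.IsSplit.rectangle_iff {T T' : Tableau} {S : Finset ℕ} (h : IsSplit T S T') (p w : ℕ) :
    (∀ i j, (i, j) ∈ T.shape ↔ i ≤ p ∧ j ≤ w) ↔
      ∀ i j, (i, j) ∈ T'.shape ↔ i ≤ p ∧ j ≤ w + 1 := by
  constructor
  · rintro hT i (_ | j)
    · rw [h.1, hT]
      simp
    · rw [h.2.1, hT]
      simp
  · intro hT i j
    rw [← h.2.1, hT]
    simp

/-- In a rectangle with at least two columns the first two have equal length, so every such tree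
comes from a split; the case S = ∅ does not occur. -/
theorem exists_natSplitEquiv (p w : ℕ) :
    ∃ e : (Σ T : NonAmbiguousTree p w,
        {S : Finset ℕ // S ⊆ T.1.firstColRows ∧ S.Nonempty}) ≃ NonAmbiguousTree p (w + 1),
      ∀ x, (e x).1.firstCol + x.2.1.card = x.1.1.firstCol + 1 := by
  refine (exists_equiv_of_rel
    (α := Σ T : NonAmbiguousTree p w, {S : Finset ℕ // S ⊆ T.1.firstColRows ∧ S.Nonempty})
    (β := NonAmbiguousTree p (w + 1)) (fun x T' => IsSplit x.1.1 x.2.1 T'.1) ?_ ?_ ?_ ?_).imp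
    fun e he x => (he x).firstCol_add x.2.2.1 x.2.2.2
  · rintro ⟨⟨T, hT⟩, S, hS, hne⟩
    obtain ⟨T', hT'⟩ := T.exists_isSplit hS hne
    exact ⟨⟨T', (hT'.rectangle_iff p w).1 hT⟩, hT'⟩
  · rintro ⟨T', hT'⟩
    obtain ⟨T, S, hS, hne, h⟩ := T'.exists_isSplit_right ((hT' 0 0).2 ⟨by omega, by omega⟩)
      (fun a ha => (hT' a 1).2 ⟨((hT' a 0).1 ha).1, by omega⟩)
    exact ⟨⟨⟨T, (h.rectangle_iff p w).2 hT'⟩, S, hS, hne⟩, h⟩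
  · rintro ⟨⟨T, hT⟩, S, hS⟩ ⟨T₁, _⟩ ⟨T₂, _⟩ h₁ h₂
    exact Subtype.ext (h₁.right_unique h₂)
  · rintro ⟨⟨T₁, hT₁⟩, S₁, hS₁⟩ ⟨⟨T₂, hT₂⟩, S₂, hS₂⟩ ⟨T, _⟩ h₁ h₂
    obtain ⟨rfl, rfl⟩ := h₁.left_unique h₂ hS₁.1 hS₂.1
    rfl

end TreeLike

namespace TreeLike
open Polynomial Tableau

/-! ### Enumeration of tree-like tableaux -/

/-- The coefficient of `X ^ k` is the size of the fibre over `k`, so corresponding fibres are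
equinumerous and their bijections glue. -/
theorem exists_equiv_of_sum_X_pow_eq {α β : Type*} [Fintype α] [Fintype β] (f : α → ℕ) (g : β → ℕ)
    (h : ∑ a, (X : ℕ[X]) ^ f a = ∑ b, X ^ g b) : ∃ e : α ≃ β, ∀ a, g (e a) = f a := by
  classical
  have hc : ∀ k, Nonempty ({a // f a = k} ≃ {b // g b = k}) := by
    intro k
    rw [← Fintype.card_eq, Fintype.card_subtype, Fintype.card_subtype]
    have := congrArg (fun p => p.coeff k) h
    simpa [finsetSum_coeff, coeff_X_pow, eq_comm (a := k)] using this
  let F := fun k => (hc k).some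
  refine ⟨(Equiv.sigmaFiberEquiv f).symm.trans
    ((Equiv.sigmaCongrRight F).trans (Equiv.sigmaFiberEquiv g)), fun a => ?_⟩
  simp only [Equiv.trans_apply, Equiv.sigmaFiberEquiv, Equiv.coe_fn_mk, Equiv.coe_fn_symm_mk,
    Equiv.sigmaCongrRight_apply]
  exact (F (f a) ⟨a, rfl⟩).2

instance : Unique (Tableaux 0) where
  default := ⟨⟨⊥, ∅, by simp, by simp, by simp, by simp, by simp⟩, rfl⟩
  uniq := by
    rintro ⟨T, hT⟩
    have hp : T.points = ∅ := Finset.card_eq_zero.1 hT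
    have hs : ∀ i j, (i, j) ∉ T.shape := fun i j h => by
      have := T.root_mem h
      simp [hp] at this
    apply Subtype.ext
    refine ext_mem (fun i j => ?_) (fun i j => ?_)
    · exact iff_of_false (hs i j) (YoungDiagram.notMem_bot _)
    · rw [hp]

instance (n : ℕ) : Finite (Tableaux n) := by
  induction n with
  | zero => infer_instance
  | succ n ih =>
    obtain ⟨e, -⟩ := exists_growEquiv n
    have : ∀ T : Tableaux n, Finite {S : Finset ℕ // S ⊆ T.1.firstColRows} := fun T =>
      Set.Finite.to_subtype ((Finset.finite_toSet T.1.firstColRows.powerset).subset fun S hS =>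
        Finset.mem_coe.2 (Finset.mem_powerset.2 hS))
    exact Finite.of_equiv _ e

noncomputable instance (n : ℕ) : Fintype (Tableaux n) := Fintype.ofFinite _

/-- A tableau with k points in its first column contributes, over all S, the sum of X^(k+1-|S|),
which is X (X + 1)^k by the binomial theorem. This is the recursion P_{n+1}(X) = X P_n(X + 1) of the
rising factorial. -/
theorem sum_X_pow_firstCol (n : ℕ) :
    ∑ T : Tableaux n, (X : ℕ[X]) ^ T.1.firstCol = ascPochhammer ℕ n := by
  classical
  induction n with
  | zero =>
    rw [Fintype.sum_unique]
    rfl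
  | succ n ih =>
    obtain ⟨e, he⟩ := exists_growEquiv n
    have : ∀ T : Tableaux n, Fintype {S : Finset ℕ // S ⊆ T.1.firstColRows} := fun T =>
      Fintype.subtype T.1.firstColRows.powerset (by simp)
    rw [← Equiv.sum_comp e, Fintype.sum_sigma, ascPochhammer_succ_left, ← ih,
      ← Polynomial.coe_compRingHom_apply, map_sum, Finset.mul_sum]
    refine Finset.sum_congr rfl fun T _ => ?_
    simp only [map_pow, Polynomial.coe_compRingHom_apply, X_comp]
    rw [← card_firstColRows T.1, add_comm X, ← Finset.sum_pow_mul_eq_add_pow, Finset.mul_sum]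
    refine Eq.trans ?_ (Finset.sum_subtype T.1.firstColRows.powerset
      (p := fun S => S ⊆ T.1.firstColRows) (F := this T) (fun S => Finset.mem_powerset) _).symm
    refine Finset.sum_congr rfl fun S _ => ?_
    have h1 := he ⟨T, S⟩
    have h2 := Finset.card_le_card S.2
    rw [one_pow, one_mul, ← pow_succ']
    congr 1
    rw [← card_firstColRows T.1] at h1
    simp only at h1
    omega

/-! ### Enumeration of permutations by cycles -/

/-- This is what lets functions descend to the set of cycles in the two counts below. -/
theorem sameCycle_congr {α β : Type*} {σ : Equiv.Perm α} {f : α → β} (h : ∀ x, f (σ x) = f x)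
    {x y : α} (hxy : σ.SameCycle x y) : f x = f y := by
  obtain ⟨i, rfl⟩ := hxy
  have hn : ∀ (k : ℕ) z, f ((σ ^ k) z) = f z := by
    intro k
    induction k with
    | zero => simp
    | succ k ih => intro z; rw [pow_succ', Equiv.Perm.mul_apply, h, ih]
  obtain ⟨k, rfl | rfl⟩ := i.eq_nat_or_neg
  · rw [zpow_natCast, hn]
  · have := hn k ((σ ^ (-(k : ℤ))) x)
    rwa [← Equiv.Perm.mul_apply, ← zpow_natCast, ← zpow_add, add_neg_cancel, zpow_zero,
      Equiv.Perm.one_apply] at this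

/-- Here 0 is a new fixed point and the rest of the permutation is a shifted copy of `π`; the extra
cycle is the `none` of an `Option`. -/
theorem numCycles_decomposeFin_zero {n : ℕ} (π : Equiv.Perm (Fin n)) :
    numCycles (Equiv.Perm.decomposeFin.symm (0, π)) = numCycles π + 1 := by
  set σ := Equiv.Perm.decomposeFin.symm (0, π)
  have h0 : σ 0 = 0 := by simp [σ]
  have hs : ∀ x : Fin n, σ x.succ = (π x).succ := by intro x; simp [σ]
  rw [numCycles, numCycles, ← Finite.card_option]
  let f : Fin (n + 1) → Option (Quotient (Equiv.Perm.SameCycle.setoid π)) :=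
    Fin.cases none fun x => some (Quotient.mk _ x)
  have hf : ∀ x, f (σ x) = f x := by
    refine Fin.cases ?_ fun x => ?_
    · rw [h0]
    · rw [hs]
      simp only [f, Fin.cases_succ]
      exact congrArg some (Quotient.sound (show π.SameCycle _ _ from
        Equiv.Perm.sameCycle_apply_left.2 (.refl _ _)))
  let g : Fin n → Quotient (Equiv.Perm.SameCycle.setoid σ) := fun x => Quotient.mk _ x.succ
  have hg : ∀ x, g (π x) = g x := fun x =>
    Quotient.sound (show σ.SameCycle _ _ by
    rw [← hs]
    exact Equiv.Perm.sameCycle_apply_left.2 (.refl _ _))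
  refine Nat.card_congr
    ⟨Quotient.lift f fun x y h => sameCycle_congr hf h,
      fun o => o.elim (Quotient.mk _ 0) (Quotient.lift g fun x y h => sameCycle_congr hg h), ?_, ?_⟩
  · intro q
    induction q using Quotient.inductionOn with
    | h x => cases x using Fin.cases <;> rfl
  · rintro (_ | q)
    · rfl
    · induction q using Quotient.inductionOn with
      | h x => rfl

/-- Here 0 is inserted into the cycle of `p`, just before `p`: the former preimage of `p` now goes
to 0, and 0 goes to `p`. No cycle is created or joined. -/
theorem numCycles_decomposeFin_succ {n : ℕ} (p : Fin n) (π : Equiv.Perm (Fin n)) :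
    numCycles (Equiv.Perm.decomposeFin.symm (p.succ, π)) = numCycles π := by
  set σ := Equiv.Perm.decomposeFin.symm (p.succ, π)
  have h0 : σ 0 = p.succ := by simp [σ]
  have hs : ∀ x : Fin n, σ x.succ = Equiv.swap 0 p.succ (π x).succ := by intro x; simp [σ]
  rw [numCycles, numCycles]
  let f : Fin (n + 1) → Quotient (Equiv.Perm.SameCycle.setoid π) :=
    Fin.cases (Quotient.mk _ p) fun x => Quotient.mk _ x
  have hf : ∀ x, f (σ x) = f x := by
    refine Fin.cases ?_ fun x => ?_
    · rw [h0]
      rfl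
    · have hx : f ((π x).succ) = f x.succ := Quotient.sound (show π.SameCycle _ _ from
        Equiv.Perm.sameCycle_apply_left.2 (.refl _ _))
      rw [hs, ← hx]
      by_cases h : π x = p
      · rw [h, Equiv.swap_apply_right]
        rfl
      · rw [Equiv.swap_apply_of_ne_of_ne (Fin.succ_ne_zero _) (by simpa using h)]
  let g : Fin n → Quotient (Equiv.Perm.SameCycle.setoid σ) := fun x => Quotient.mk _ x.succ
  have hσ : ∀ x, (Quotient.mk _ (σ x) : Quotient (Equiv.Perm.SameCycle.setoid σ)) =
      Quotient.mk _ x := fun x => Quotient.sound (show σ.SameCycle _ _ from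
    Equiv.Perm.sameCycle_apply_left.2 (.refl _ _))
  have hg : ∀ x, g (π x) = g x := by
    intro x
    have h1 := hσ x.succ
    rw [hs] at h1
    by_cases h : π x = p
    · rw [h, Equiv.swap_apply_right, ← hσ 0, h0] at h1
      rw [h]
      exact h1
    · rwa [Equiv.swap_apply_of_ne_of_ne (Fin.succ_ne_zero _) (by simpa using h)] at h1
  refine Nat.card_congr
    ⟨Quotient.lift f fun x y h => sameCycle_congr hf h,
      Quotient.lift g fun x y h => sameCycle_congr hg h, ?_, ?_⟩
  · intro q
    induction q using Quotient.inductionOn with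
    | h x =>
      cases x using Fin.cases with
      | zero =>
        have := hσ 0
        rw [h0] at this
        exact this
      | succ x => rfl
  · intro q
    induction q using Quotient.inductionOn with
    | h x => rfl

/-- Of the n + 1 ways to insert a new element, one creates a fixed point and n leave the number of
cycles unchanged, which gives the factor X + n. -/
theorem sum_X_pow_numCycles (n : ℕ) :
    ∑ π : Equiv.Perm (Fin n), (X : ℕ[X]) ^ numCycles π = ascPochhammer ℕ n := by
  induction n with
  | zero =>
    rw [Fintype.sum_unique, numCycles, Nat.card_of_isEmpty]
    rfl
  | succ n ih =>
    rw [← Equiv.sum_comp Equiv.Perm.decomposeFin.symm, Fintype.sum_prod_type, Fin.sum_univ_succ]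
    simp only [numCycles_decomposeFin_zero, numCycles_decomposeFin_succ, pow_succ,
      ← Finset.sum_mul, ih, Finset.sum_const, Finset.card_univ, Fintype.card_fin]
    rw [ascPochhammer_succ_right, mul_add, nsmul_eq_mul, mul_comm (n : ℕ[X])]

theorem exists_perm_equiv_firstCol (n : ℕ) :
    ∃ e : Tableaux n ≃ Equiv.Perm (Fin n), ∀ T, numCycles (e T) = T.1.firstCol :=
  exists_equiv_of_sum_X_pow_eq _ _ ((sum_X_pow_firstCol n).trans (sum_X_pow_numCycles n).symm)

/-- Transposition of tableaux of a given size. -/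
noncomputable def transposeEquiv (n : ℕ) : Tableaux n ≃ Tableaux n where
  toFun T := ⟨T.1.transpose, by rw [size_transpose, T.2]⟩
  invFun T := ⟨T.1.transpose, by rw [size_transpose, T.2]⟩
  left_inv T := Subtype.ext (Tableau.transpose_transpose T.1)
  right_inv T := Subtype.ext (Tableau.transpose_transpose T.1)

theorem exists_perm_equiv_firstRow (n : ℕ) :
    ∃ e : Tableaux n ≃ Equiv.Perm (Fin n), ∀ T, numCycles (e T) = T.1.firstRow := by
  obtain ⟨e, he⟩ := exists_perm_equiv_firstCol n
  exact ⟨(transposeEquiv n).trans e, fun T => by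
    rw [Equiv.trans_apply, he]
    exact firstCol_transpose T.1⟩

end TreeLike

namespace TreeLike
open Tableau

/-! ### Enumeration of non-ambiguous trees and of words -/

/-- The operator `g ↦ (k ↦ ∑ g (k + 1 - |S|))`, with the sum over the non-empty `S ⊆ {1, …, k}`. -/
def mergeSum (g : ℕ → ℕ) (k : ℕ) : ℕ := ∑ s ∈ Finset.range k, k.choose (s + 1) * g (k - s)

theorem sum_nonempty_subset_eq_mergeSum (R : Finset ℕ) (g : ℕ → ℕ)
    [Fintype {S : Finset ℕ // S ⊆ R ∧ S.Nonempty}] :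
    ∑ S : {S : Finset ℕ // S ⊆ R ∧ S.Nonempty}, g (R.card + 1 - S.1.card) =
      mergeSum g R.card := by
  classical
  rw [← Finset.sum_subtype (R.powerset.filter Finset.Nonempty) (fun S => by simp)
    (fun S => g (R.card + 1 - S.card)), Finset.sum_filter]
  -- Subsets are grouped by cardinality. The value 0 at m = 0 discards the empty set and shifts the
  -- summation index by one.
  have := Finset.sum_powerset_apply_card (fun m => if m = 0 then 0 else g (R.card + 1 - m)) (x := R)
  simp only [Finset.sum_range_succ', if_true, smul_zero, add_zero] at this
  refine Eq.trans (Finset.sum_congr rfl fun S _ => ?_) (this.trans ?_)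
  · by_cases h : S = ∅
    · simp [h]
    · simp [h, Finset.nonempty_iff_ne_empty]
  · refine Finset.sum_congr rfl fun s hs => ?_
    simp [Nat.add_sub_add_right]

theorem finite_nonempty_subset (R : Finset ℕ) : Finite {S : Finset ℕ // S ⊆ R ∧ S.Nonempty} :=
  Set.Finite.to_subtype ((Finset.finite_toSet R.powerset).subset fun _ hS =>
    Finset.mem_coe.2 (Finset.mem_powerset.2 hS.1))

theorem exists_column (p : ℕ) : ∃ T : Tableau, (∀ i j, (i, j) ∈ T.shape ↔ i ≤ p ∧ j = 0) ∧
    ∀ i j, (i, j) ∈ T.points ↔ i ≤ p ∧ j = 0 := by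
  refine exists_of_pred _ _ ⟨p + 1, fun i j h => by omega⟩ (fun i j i' j' _ _ h => by omega)
    (fun i j h => h) (fun i j h => by omega) ?_ (fun i j h => ⟨0, h.1, rfl⟩)
    (fun i j h => ⟨0, by omega, h.2⟩)
  rintro i j ⟨hi, rfl⟩ h0
  left
  have : 0 < i := by simp at h0; omega
  refine ⟨⟨0, this, by omega, rfl⟩, ?_⟩
  rintro ⟨j, hj, -⟩
  omega

theorem NonAmbiguousTree.points_of_width_zero {p : ℕ} (T : NonAmbiguousTree p 0) (i j : ℕ) :
    (i, j) ∈ T.1.points ↔ i ≤ p ∧ j = 0 := by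
  constructor
  · intro h
    have := (T.2 i j).1 (T.1.mem_shape_of_mem_points h)
    omega
  · rintro ⟨hi, rfl⟩
    obtain ⟨j, hj⟩ := T.1.row_nonempty i 0 ((T.2 i 0).2 ⟨hi, le_rfl⟩)
    have := (T.2 i j).1 (T.1.mem_shape_of_mem_points hj)
    have h0 : j = 0 := by omega
    rwa [h0] at hj

noncomputable instance (p : ℕ) : Unique (NonAmbiguousTree p 0) where
  default := ⟨(exists_column p).choose, fun i j => by
    rw [(exists_column p).choose_spec.1]; omega⟩
  uniq T := by
    apply Subtype.ext
    refine ext_mem (fun i j => ?_) (fun i j => ?_)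
    · rw [T.2, (exists_column p).choose_spec.1]
      omega
    · rw [T.points_of_width_zero, (exists_column p).choose_spec.2]

theorem NonAmbiguousTree.firstCol_of_width_zero {p : ℕ} (T : NonAmbiguousTree p 0) :
    T.1.firstCol = p + 1 := by
  rw [← card_firstColRows, ← Finset.card_range (p + 1)]
  congr 1
  ext a
  rw [mem_firstColRows, T.points_of_width_zero, Finset.mem_range]
  omega

instance (p w : ℕ) : Finite (NonAmbiguousTree p w) := by
  induction w with
  | zero => infer_instance
  | succ w ih =>
    obtain ⟨e, -⟩ := exists_natSplitEquiv p w
    have := fun T : NonAmbiguousTree p w => finite_nonempty_subset T.1.firstColRows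
    exact Finite.of_equiv _ e

noncomputable instance (p w : ℕ) : Fintype (NonAmbiguousTree p w) := Fintype.ofFinite _

/-- Undoing the last split replaces the weight `g` by `mergeSum g`, which is why `g` has to be
arbitrary. After `w` steps a single column remains, with all its p + 1 cells pointed. -/
theorem sum_nonAmbiguousTree (p w : ℕ) (g : ℕ → ℕ) :
    ∑ T : NonAmbiguousTree p w, g T.1.firstCol = mergeSum^[w] g (p + 1) := by
  induction w generalizing g with
  | zero =>
    rw [Fintype.sum_unique, NonAmbiguousTree.firstCol_of_width_zero]
    rfl
  | succ w ih =>
    obtain ⟨e, he⟩ := exists_natSplitEquiv p w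
    have := fun T : NonAmbiguousTree p w => finite_nonempty_subset T.1.firstColRows
    have := fun T : NonAmbiguousTree p w =>
      Fintype.ofFinite {S : Finset ℕ // S ⊆ T.1.firstColRows ∧ S.Nonempty}
    rw [← Equiv.sum_comp e, Fintype.sum_sigma, Function.iterate_succ_apply, ← ih]
    refine Finset.sum_congr rfl fun T _ => ?_
    rw [← card_firstColRows T.1, ← sum_nonempty_subset_eq_mergeSum]
    refine Finset.sum_congr rfl fun S _ => ?_
    have h1 := he ⟨T, S⟩
    rw [← card_firstColRows T.1] at h1
    congr 1
    simp only at h1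
    omega

theorem card_nonAmbiguousTree (p w : ℕ) :
    Nat.card (NonAmbiguousTree p w) = mergeSum^[w] 1 (p + 1) := by
  rw [← sum_nonAmbiguousTree, Nat.card_eq_fintype_card, Fintype.card_eq_sum_ones]
  rfl

/-- Trees are counted by one iteration per column, words by one iteration per blue letter, and blue
letters correspond to the height. Transposition reconciles the two. -/
theorem card_nonAmbiguousTree_swap (p w : ℕ) :
    Nat.card (NonAmbiguousTree p w) = Nat.card (NonAmbiguousTree w p) := by
  have h : ∀ {p w : ℕ} (T : NonAmbiguousTree p w) (i j : ℕ),
      (i, j) ∈ T.1.transpose.shape ↔ i ≤ w ∧ j ≤ p := fun T i j => by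
    rw [mem_shape_transpose, T.2, and_comm]
  exact Nat.card_congr ⟨fun T => ⟨T.1.transpose, h T⟩, fun T => ⟨T.1.transpose, h T⟩,
    fun T => Subtype.ext T.1.transpose_transpose, fun T => Subtype.ext T.1.transpose_transpose⟩

/-- Consecutive letters of the same colour increase. -/
def LetterRel (x y : Letter) : Prop := x.isRed = y.isRed → x.val < y.val

/-- The arrangements of the blue letters in `A` and the red letters in `B` into a word that ends
with a red letter and in which consecutive letters of the same colour increase. -/
structure IsWord (A B : Finset ℕ) (m : List Letter) : Prop where
  nodup : m.Nodup
  blue_mem : ∀ i, Letter.blue i ∈ m ↔ i ∈ A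
  red_mem : ∀ i, Letter.red i ∈ m ↔ i ∈ B
  getLast : ∃ i, m.getLast? = some (Letter.red i)
  chain : m.IsChain LetterRel

/-- `m'` is obtained from `m` by replacing the blue letter `b` and the block of the red letters `S`
after it by the red letter `t`. -/
def IsContract (b t : ℕ) (S : Finset ℕ) (m m' : List Letter) : Prop :=
  ∃ u v : List Letter, m = u ++ Letter.blue b :: ((S.sort (· ≤ ·)).map Letter.red ++ v) ∧
    m' = u ++ Letter.red t :: v ∧ ∀ y ∈ v.head?, y.isRed = false

theorem isChain_map_red {l : List ℕ} : (l.map Letter.red).IsChain LetterRel ↔ l.SortedLT := by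
  rw [List.isChain_map, List.sortedLT_iff_isChain]
  simp [LetterRel, Letter.isRed, Letter.val]

theorem exists_map_red {m : List Letter} (h : ∀ x ∈ m, x.isRed = true) :
    ∃ l : List ℕ, m = l.map Letter.red := by
  refine ⟨m.map Letter.val, ?_⟩
  rw [List.map_map]
  conv_lhs => rw [← List.map_id m]
  refine List.map_congr_left fun x hx => ?_
  rcases x with i | i
  · cases h _ hx
  · rfl

theorem getLast?_append_cons_append {α : Type*} (u l : List α) (c : α) {v : List α} (hv : v ≠ []) :
    (u ++ c :: (l ++ v)).getLast? = v.getLast? := by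
  rw [List.getLast?_append_of_ne_nil _ (List.cons_ne_nil _ _), ← List.cons_append,
    List.getLast?_append_of_ne_nil _ hv]

/-- As `t` exceeds every red letter of `B`, it may follow whatever ends `u`; what comes after it is
blue or nothing, so no further comparison arises. -/
theorem IsContract.isWord_right {A B S : Finset ℕ} {b t : ℕ} {m m' : List Letter}
    (hb : ∀ a ∈ A, a < b) (ht : ∀ i ∈ B, i < t) (h : IsContract b t S m m')
    (hm : IsWord (insert b A) B m) : IsWord A (insert t (B \ S)) m' := by
  obtain ⟨u, v, rfl, rfl, hv⟩ := h
  have hbA : b ∉ A := fun h => lt_irrefl _ (hb b h)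
  have htB : t ∉ B := fun h => lt_irrefl _ (ht t h)
  obtain ⟨h1, h2, h3, ⟨i, h4⟩, h5⟩ := hm
  simp only [List.nodup_append, List.nodup_cons, List.mem_append, List.mem_cons, List.mem_map,
    Finset.mem_sort, List.isChain_append, List.isChain_cons, Letter.blue.injEq, Letter.red.injEq,
    Finset.mem_insert, reduceCtorEq, false_or, and_false, exists_false,
    exists_eq_right] at h1 h2 h3 h5
  refine ⟨?_, fun k => ?_, fun k => ?_, ?_, ?_⟩
  · simp only [List.nodup_append, List.nodup_cons, List.mem_cons]
    grind
  · simp only [List.mem_append, List.mem_cons, reduceCtorEq, false_or]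
    have := h2 k
    have := h2 b
    grind
  · simp only [List.mem_append, List.mem_cons, Letter.red.injEq, Finset.mem_insert,
      Finset.mem_sdiff]
    have := h3 k
    have := h3 t
    grind
  · by_cases hv0 : v = []
    · exact ⟨t, by simp [hv0]⟩
    · rw [getLast?_append_cons_append _ _ _ hv0] at h4
      exact ⟨i, (getLast?_append_cons_append _ [] _ hv0).trans h4⟩
  · simp only [List.isChain_append, List.isChain_cons]
    refine ⟨h5.1, ⟨fun y hy hc => ?_, h5.2.1.2.2.1⟩, ?_⟩
    · rw [hv y hy] at hc
      cases hc
    · intro x hx y hy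
      have hxu := List.mem_of_mem_getLast? hx
      simp only [List.head?_cons, Option.mem_def, Option.some.injEq] at hy
      subst hy
      intro hc
      rcases x with k | k
      · cases hc
      · exact ht k ((h3 k).1 (Or.inl hxu))

/-- As `b` exceeds every letter of `A`, it may follow a blue letter. The sorted block of `S` is
non-empty, so it separates `b` from the next blue letter and also supplies a red last letter when
`v` is empty. -/
theorem IsContract.isWord_left {A B S : Finset ℕ} {b t : ℕ} {m m' : List Letter}
    (hb : ∀ a ∈ A, a < b) (ht : ∀ i ∈ B, i < t) (hS : S ⊆ B) (hne : S.Nonempty)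
    (h : IsContract b t S m m') (hm : IsWord A (insert t (B \ S)) m') :
    IsWord (insert b A) B m := by
  obtain ⟨u, v, rfl, rfl, hv⟩ := h
  have hbA : b ∉ A := fun h => lt_irrefl _ (hb b h)
  have htB : t ∉ B := fun h => lt_irrefl _ (ht t h)
  obtain ⟨h1, h2, h3, ⟨i, h4⟩, h5⟩ := hm
  simp only [List.nodup_append, List.nodup_cons, List.mem_append, List.mem_cons,
    List.isChain_append, List.isChain_cons, Letter.red.injEq,
    Finset.mem_insert, Finset.mem_sdiff, reduceCtorEq, false_or] at h1 h2 h3 h5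
  refine ⟨?_, fun k => ?_, fun k => ?_, ?_, ?_⟩
  · have : ((S.sort (· ≤ ·)).map Letter.red).Nodup :=
      (S.sort_nodup _).map fun x y h => by simpa using h
    simp only [List.nodup_append, List.nodup_cons, List.mem_cons, List.mem_append, List.mem_map,
      Finset.mem_sort]
    have := h2 b
    refine ⟨h1.1, ⟨?_, by assumption, h1.2.1.2, ?_⟩, ?_⟩
    · grind
    · rintro _ ⟨k, hk, rfl⟩ y hy rfl
      have := h3 k
      grind
    · rintro x hx y (rfl | ⟨k, hk, rfl⟩ | hy) rfl
      · grind
      · have := h3 k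
        grind
      · grind
  · simp only [List.mem_append, List.mem_cons, List.mem_map, Finset.mem_sort, reduceCtorEq,
      and_false, exists_false, false_or, Letter.blue.injEq, Finset.mem_insert]
    have := h2 k
    grind
  · simp only [List.mem_append, List.mem_cons, List.mem_map, Finset.mem_sort, reduceCtorEq,
      Letter.red.injEq, false_or, exists_eq_right]
    have := h3 k
    have := @hS k
    grind
  · by_cases hv0 : v = []
    · rcases (S.sort (· ≤ ·)).eq_nil_or_concat with h | ⟨l, x, h⟩
      · have := congrArg List.toFinset h
        rw [Finset.sort_toFinset] at this
        exact (hne.ne_empty this).elim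
      · refine ⟨x, ?_⟩
        rw [h, hv0, List.append_nil, List.concat_eq_append, List.map_append,
          getLast?_append_cons_append _ _ _ (by simp)]
        rfl
    · replace h4 := (getLast?_append_cons_append u [] _ hv0).symm.trans h4
      exact ⟨i, (getLast?_append_cons_append _ _ _ hv0).trans h4⟩
  · simp only [List.isChain_append, List.isChain_cons]
    refine ⟨h5.1, ⟨?_, ?_, h5.2.1.2, ?_⟩, ?_⟩
    · intro y hy hc
      rcases hl : S.sort (· ≤ ·) with _ | ⟨x, l⟩
      · have := congrArg List.toFinset hl
        rw [Finset.sort_toFinset] at this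
        exact (hne.ne_empty this).elim
      · simp [hl] at hy
        subst hy
        cases hc
    · exact isChain_map_red.2 S.sortedLT_sort
    · intro x hx y hy hc
      have hx' := List.mem_of_mem_getLast? hx
      obtain ⟨k, -, rfl⟩ := List.mem_map.1 hx'
      rw [hv y hy] at hc
      cases hc
    · intro x hx y hy hc
      simp only [List.head?_cons, Option.mem_def, Option.some.injEq] at hy
      subst hy
      rcases x with k | k
      · exact hb k ((h2 k).1 (Or.inl (List.mem_of_mem_getLast? hx)))
      · cases hc

/-- `S` is the maximal red block after `b`. It is non-empty because a larger blue letter would have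
to follow otherwise, or `b` would end the word; both are excluded. -/
theorem exists_isContract_right {A B : Finset ℕ} {b : ℕ} (t : ℕ) {m : List Letter}
    (hb : ∀ a ∈ A, a < b) (hm : IsWord (insert b A) B m) :
    ∃ S ⊆ B, S.Nonempty ∧ ∃ m', IsContract b t S m m' := by
  obtain ⟨u, w, rfl⟩ := List.append_of_mem ((hm.blue_mem b).2 (Finset.mem_insert_self _ _))
  have hw := List.takeWhile_append_dropWhile (p := Letter.isRed) (l := w)
  obtain ⟨l, hl⟩ := exists_map_red (m := w.takeWhile Letter.isRed)
    (fun x hx => List.mem_takeWhile_imp hx)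
  have hv : ∀ y ∈ (w.dropWhile Letter.isRed).head?, y.isRed = false := by
    intro y hy
    have := List.head?_dropWhile_not Letter.isRed w
    rw [hy] at this
    simpa using this
  rw [hl] at hw
  generalize w.dropWhile Letter.isRed = v at *
  subst hw
  have hc := hm.chain
  rw [List.isChain_append, List.isChain_cons, List.isChain_append, isChain_map_red] at hc
  have hls : l.SortedLT := hc.2.1.2.1
  have hsort : l.toFinset.sort (· ≤ ·) = l := by
    rw [List.toFinset_sort _ hls.nodup]
    exact hls.sortedLE.pairwise
  refine ⟨l.toFinset, fun i hi => ?_, ?_, _, u, v, by rw [hsort], rfl, hv⟩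
  · rw [← hm.red_mem]
    simp at hi ⊢
    tauto
  · rw [List.toFinset_nonempty_iff]
    rintro rfl
    rcases v with _ | ⟨y, v⟩
    · obtain ⟨i, hi⟩ := hm.getLast
      simp at hi
    · have hy := hv y (by simp)
      rcases y with k | k
      · have h1 : b < k := hc.2.1.1 (Letter.blue k) (by simp) rfl
        have h2 := (hm.blue_mem k).1 (by simp)
        rcases Finset.mem_insert.1 h2 with h | h
        · omega
        · have := hb k h
          omega
      · cases hy

/-- No red letter can follow `t`, the largest one. So after `t` is replaced, the inserted red block
is a maximal one, and `S` can be read off again. -/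
theorem exists_isContract_left {A B S : Finset ℕ} (b : ℕ) {t : ℕ} {m' : List Letter}
    (ht : ∀ i ∈ B, i < t) (hm : IsWord A (insert t (B \ S)) m') :
    ∃ m, IsContract b t S m m' := by
  obtain ⟨u, v, rfl⟩ := List.append_of_mem ((hm.red_mem t).2 (Finset.mem_insert_self _ _))
  refine ⟨_, u, v, rfl, rfl, fun y hy => ?_⟩
  have hc := hm.chain
  rw [List.isChain_append, List.isChain_cons] at hc
  rcases y with k | k
  · rfl
  · have h1 : t < k := hc.2.1.1 _ hy rfl
    have h2 := (hm.red_mem k).1 (by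
      have := List.mem_of_mem_head? hy
      simp [this])
    rcases Finset.mem_insert.1 h2 with h | h
    · omega
    · have := ht k (Finset.mem_sdiff.1 h).1
      omega

theorem takeWhile_map_red_append (l : List ℕ) {v : List Letter}
    (hv : ∀ y ∈ v.head?, y.isRed = false) :
    (l.map Letter.red ++ v).takeWhile Letter.isRed = l.map Letter.red := by
  rw [List.takeWhile_append_of_pos]
  · rcases v with _ | ⟨y, v⟩
    · simp
    · rw [List.takeWhile_cons_of_neg, List.append_nil]
      simp [hv y (by simp)]
  · intro x hx
    obtain ⟨k, -, rfl⟩ := List.mem_map.1 hx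
    rfl

theorem IsContract.right_unique {S S' : Finset ℕ} {b t : ℕ} {m m₁ m₂ : List Letter}
    (hm : m.Nodup) (h₁ : IsContract b t S m m₁) (h₂ : IsContract b t S' m m₂) :
    S = S' ∧ m₁ = m₂ := by
  obtain ⟨u, v, rfl, rfl, hv⟩ := h₁
  obtain ⟨u', v', h, rfl, hv'⟩ := h₂
  rw [List.nodup_append, List.nodup_cons] at hm
  have hu : Letter.blue b ∉ u := fun hu => hm.2.2 _ hu _ (by simp) rfl
  obtain ⟨rfl, -, h⟩ := (List.append_cons_inj_of_notMem hu hm.2.1.1).1 h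
  have h2 := congrArg (List.takeWhile Letter.isRed) h
  rw [takeWhile_map_red_append _ hv, takeWhile_map_red_append _ hv'] at h2
  rw [h2] at h
  have h3 := List.map_injective_iff.2 (fun x y h => by simpa using h) h2
  have h4 := congrArg List.toFinset h3
  rw [Finset.sort_toFinset, Finset.sort_toFinset] at h4
  exact ⟨h4, by rw [List.append_cancel_left h]⟩

theorem IsContract.left_unique {S : Finset ℕ} {b t : ℕ} {m' m₁ m₂ : List Letter}
    (hm : m'.Nodup) (h₁ : IsContract b t S m₁ m') (h₂ : IsContract b t S m₂ m') :
    m₁ = m₂ := by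
  obtain ⟨u, v, rfl, rfl, hv⟩ := h₁
  obtain ⟨u', v', rfl, h, hv'⟩ := h₂
  rw [List.nodup_append, List.nodup_cons] at hm
  have hu : Letter.red t ∉ u := fun hu => hm.2.2 _ hu _ (by simp) rfl
  obtain ⟨rfl, -, rfl⟩ := (List.append_cons_inj_of_notMem hu hm.2.1.1).1 h
  rfl

theorem exists_contractEquiv {A B : Finset ℕ} {b t : ℕ} (hb : ∀ a ∈ A, a < b)
    (ht : ∀ i ∈ B, i < t) :
    Nonempty ((Σ S : {S : Finset ℕ // S ⊆ B ∧ S.Nonempty},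
      {m // IsWord A (insert t (B \ S.1)) m}) ≃ {m // IsWord (insert b A) B m}) := by
  refine (exists_equiv_of_rel (α := Σ S : {S : Finset ℕ // S ⊆ B ∧ S.Nonempty},
    {m // IsWord A (insert t (B \ S.1)) m}) (β := {m // IsWord (insert b A) B m})
    (fun x m => IsContract b t x.1.1 m.1 x.2.1) ?_ ?_ ?_ ?_).nonempty
  · rintro ⟨⟨S, hS, hne⟩, m', hm'⟩
    obtain ⟨m, hm⟩ := exists_isContract_left b ht hm'
    exact ⟨⟨m, hm.isWord_left hb ht hS hne hm'⟩, hm⟩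
  · rintro ⟨m, hm⟩
    obtain ⟨S, hS, hne, m', h⟩ := exists_isContract_right t hb hm
    exact ⟨⟨⟨S, hS, hne⟩, m', h.isWord_right hb ht hm⟩, h⟩
  · rintro ⟨⟨S, hS, hne⟩, m', hm'⟩ ⟨m₁, h₁⟩ ⟨m₂, h₂⟩ h h'
    exact Subtype.ext (h.left_unique hm'.nodup h')
  · rintro ⟨⟨S₁, hS₁, hne₁⟩, m₁, hm₁⟩ ⟨⟨S₂, hS₂, hne₂⟩, m₂, hm₂⟩ ⟨m, hm⟩ h h'
    obtain ⟨rfl, rfl⟩ := h.right_unique hm.nodup h'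
    rfl

theorem card_isWord_empty {B : Finset ℕ} (hB : B.Nonempty) :
    ∃ m₀, ∀ m, IsWord ∅ B m ↔ m = m₀ := by
  refine ⟨(B.sort (· ≤ ·)).map Letter.red, fun m => ⟨fun h => ?_, ?_⟩⟩
  · obtain ⟨l, rfl⟩ := exists_map_red (m := m) (by
      rintro (i | i) hx
      · simpa using (h.blue_mem i).1 hx
      · rfl)
    have hl := isChain_map_red.1 h.chain
    congr 1
    have : B = l.toFinset := by
      ext i
      rw [← h.red_mem]
      simp
    rw [this, (List.toFinset_sort _ hl.nodup).2 hl.sortedLE.pairwise]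
  · rintro rfl
    refine ⟨(B.sort_nodup _).map fun x y h => by simpa using h, by simp, by simp, ?_,
      isChain_map_red.2 B.sortedLT_sort⟩
    rcases (B.sort (· ≤ ·)).eq_nil_or_concat with h | ⟨l, x, h⟩
    · have := congrArg List.toFinset h
      rw [Finset.sort_toFinset] at this
      exact (hB.ne_empty this).elim
    · exact ⟨x, by simp [h]⟩

/-- The induction removes the largest blue letter; contraction replaces `B` by a set of |B| + 1 -
|S| letters, which is the recursion of `mergeSum`. Arbitrary sets are used instead of intervals
because removing `S` leaves gaps. -/
theorem card_isWord (A B : Finset ℕ) (hB : B.Nonempty) :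
    Finite {m // IsWord A B m} ∧
      Nat.card {m // IsWord A B m} = mergeSum^[A.card] 1 B.card := by
  induction A using Finset.induction_on_max generalizing B with
  | empty =>
    obtain ⟨m₀, h⟩ := card_isWord_empty hB
    simp only [h]
    exact ⟨inferInstance, by simp⟩
  | insert b A hb ih =>
    obtain ⟨t, ht⟩ : ∃ t, ∀ i ∈ B, i < t :=
      ⟨B.sup id + 1, fun i hi => Nat.lt_succ_of_le (Finset.le_sup (f := id) hi)⟩
    obtain ⟨e⟩ := exists_contractEquiv hb ht
    have hfin := finite_nonempty_subset B
    have := Fintype.ofFinite {S : Finset ℕ // S ⊆ B ∧ S.Nonempty}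
    have := fun S : {S : Finset ℕ // S ⊆ B ∧ S.Nonempty} =>
      (ih (insert t (B \ S.1)) (Finset.insert_nonempty _ _)).1
    refine ⟨Finite.of_equiv _ e, ?_⟩
    rw [← Nat.card_congr e, Nat.card_sigma, Finset.card_insert_of_notMem fun h => lt_irrefl b (hb b h),
      Function.iterate_succ_apply', ← sum_nonempty_subset_eq_mergeSum]
    refine Finset.sum_congr rfl fun S _ => ?_
    rw [(ih _ (Finset.insert_nonempty _ _)).2]
    have h1 := Finset.card_le_card S.2.1
    rw [Finset.card_insert_of_notMem, Finset.card_sdiff_of_subset S.2.1, Nat.sub_add_comm h1]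
    · intro h
      exact lt_irrefl t (ht t (Finset.mem_sdiff.1 h).1)

theorem isWord_iff (p q : ℕ) (m : List Letter) :
    IsWord (Finset.Icc 1 p) (Finset.range (q + 1)) m ↔
      m.Nodup ∧ (∀ i, Letter.blue i ∈ m ↔ 1 ≤ i ∧ i ≤ p) ∧
      (∀ i, Letter.red i ∈ m ↔ i ≤ q) ∧ (∃ i, m.getLast? = some (Letter.red i)) ∧
      m.IsChain fun x y => x.isRed = y.isRed → x.val < y.val := by
  constructor
  · rintro ⟨h1, h2, h3, h4, h5⟩
    exact ⟨h1, by simpa using h2, by simpa [Nat.lt_succ_iff] using h3, h4, h5⟩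
  · rintro ⟨h1, h2, h3, h4, h5⟩
    exact ⟨h1, by simpa using h2, by simpa [Nat.lt_succ_iff] using h3, h4, h5⟩

theorem exists_word_equiv (p q : ℕ) : Nonempty (NonAmbiguousTree p q ≃ Words p q) := by
  have e : Words p q ≃ {m // IsWord (Finset.Icc 1 p) (Finset.range (q + 1)) m} :=
    Equiv.subtypeEquivRight fun m => (isWord_iff p q m).symm
  obtain ⟨hf, hc⟩ := card_isWord (Finset.Icc 1 p) (Finset.range (q + 1)) ⟨0, by simp⟩
  have := Finite.of_equiv _ e.symm
  refine Finite.card_eq.1 ?_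
  rw [card_nonAmbiguousTree_swap, card_nonAmbiguousTree, Nat.card_congr e, hc]
  simp

end TreeLike

namespace TreeLike
open Tableau

/-! ### Ranks -/

/-- The number of elements below `a` with the property `Q`. -/
noncomputable def rank (Q : ℕ → Prop) (a : ℕ) : ℕ := {a' | a' < a ∧ Q a'}.ncard

theorem rank_zero (Q : ℕ → Prop) : rank Q 0 = 0 := by simp [rank]

theorem finite_lt_and (Q : ℕ → Prop) (a : ℕ) : {a' | a' < a ∧ Q a'}.Finite :=
  (Set.finite_lt_nat a).subset fun _ h => h.1

theorem rank_succ_of {Q : ℕ → Prop} {a : ℕ} (h : Q a) : rank Q (a + 1) = rank Q a + 1 := by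
  rw [rank, rank, ← Set.ncard_insert_of_notMem (a := a) (by simp) (finite_lt_and Q a)]
  congr 1
  ext x
  simp only [Set.mem_ofPred_eq, Set.mem_insert_iff]
  constructor
  · rintro ⟨h1, h2⟩
    by_cases hx : x = a
    · exact Or.inl hx
    · exact Or.inr ⟨by omega, h2⟩
  · rintro (rfl | ⟨h1, h2⟩)
    · exact ⟨by omega, h⟩
    · exact ⟨by omega, h2⟩

theorem rank_congr {Q Q' : ℕ → Prop} {a : ℕ} (h : ∀ x < a, Q x ↔ Q' x) : rank Q a = rank Q' a := by
  rw [rank, rank]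
  congr 1
  ext x
  exact and_congr_right (h x)

theorem rank_succ_of_not {Q : ℕ → Prop} {a : ℕ} (h : ¬ Q a) : rank Q (a + 1) = rank Q a := by
  rw [rank, rank]
  congr 1
  ext x
  simp only [Set.mem_ofPred_eq]
  constructor
  · rintro ⟨h1, h2⟩
    by_cases hx : x = a
    · exact (h (hx ▸ h2)).elim
    · exact ⟨by omega, h2⟩
  · rintro ⟨h1, h2⟩
    exact ⟨by omega, h2⟩

theorem rank_mono (Q : ℕ → Prop) {a b : ℕ} (h : a ≤ b) : rank Q a ≤ rank Q b :=
  Set.ncard_le_ncard (fun _ hx => ⟨hx.1.trans_le h, hx.2⟩) (finite_lt_and Q b)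

theorem rank_lt_rank {Q : ℕ → Prop} {a b : ℕ} (ha : Q a) (h : a < b) : rank Q a < rank Q b := by
  have h1 := rank_succ_of ha
  have h2 := rank_mono Q (show a + 1 ≤ b from h)
  omega

theorem lt_of_rank_lt {Q : ℕ → Prop} {a b : ℕ} (h : rank Q a < rank Q b) : a < b := by
  by_contra h'
  have := rank_mono Q (not_lt.1 h')
  omega

theorem rank_inj {Q : ℕ → Prop} {a b : ℕ} (ha : Q a) (hb : Q b) (h : rank Q a = rank Q b) :
    a = b := by
  rcases lt_trichotomy a b with h' | h' | h'
  · have := rank_lt_rank ha h'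
    omega
  · exact h'
  · have := rank_lt_rank hb h'
    omega

theorem exists_rank_eq (Q : ℕ → Prop) {p x : ℕ} (hx : x < rank Q p) :
    ∃ a < p, Q a ∧ rank Q a = x := by
  induction p with
  | zero => simp [rank_zero] at hx
  | succ p ih =>
    by_cases h : Q p
    · rw [rank_succ_of h] at hx
      rcases (Nat.lt_succ_iff.1 hx).lt_or_eq with h' | h'
      · obtain ⟨a, ha, h⟩ := ih h'
        exact ⟨a, by omega, h⟩
      · exact ⟨p, by omega, h, h'.symm⟩
    · rw [rank_succ_of_not h] at hx
      obtain ⟨a, ha, h⟩ := ih hx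
      exact ⟨a, by omega, h⟩

theorem exists_rank_eq_of_le {Q : ℕ → Prop} {p x : ℕ} (hp : Q p) (hx : x ≤ rank Q p) :
    ∃ a ≤ p, Q a ∧ rank Q a = x := by
  rcases hx.lt_or_eq with h | h
  · obtain ⟨a, ha, h⟩ := exists_rank_eq Q h
    exact ⟨a, ha.le, h⟩
  · exact ⟨p, le_rfl, hp, h.symm⟩

/-! ### The size of a tableau of rectangular shape -/

namespace Tableau

theorem not_above_iff (T : Tableau) {i j : ℕ} (h : (i, j) ∈ T.points) (h0 : (i, j) ≠ (0, 0)) :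
    (¬ ∃ i' < i, (i', j) ∈ T.points) ↔ ∃ j' < j, (i, j') ∈ T.points := by
  rcases T.parent i j h h0 with ⟨h1, h2⟩ | ⟨h1, h2⟩
  · exact iff_of_false (fun h => h h1) h2
  · exact iff_of_true h2 h1

open Classical in
theorem card_top (T : Tableau) {p q : ℕ} (hT : ∀ i j, (i, j) ∈ T.shape ↔ i ≤ p ∧ j ≤ q) :
    (T.points.filter fun c => ¬ ∃ i' < c.1, (i', c.2) ∈ T.points).card = q + 1 := by
  rw [← Finset.card_range (q + 1)]
  refine Finset.card_bij (fun c _ => c.2) ?_ ?_ ?_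
  · rintro ⟨i, j⟩ h
    have := (hT i j).1 (T.mem_shape_of_mem_points (Finset.mem_filter.1 h).1)
    simp only [Finset.mem_range]
    omega
  · rintro ⟨i, j⟩ h ⟨i', j'⟩ h' rfl
    simp only [Finset.mem_filter, not_exists, not_and] at h h'
    have h1 : ¬ i' < i := fun hlt => h.2 i' hlt h'.1
    have h2 : ¬ i < i' := fun hlt => h'.2 i hlt h.1
    rw [show i = i' by omega]
  · intro j hj
    obtain ⟨i, hi⟩ := T.col_nonempty 0 j ((hT 0 j).2 ⟨by omega, by simpa [Nat.lt_succ_iff] using hj⟩)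
    have hex : ∃ i, (i, j) ∈ T.points := ⟨i, hi⟩
    refine ⟨(Nat.find hex, j), ?_, rfl⟩
    simp only [Finset.mem_filter, not_exists, not_and]
    exact ⟨Nat.find_spec hex, fun k hk => Nat.find_min hex hk⟩

open Classical in
theorem card_leftmost (T : Tableau) {p q : ℕ} (hT : ∀ i j, (i, j) ∈ T.shape ↔ i ≤ p ∧ j ≤ q) :
    (T.points.filter fun c => ¬ ∃ j' < c.2, (c.1, j') ∈ T.points).card = p + 1 := by
  rw [← T.transpose.card_top (p := q) (q := p)
    (fun i j => by rw [mem_shape_transpose, hT, and_comm]), points_transpose, Finset.filter_map,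
    Finset.card_map]
  congr 1
  ext ⟨i, j⟩
  simp

/-- By the parent condition a non-root point is either topmost in its column or leftmost in its row,
never both, while the root is both. There is one topmost point per column and one leftmost point per
row, so q + 1 and p + 1 add up to the size plus one. -/
theorem size_of_rectangle (T : Tableau) {p q : ℕ}
    (hT : ∀ i j, (i, j) ∈ T.shape ↔ i ≤ p ∧ j ≤ q) : T.size = p + q + 1 := by
  classical
  have hroot : (0, 0) ∈ T.points := T.root_mem ((hT 0 0).2 ⟨by omega, by omega⟩)
  have h1 := T.card_top hT
  have h2 := T.card_leftmost hT
  set A := T.points.filter fun c => ¬ ∃ i' < c.1, (i', c.2) ∈ T.points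
  set B := T.points.filter fun c => ¬ ∃ j' < c.2, (c.1, j') ∈ T.points
  have hu : A ∪ B = T.points := by
    ext ⟨i, j⟩
    simp only [A, B, Finset.mem_union, Finset.mem_filter]
    constructor
    · rintro (h | h) <;> exact h.1
    · intro h
      by_cases h0 : (i, j) = (0, 0)
      · refine Or.inl ⟨h, ?_⟩
        simp only [Prod.mk.injEq] at h0
        rintro ⟨k, hk, -⟩
        omega
      · have := T.not_above_iff h h0
        tauto
  have hi : A ∩ B = {(0, 0)} := by
    ext ⟨i, j⟩
    simp only [A, B, Finset.mem_inter, Finset.mem_filter, Finset.mem_singleton]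
    constructor
    · rintro ⟨⟨h, h1⟩, -, h2⟩
      by_contra h0
      exact h2 ((T.not_above_iff h h0).1 h1)
    · intro h
      simp only [Prod.mk.injEq] at h
      obtain ⟨rfl, rfl⟩ := h
      refine ⟨⟨hroot, ?_⟩, hroot, ?_⟩ <;>
      · rintro ⟨k, hk, -⟩
        omega
  have := Finset.card_union_add_card_inter A B
  rw [hu, hi, h1, h2, Finset.card_singleton] at this
  rw [size]
  omega

end Tableau

/-! ### Cutting at a corner -/

/-- `L` is the part of `T` below row `p`, with a first row of `q` cells that are pointed below the
columns with a point above row `p + 1`. -/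
def IsLeftPart (T : Tableau) (p q : ℕ) (L : Tableau) : Prop :=
  (∀ b, (0, b) ∈ L.shape ↔ b < q) ∧
  (∀ a b, (a + 1, b) ∈ L.shape ↔ (p + 1 + a, b) ∈ T.shape) ∧
  (∀ b, (0, b) ∈ L.points ↔ b < q ∧ ∃ a ≤ p, (a, b) ∈ T.points) ∧
  ∀ a b, (a + 1, b) ∈ L.points ↔ (p + 1 + a, b) ∈ T.points

/-- `R` is the part of `T` to the right of column `q`, with a first column of `p` cells that are
pointed in the rows with a point to the left of column `q + 1`. -/
def IsRightPart (T : Tableau) (p q : ℕ) (R : Tableau) : Prop :=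
  (∀ a, (a, 0) ∈ R.shape ↔ a < p) ∧
  (∀ a b, (a, b + 1) ∈ R.shape ↔ (a, q + 1 + b) ∈ T.shape) ∧
  (∀ a, (a, 0) ∈ R.points ↔ a < p ∧ ∃ b ≤ q, (a, b) ∈ T.points) ∧
  ∀ a b, (a, b + 1) ∈ R.points ↔ (a, q + 1 + b) ∈ T.points

/-- The points of `M` are those of the middle part of `T`, with empty rows and columns removed. -/
def IsMiddlePart (T : Tableau) (p q : ℕ) (M : Tableau) : Prop :=
  ∀ x y, (x, y) ∈ M.points ↔ ∃ a ≤ p, ∃ b ≤ q, (a, b) ∈ T.points ∧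
    rank (fun a' => ∃ b' ≤ q, (a', b') ∈ T.points) a = x ∧
    rank (fun b' => ∃ a' ≤ p, (a', b') ∈ T.points) b = y

theorem isCut_iff {n : ℕ} (T : Tableau) (c : ℕ × ℕ) (t : Triple n) :
    IsCut T c t ↔ IsLeftPart T c.1 c.2 t.left ∧ IsRightPart T c.1 c.2 t.right ∧
      IsMiddlePart T c.1 c.2 t.tree.1 := by
  unfold IsCut IsLeftPart IsRightPart IsMiddlePart rank
  tauto

section Corner

variable {T : Tableau} {p q : ℕ}

theorem IsCorner.mem_of_le (h : IsCorner T.shape (p, q)) {a b : ℕ} (ha : a ≤ p) (hb : b ≤ q) :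
    (a, b) ∈ T.shape := T.shape.up_left_mem ha hb h.1

theorem IsCorner.lt_of_below (h : IsCorner T.shape (p, q)) {a b : ℕ} (hab : (a, b) ∈ T.shape)
    (ha : p < a) : b < q := by
  by_contra hb
  exact h.2.1 (T.shape.up_left_mem ha (not_lt.1 hb) hab)

theorem IsCorner.lt_of_right (h : IsCorner T.shape (p, q)) {a b : ℕ} (hab : (a, b) ∈ T.shape)
    (hb : q < b) : a < p := by
  by_contra ha
  exact h.2.2 (T.shape.up_left_mem (not_lt.1 ha) hb hab)

/-- The row of the corner ends at column `q`, so its point lies in the middle part. Thus this row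
survives the removal of empty rows and is the additional last row of the tree. -/
theorem IsCorner.row (h : IsCorner T.shape (p, q)) : ∃ b ≤ q, (p, b) ∈ T.points := by
  obtain ⟨b, hb⟩ := T.row_nonempty p q h.1
  refine ⟨b, ?_, hb⟩
  by_contra hq
  have := h.lt_of_right (T.mem_shape_of_mem_points hb) (not_le.1 hq)
  omega

theorem IsCorner.col (h : IsCorner T.shape (p, q)) : ∃ a ≤ p, (a, q) ∈ T.points := by
  obtain ⟨a, ha⟩ := T.col_nonempty p q h.1
  refine ⟨a, ?_, ha⟩
  by_contra hp
  have := h.lt_of_below (T.mem_shape_of_mem_points ha) (not_le.1 hp)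
  omega

theorem IsCorner.transpose (h : IsCorner T.shape (p, q)) : IsCorner T.transpose.shape (q, p) := by
  unfold IsCorner at h ⊢
  simp only [mem_shape_transpose]
  tauto

theorem isRightPart_iff_transpose {R : Tableau} :
    IsRightPart T p q R ↔ IsLeftPart T.transpose q p R.transpose := by
  simp only [IsRightPart, IsLeftPart, mem_shape_transpose, mem_points_transpose]
  rw [forall_comm (α := ℕ) (β := ℕ) (p := fun a b => (a, b + 1) ∈ R.shape ↔ _),
    forall_comm (α := ℕ) (β := ℕ) (p := fun a b => (a, b + 1) ∈ R.points ↔ _)]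

/-- The first row condenses rows 0 to p of `T`, so whether a lower point has something above it is
unchanged (`habove`). Lower rows are copied, so left parents are unchanged too. Points of the first
row other than its first cell have that cell, always pointed, to their left. -/
theorem exists_isLeftPart (h : IsCorner T.shape (p, q)) : ∃ L, IsLeftPart T p q L := by
  obtain ⟨N, hN⟩ := T.exists_bound
  have hroot := T.root_mem h.1
  let D : ℕ → ℕ → Prop := fun a b =>
    match a with
    | 0 => b < q
    | a + 1 => (p + 1 + a, b) ∈ T.shape
  let P : ℕ → ℕ → Prop := fun a b =>
    match a with
    | 0 => b < q ∧ ∃ a ≤ p, (a, b) ∈ T.points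
    | a + 1 => (p + 1 + a, b) ∈ T.points
  have hD : ∀ a b, D a b → b < q := by
    rintro (_ | a) b hab
    · exact hab
    · exact h.lt_of_below hab (by omega)
  have habove : ∀ a b, b < q → ((∃ i < a + 1, P i b) ↔ ∃ i < p + 1 + a, (i, b) ∈ T.points) := by
    intro a b hb
    constructor
    · rintro ⟨_ | i, hi, hP⟩
      · obtain ⟨-, k, hk, h⟩ := hP
        exact ⟨k, by omega, h⟩
      · exact ⟨p + 1 + i, by omega, hP⟩
    · rintro ⟨i, hi, hP⟩
      by_cases hip : i ≤ p
      · exact ⟨0, by omega, hb, i, hip, hP⟩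
      · obtain ⟨k, rfl⟩ := Nat.exists_eq_add_of_le (not_le.1 hip)
        exact ⟨k + 1, by omega, hP⟩
  refine Exists.imp (fun L h => ⟨fun b => h.1 0 b, fun a b => h.1 (a + 1) b, fun b => h.2 0 b,
    fun a b => h.2 (a + 1) b⟩) (exists_of_pred D P ?_ ?_ ?_ ?_ ?_ ?_ ?_)
  · refine ⟨N + q + 1, ?_⟩
    rintro (_ | a) b hab
    · have : b < q := hab
      omega
    · have := hN _ _ hab
      omega
  · rintro (_ | a) b (_ | a') b' ha hb hab
    · exact hb.trans_lt hab
    · omega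
    · exact hb.trans_lt (hD (a + 1) b hab)
    · exact T.shape.up_left_mem (by omega) hb hab
  · rintro (_ | a) b hab
    · exact hab.1
    · exact T.mem_shape_of_mem_points hab
  · intro a b hab
    have := hD _ _ hab
    exact ⟨by omega, 0, by omega, hroot⟩
  · rintro (_ | a) b hab h0
    · right
      have hb : 0 < b := by simp at h0; omega
      refine ⟨⟨0, hb, hb.trans hab.1, 0, by omega, hroot⟩, ?_⟩
      rintro ⟨i, hi, -⟩
      omega
    · rw [habove _ _ (h.lt_of_below (T.mem_shape_of_mem_points hab) (by omega))]
      exact T.parent _ _ hab (by simp)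
  · rintro (_ | a) b hab
    · exact ⟨0, (Nat.zero_le _).trans_lt hab, 0, by omega, hroot⟩
    · exact T.row_nonempty _ _ hab
  · intro a b hab
    have hb := hD _ _ hab
    obtain ⟨i, hi⟩ := T.col_nonempty 0 b (h.mem_of_le (by omega) hb.le)
    obtain ⟨k, -, hk⟩ := (habove i b hb).2 ⟨i, by omega, hi⟩
    exact ⟨k, hk⟩

theorem exists_isRightPart (h : IsCorner T.shape (p, q)) : ∃ R, IsRightPart T p q R := by
  obtain ⟨R, hR⟩ := exists_isLeftPart h.transpose
  exact ⟨R.transpose, isRightPart_iff_transpose.2 (by rwa [transpose_transpose])⟩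

theorem IsRightPart.firstCol_eq {R : Tableau} (h : IsRightPart T p q R) :
    R.firstCol = rank (fun a => ∃ b ≤ q, (a, b) ∈ T.points) p := by
  rw [← card_firstColRows, ← Set.ncard_coe_finset, rank]
  congr 1
  ext a
  rw [Finset.mem_coe, mem_firstColRows, h.2.2.1]
  rfl

theorem IsLeftPart.firstRow_eq {L : Tableau} (h : IsLeftPart T p q L) :
    L.firstRow = rank (fun b => ∃ a ≤ p, (a, b) ∈ T.points) q := by
  have h' : IsRightPart T.transpose q p L.transpose := by
    rw [isRightPart_iff_transpose]
    simpa using h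
  rw [← firstCol_transpose, h'.firstCol_eq]
  simp

/-- `rank` is strictly increasing on the non-empty rows and columns and takes every value up to that
of the corner, so the relations above and left of are carried over. All ranks up to the corner's
occur, and therefore the shape is a full rectangle. -/
theorem exists_isMiddlePart (h : IsCorner T.shape (p, q)) : ∃ M, IsMiddlePart T p q M ∧
    ∀ i j, (i, j) ∈ M.shape ↔ i ≤ rank (fun a => ∃ b ≤ q, (a, b) ∈ T.points) p ∧
      j ≤ rank (fun b => ∃ a ≤ p, (a, b) ∈ T.points) q := by
  have hrow : ∃ b ≤ q, (p, b) ∈ T.points := h.row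
  have hcol : ∃ a ≤ p, (a, q) ∈ T.points := h.col
  have hroot := T.root_mem h.1
  obtain ⟨ρ, hρ⟩ : ∃ ρ : ℕ → Prop, ρ = fun a => ∃ b ≤ q, (a, b) ∈ T.points := ⟨_, rfl⟩
  obtain ⟨κ, hκ⟩ : ∃ κ : ℕ → Prop, κ = fun b => ∃ a ≤ p, (a, b) ∈ T.points := ⟨_, rfl⟩
  unfold IsMiddlePart
  rw [← hρ, ← hκ]
  have hρi : ∀ {a b}, b ≤ q → (a, b) ∈ T.points → ρ a := fun hb h => by rw [hρ]; exact ⟨_, hb, h⟩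
  have hκi : ∀ {a b}, a ≤ p → (a, b) ∈ T.points → κ b := fun hb h => by rw [hκ]; exact ⟨_, hb, h⟩
  have hρp : ρ p := by rw [hρ]; exact hrow
  have hκq : κ q := by rw [hκ]; exact hcol
  refine (exists_of_pred (fun i j => i ≤ rank ρ p ∧ j ≤ rank κ q)
    (fun x y => ∃ a ≤ p, ∃ b ≤ q, (a, b) ∈ T.points ∧ rank ρ a = x ∧ rank κ b = y)
    ?_ ?_ ?_ ?_ ?_ ?_ ?_).imp fun M hM => ⟨hM.2, hM.1⟩
  · exact ⟨rank ρ p + rank κ q + 1, fun i j h => by omega⟩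
  · exact fun i j i' j' hi hj h => by omega
  · rintro _ _ ⟨a, ha, b, hb, -, rfl, rfl⟩
    exact ⟨rank_mono ρ ha, rank_mono κ hb⟩
  · exact fun i j _ => ⟨0, by omega, 0, by omega, hroot, rank_zero _, rank_zero _⟩
  · rintro _ _ ⟨a, ha, b, hb, hab, rfl, rfl⟩ h0
    have e1 : (∃ i' < rank ρ a, ∃ a' ≤ p, ∃ b' ≤ q, (a', b') ∈ T.points ∧ rank ρ a' = i' ∧
        rank κ b' = rank κ b) ↔ ∃ a' < a, (a', b) ∈ T.points := by
      constructor
      · rintro ⟨_, hi, a', ha', b', hb', hab', rfl, h⟩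
        rw [rank_inj (hκi ha' hab') (hκi ha hab) h] at hab'
        exact ⟨a', lt_of_rank_lt hi, hab'⟩
      · rintro ⟨a', ha', hab'⟩
        exact ⟨_, rank_lt_rank (hρi hb hab') ha', a', by omega, b, hb, hab', rfl, rfl⟩
    have e2 : (∃ j' < rank κ b, ∃ a' ≤ p, ∃ b' ≤ q, (a', b') ∈ T.points ∧ rank ρ a' = rank ρ a ∧
        rank κ b' = j') ↔ ∃ b' < b, (a, b') ∈ T.points := by
      constructor
      · rintro ⟨_, hi, a', ha', b', hb', hab', h, rfl⟩
        rw [rank_inj (hρi hb' hab') (hρi hb hab) h] at hab'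
        exact ⟨b', lt_of_rank_lt hi, hab'⟩
      · rintro ⟨b', hb', hab'⟩
        exact ⟨_, rank_lt_rank (hκi ha hab') hb', a, ha, b', by omega, hab', rfl, rfl⟩
    rw [e1, e2]
    refine T.parent a b hab fun h => h0 ?_
    simp only [Prod.mk.injEq] at h
    rw [h.1, h.2, rank_zero, rank_zero]
  · rintro i j ⟨hi, hj⟩
    obtain ⟨a, ha, haρ, rfl⟩ := exists_rank_eq_of_le hρp hi
    rw [hρ] at haρ
    obtain ⟨b, hb, hab⟩ := haρ
    exact ⟨_, a, ha, b, hb, hab, rfl, rfl⟩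
  · rintro i j ⟨hi, hj⟩
    obtain ⟨b, hb, hbκ, rfl⟩ := exists_rank_eq_of_le hκq hj
    rw [hκ] at hbκ
    obtain ⟨a, ha, hab⟩ := hbκ
    exact ⟨_, a, ha, b, hb, hab, rfl, rfl⟩

theorem IsMiddlePart.card_eq {M : Tableau} (h : IsMiddlePart T p q M) :
    M.size = (T.points.filter fun c => c.1 ≤ p ∧ c.2 ≤ q).card := by
  rw [Tableau.size, ← Finset.card_image_of_injOn (s := T.points.filter fun c => c.1 ≤ p ∧ c.2 ≤ q)
    (f := fun c : ℕ × ℕ =>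
    (rank (fun a' => ∃ b' ≤ q, (a', b') ∈ T.points) c.1,
      rank (fun b' => ∃ a' ≤ p, (a', b') ∈ T.points) c.2))]
  · congr 1
    ext ⟨x, y⟩
    rw [h]
    simp only [Finset.mem_image, Finset.mem_filter, Prod.exists, Prod.mk.injEq]
    constructor
    · rintro ⟨a, ha, b, hb, hab, h⟩
      exact ⟨a, b, ⟨hab, ha, hb⟩, h⟩
    · rintro ⟨a, b, ⟨hab, ha, hb⟩, h⟩
      exact ⟨a, ha, b, hb, hab, h⟩
  · rintro ⟨a, b⟩ hab ⟨a', b'⟩ hab' hh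
    simp only [Finset.coe_filter, Set.mem_ofPred_eq, Prod.mk.injEq] at hab hab' hh ⊢
    exact ⟨rank_inj (Q := fun a' => ∃ b' ≤ q, (a', b') ∈ T.points) ⟨b, hab.2.2, hab.1⟩
      ⟨b', hab'.2.2, hab'.1⟩ hh.1, rank_inj (Q := fun b' => ∃ a' ≤ p, (a', b') ∈ T.points)
      ⟨a, hab.2.1, hab.1⟩ ⟨a', hab'.2.1, hab'.1⟩ hh.2⟩

theorem IsLeftPart.size_eq {L : Tableau} (h : IsLeftPart T p q L) :
    L.size = L.firstRow + (T.points.filter fun c => p < c.1).card := by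
  rw [Tableau.size, ← Finset.card_filter_add_card_filter_not (fun c : ℕ × ℕ => c.1 = 0),
    Tableau.firstRow]
  congr 1
  rw [← Finset.card_image_of_injective (T.points.filter fun c => p < c.1 )
    (f := fun c : ℕ × ℕ => (c.1, c.2)) (fun _ _ h => h)]
  refine Finset.card_bij (fun c _ => (p + c.1, c.2)) ?_ ?_ ?_
  · rintro ⟨_ | a, b⟩ hab
    · simp at hab
    · simp only [Finset.mem_filter, h.2.2.2] at hab
      simp only [Finset.image_id', Finset.mem_filter]
      rw [show p + (a + 1) = p + 1 + a by omega]
      exact ⟨hab.1, by omega⟩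
  · rintro ⟨a, b⟩ - ⟨a', b'⟩ - h
    simpa using h
  · rintro ⟨a, b⟩ hab
    simp only [Finset.image_id', Finset.mem_filter] at hab
    obtain ⟨k, rfl⟩ := Nat.exists_eq_add_of_le hab.2
    refine ⟨(k + 1, b), ?_, by simp; omega⟩
    simp only [Finset.mem_filter, h.2.2.2]
    exact ⟨hab.1, by omega⟩

theorem IsRightPart.size_eq {R : Tableau} (h : IsRightPart T p q R) :
    R.size = R.firstCol + (T.points.filter fun c => q < c.2).card := by
  have h' := (isRightPart_iff_transpose.1 h).size_eq
  rw [size_transpose, firstRow_transpose, points_transpose, Finset.filter_map,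
    Finset.card_map] at h'
  exact h'

/-- With h and w the height and width of the tree, there are |L| - w points below, |R| - h to the
right and h + w + 1 in the middle, the last by `size_of_rectangle`. -/
theorem size_of_parts {L R M : Tableau} (h : IsCorner T.shape (p, q)) (hL : IsLeftPart T p q L)
    (hR : IsRightPart T p q R) (hM : IsMiddlePart T p q M)
    (hs : ∀ i j, (i, j) ∈ M.shape ↔ i ≤ R.firstCol ∧ j ≤ L.firstRow) :
    L.size + R.size + 1 = T.size := by
  have h1 := hL.size_eq
  have h2 := hR.size_eq
  have h3 := hM.card_eq
  rw [M.size_of_rectangle hs] at h3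
  have h4 := Finset.card_filter_add_card_filter_not (s := T.points) fun c => p < c.1
  have h5 := Finset.card_filter_add_card_filter_not (s := T.points.filter fun c => ¬ p < c.1)
    fun c => q < c.2
  rw [Finset.filter_filter, Finset.filter_filter] at h5
  have h6 : (T.points.filter fun c => ¬ p < c.1 ∧ q < c.2) = T.points.filter fun c => q < c.2 := by
    refine Finset.filter_congr fun c hc => ?_
    constructor
    · exact fun h => h.2
    · refine fun hq => ⟨fun hp => ?_, hq⟩
      have := h.lt_of_below (T.mem_shape_of_mem_points (i := c.1) (j := c.2) hc) hp
      omega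
  have h7 : (T.points.filter fun c => ¬ p < c.1 ∧ ¬ q < c.2) =
      T.points.filter fun c => c.1 ≤ p ∧ c.2 ≤ q :=
    Finset.filter_congr fun c hc => by omega
  rw [h6, h7] at h5
  have h8 : T.size = T.points.card := rfl
  omega

end Corner
end TreeLike

namespace TreeLike
open Tableau

theorem IsLeftPart.unique {T L L' : Tableau} {p q : ℕ} (h : IsLeftPart T p q L)
    (h' : IsLeftPart T p q L') : L = L' := by
  refine ext_mem ?_ ?_
  · rintro (_ | a) b
    · rw [h.1, h'.1]
    · rw [h.2.1, h'.2.1]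
  · rintro (_ | a) b
    · rw [h.2.2.1, h'.2.2.1]
    · rw [h.2.2.2, h'.2.2.2]

theorem IsRightPart.unique {T R R' : Tableau} {p q : ℕ} (h : IsRightPart T p q R)
    (h' : IsRightPart T p q R') : R = R' := by
  have := (isRightPart_iff_transpose.1 h).unique (isRightPart_iff_transpose.1 h')
  rw [← R.transpose_transpose, this, transpose_transpose]

/-- The length of the first row of `L` gives `q` and that of the first column of `R` gives `p`.
Their points tell which rows and columns of the middle are non-empty, the corner's own being
non-empty anyway. Injectivity of `rank` then puts the points of `M` back in place. -/
theorem eq_of_parts {T T' L R M : Tableau} {p q p' q' : ℕ} (hc : IsCorner T.shape (p, q))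
    (hc' : IsCorner T'.shape (p', q')) (hL : IsLeftPart T p q L) (hR : IsRightPart T p q R)
    (hM : IsMiddlePart T p q M) (hL' : IsLeftPart T' p' q' L) (hR' : IsRightPart T' p' q' R)
    (hM' : IsMiddlePart T' p' q' M) : T = T' ∧ p = p' ∧ q = q' := by
  obtain rfl : q = q' := eq_of_forall_lt_iff fun b => by rw [← hL.1, hL'.1]
  obtain rfl : p = p' := eq_of_forall_lt_iff fun b => by rw [← hR.1, hR'.1]
  refine ⟨?_, rfl, rfl⟩
  have hρ : ∀ a ≤ p, (∃ b ≤ q, (a, b) ∈ T.points) ↔ ∃ b ≤ q, (a, b) ∈ T'.points := by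
    intro a ha
    rcases ha.lt_or_eq with ha | rfl
    · have h1 := hR.2.2.1 a
      have h2 := hR'.2.2.1 a
      rw [h1] at h2
      simpa [ha] using h2
    · exact iff_of_true hc.row hc'.row
  have hκ : ∀ b ≤ q, (∃ a ≤ p, (a, b) ∈ T.points) ↔ ∃ a ≤ p, (a, b) ∈ T'.points := by
    intro b hb
    rcases hb.lt_or_eq with hb | rfl
    · have h1 := hL.2.2.1 b
      have h2 := hL'.2.2.1 b
      rw [h1] at h2
      simpa [hb] using h2
    · exact iff_of_true hc.col hc'.col
  have hmid : ∀ a ≤ p, ∀ b ≤ q, (a, b) ∈ T.points → (a, b) ∈ T'.points := by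
    intro a ha b hb hab
    have h1 := (hM _ _).2 ⟨a, ha, b, hb, hab, rfl, rfl⟩
    obtain ⟨a', ha', b', hb', hab', h2, h3⟩ := (hM' _ _).1 h1
    rw [rank_congr fun x hx => hρ x (by omega)] at h2
    rw [rank_congr fun x hx => hκ x (by omega)] at h3
    have h4 := rank_inj (Q := fun a => ∃ b ≤ q, (a, b) ∈ T'.points) ⟨b', hb', hab'⟩
      ((hρ a ha).1 ⟨b, hb, hab⟩) h2
    have h5 := rank_inj (Q := fun b => ∃ a ≤ p, (a, b) ∈ T'.points) ⟨a', ha', hab'⟩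
      ((hκ b hb).1 ⟨a, ha, hab⟩) h3
    rwa [h4, h5] at hab'
  have hmid' : ∀ a ≤ p, ∀ b ≤ q, (a, b) ∈ T'.points → (a, b) ∈ T.points := by
    intro a ha b hb hab
    have h1 := (hM' _ _).2 ⟨a, ha, b, hb, hab, rfl, rfl⟩
    obtain ⟨a', ha', b', hb', hab', h2, h3⟩ := (hM _ _).1 h1
    rw [rank_congr fun x hx => (hρ x (by omega)).symm] at h2
    rw [rank_congr fun x hx => (hκ x (by omega)).symm] at h3
    have h4 := rank_inj (Q := fun a => ∃ b ≤ q, (a, b) ∈ T.points) ⟨b', hb', hab'⟩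
      ((hρ a ha).2 ⟨b, hb, hab⟩) h2
    have h5 := rank_inj (Q := fun b => ∃ a ≤ p, (a, b) ∈ T.points) ⟨a', ha', hab'⟩
      ((hκ b hb).2 ⟨a, ha, hab⟩) h3
    rwa [h4, h5] at hab'
  refine ext_mem (fun a b => ?_) (fun a b => ?_)
  · rcases le_or_gt a p with ha | ha
    · rcases le_or_gt b q with hb | hb
      · exact iff_of_true (hc.mem_of_le ha hb) (hc'.mem_of_le ha hb)
      · obtain ⟨k, rfl⟩ := Nat.exists_eq_add_of_le hb
        rw [← hR.2.1, hR'.2.1]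
    · obtain ⟨k, rfl⟩ := Nat.exists_eq_add_of_le ha
      rw [← hL.2.1, hL'.2.1]
  · rcases le_or_gt a p with ha | ha
    · rcases le_or_gt b q with hb | hb
      · exact ⟨hmid a ha b hb, hmid' a ha b hb⟩
      · obtain ⟨k, rfl⟩ := Nat.exists_eq_add_of_le hb
        rw [← hR.2.2.2, hR'.2.2.2]
    · obtain ⟨k, rfl⟩ := Nat.exists_eq_add_of_le ha
      rw [← hL.2.2.2, hL'.2.2.2]

theorem rank_firstCol (R : Tableau) {p : ℕ} (hp : ∀ a, (a, 0) ∈ R.shape ↔ a < p) :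
    rank (fun a => a = p ∨ (a, 0) ∈ R.points) p = R.firstCol := by
  rw [← card_firstColRows, ← Set.ncard_coe_finset, rank]
  congr 1
  ext a
  rw [Finset.mem_coe, mem_firstColRows]
  constructor
  · rintro ⟨h1, rfl | h2⟩
    · exact (lt_irrefl _ h1).elim
    · exact h2
  · intro h
    exact ⟨(hp a).1 (R.mem_shape_of_mem_points h), Or.inr h⟩

/-- `M` is spread out over the rows with `ρ` and the columns with `κ`: those pointed in the first
column of `R` or first row of `L`, and the corner's own. The rest of `L` is attached below and the
rest of `R` to the right. -/
theorem exists_glue (L R M : Tableau)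
    (hM : ∀ i j, (i, j) ∈ M.shape ↔ i ≤ R.firstCol ∧ j ≤ L.firstRow) :
    ∃ (T : Tableau) (p q : ℕ), IsCorner T.shape (p, q) ∧ IsLeftPart T p q L ∧
      IsRightPart T p q R ∧ IsMiddlePart T p q M := by
  obtain ⟨p, hp⟩ : ∃ p, ∀ a, (a, 0) ∈ R.shape ↔ a < p :=
    ⟨_, fun a => (R.lt_colLen a 0).symm⟩
  obtain ⟨q, hq⟩ : ∃ q, ∀ b, (0, b) ∈ L.shape ↔ b < q :=
    ⟨L.transpose.shape.colLen 0, fun b => by rw [lt_colLen, mem_shape_transpose]⟩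
  obtain ⟨ρ, hρ⟩ : ∃ ρ : ℕ → Prop, ρ = fun a => a = p ∨ (a, 0) ∈ R.points := ⟨_, rfl⟩
  obtain ⟨κ, hκ⟩ : ∃ κ : ℕ → Prop, κ = fun b => b = q ∨ (0, b) ∈ L.points := ⟨_, rfl⟩
  have hrp : rank ρ p = R.firstCol := hρ ▸ rank_firstCol R hp
  have hrq : rank κ q = L.firstRow := by
    rw [hκ, ← L.firstCol_transpose, ← rank_firstCol L.transpose (p := q)
      (fun a => by rw [mem_shape_transpose, hq])]
    simp only [mem_points_transpose]
  rw [← hrp, ← hrq] at hM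
  have hρp : ρ p := by rw [hρ]; exact Or.inl rfl
  have hκq : κ q := by rw [hκ]; exact Or.inl rfl
  have hρ' : ∀ a < p, ρ a ↔ (a, 0) ∈ R.points := fun a ha => by
    rw [hρ]
    exact ⟨fun h => h.resolve_left (by omega), Or.inr⟩
  have hκ' : ∀ b < q, κ b ↔ (0, b) ∈ L.points := fun b hb => by
    rw [hκ]
    exact ⟨fun h => h.resolve_left (by omega), Or.inr⟩
  clear hρ hκ hrp hrq
  have hρ0 : ρ 0 := by
    rcases Nat.eq_zero_or_pos p with h | h
    · exact h ▸ hρp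
    · exact (hρ' 0 h).2 (R.root_mem ((hp 0).2 h))
  have hκ0 : κ 0 := by
    rcases Nat.eq_zero_or_pos q with h | h
    · exact h ▸ hκq
    · exact (hκ' 0 h).2 (L.root_mem ((hq 0).2 h))
  have hLq : ∀ {a b}, (a, b) ∈ L.shape → b < q := fun {a b} h =>
    (hq b).1 (L.shape.up_left_mem (Nat.zero_le _) le_rfl h)
  have hRp : ∀ {a b}, (a, b) ∈ R.shape → a < p := fun {a b} h =>
    (hp a).1 (R.shape.up_left_mem le_rfl (Nat.zero_le _) h)
  have hMrow : ∀ a ≤ p, ρ a → ∃ b ≤ q, κ b ∧ (rank ρ a, rank κ b) ∈ M.points := by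
    intro a ha _
    obtain ⟨j, hj⟩ := M.row_nonempty (rank ρ a) 0 ((hM _ _).2 ⟨rank_mono ρ ha, Nat.zero_le _⟩)
    obtain ⟨b, hb, h1, rfl⟩ :=
      exists_rank_eq_of_le hκq ((hM _ _).1 (M.mem_shape_of_mem_points hj)).2
    exact ⟨b, hb, h1, hj⟩
  have hMcol : ∀ b ≤ q, κ b → ∃ a ≤ p, ρ a ∧ (rank ρ a, rank κ b) ∈ M.points := by
    intro b hb _
    obtain ⟨i, hi⟩ := M.col_nonempty 0 (rank κ b) ((hM _ _).2 ⟨Nat.zero_le _, rank_mono κ hb⟩)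
    obtain ⟨a, ha, h1, rfl⟩ :=
      exists_rank_eq_of_le hρp ((hM _ _).1 (M.mem_shape_of_mem_points hi)).1
    exact ⟨a, ha, h1, hi⟩
  have hMroot : (0, 0) ∈ M.points := M.root_mem ((hM 0 0).2 ⟨Nat.zero_le _, Nat.zero_le _⟩)
  obtain ⟨N, hN⟩ := L.exists_bound
  obtain ⟨N', hN'⟩ := R.exists_bound
  -- For p < a the row a - p is at least 1, so the auxiliary first row of `L` is left out; likewise
  -- for `R`.
  let D : ℕ → ℕ → Prop := fun a b => (a ≤ p ∧ b ≤ q) ∨ (p < a ∧ (a - p, b) ∈ L.shape) ∨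
    (q < b ∧ (a, b - q) ∈ R.shape)
  let P : ℕ → ℕ → Prop := fun a b =>
    (a ≤ p ∧ b ≤ q ∧ ρ a ∧ κ b ∧ (rank ρ a, rank κ b) ∈ M.points) ∨
      (p < a ∧ (a - p, b) ∈ L.points) ∨ (q < b ∧ (a, b - q) ∈ R.points)
  have hPmid : ∀ {a b}, a ≤ p → b ≤ q →
      (P a b ↔ ρ a ∧ κ b ∧ (rank ρ a, rank κ b) ∈ M.points) := by
    intro a b ha hb
    constructor
    · rintro (h | h | h)
      · exact h.2.2
      · omega
      · omega
    · exact fun h => Or.inl ⟨ha, hb, h⟩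
  have hPL : ∀ {a b}, p < a → (P a b ↔ (a - p, b) ∈ L.points) := by
    intro a b ha
    constructor
    · rintro (h | h | h)
      · omega
      · exact h.2
      · have := hRp (R.mem_shape_of_mem_points h.2)
        omega
    · exact fun h => Or.inr (Or.inl ⟨ha, h⟩)
  have hPR : ∀ {a b}, q < b → (P a b ↔ (a, b - q) ∈ R.points) := by
    intro a b hb
    constructor
    · rintro (h | h | h)
      · omega
      · have := hLq (L.mem_shape_of_mem_points h.2)
        omega
      · exact h.2
    · exact fun h => Or.inr (Or.inr ⟨hb, h⟩)
  have hDL : ∀ {a b}, p < a → (D a b ↔ (a - p, b) ∈ L.shape) := by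
    intro a b ha
    constructor
    · rintro (h | h | h)
      · omega
      · exact h.2
      · have := hRp h.2
        omega
    · exact fun h => Or.inr (Or.inl ⟨ha, h⟩)
  have hDR : ∀ {a b}, q < b → (D a b ↔ (a, b - q) ∈ R.shape) := by
    intro a b hb
    constructor
    · rintro (h | h | h)
      · omega
      · have := hLq h.2
        omega
      · exact h.2
    · exact fun h => Or.inr (Or.inr ⟨hb, h⟩)
  have hrowmid : ∀ a ≤ p, (∃ b ≤ q, P a b) ↔ ρ a := by
    intro a ha
    constructor
    · rintro ⟨b, hb, h⟩
      exact ((hPmid ha hb).1 h).1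
    · intro h
      obtain ⟨b, hb, h1, h2⟩ := hMrow a ha h
      exact ⟨b, hb, (hPmid ha hb).2 ⟨h, h1, h2⟩⟩
  have hcolmid : ∀ b ≤ q, (∃ a ≤ p, P a b) ↔ κ b := by
    intro b hb
    constructor
    · rintro ⟨a, ha, h⟩
      exact ((hPmid ha hb).1 h).2.1
    · intro h
      obtain ⟨a, ha, h1, h2⟩ := hMcol b hb h
      exact ⟨a, ha, (hPmid ha hb).2 ⟨h1, h, h2⟩⟩
  have habove : ∀ {a b}, p < a → b < q →
      ((∃ i < a, P i b) ↔ ∃ i < a - p, (i, b) ∈ L.points) := by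
    intro a b ha hb
    constructor
    · rintro ⟨i, hi, h⟩
      rcases le_or_gt i p with hip | hip
      · exact ⟨0, by omega, (hκ' b hb).1 ((hcolmid b hb.le).1 ⟨i, hip, h⟩)⟩
      · exact ⟨i - p, by omega, (hPL hip).1 h⟩
    · rintro ⟨_ | i, hi, h⟩
      · obtain ⟨i, hi, h⟩ := (hcolmid b hb.le).2 ((hκ' b hb).2 h)
        exact ⟨i, by omega, h⟩
      · refine ⟨p + (i + 1), by omega, (hPL (by omega)).2 ?_⟩
        rwa [Nat.add_sub_cancel_left]
  have hleft : ∀ {a b}, a < p → q < b →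
      ((∃ j < b, P a j) ↔ ∃ j < b - q, (a, j) ∈ R.points) := by
    intro a b ha hb
    constructor
    · rintro ⟨j, hj, h⟩
      rcases le_or_gt j q with hjq | hjq
      · exact ⟨0, by omega, (hρ' a ha).1 ((hrowmid a ha.le).1 ⟨j, hjq, h⟩)⟩
      · exact ⟨j - q, by omega, (hPR hjq).1 h⟩
    · rintro ⟨_ | j, hj, h⟩
      · obtain ⟨j, hj, h⟩ := (hrowmid a ha.le).2 ((hρ' a ha).2 h)
        exact ⟨j, by omega, h⟩
      · refine ⟨q + (j + 1), by omega, (hPR (by omega)).2 ?_⟩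
        rwa [Nat.add_sub_cancel_left]
  have hroot : P 0 0 := (hPmid (Nat.zero_le _) (Nat.zero_le _)).2
    ⟨hρ0, hκ0, by rwa [rank_zero, rank_zero]⟩
  obtain ⟨T, hD, hP⟩ : ∃ T : Tableau, (∀ i j, (i, j) ∈ T.shape ↔ D i j) ∧
      ∀ i j, (i, j) ∈ T.points ↔ P i j := by
    refine exists_of_pred D P ?_ ?_ ?_ (fun _ _ _ => hroot) ?_ ?_ ?_
    · refine ⟨N + N' + p + q + 1, ?_⟩
      rintro i j (h | h | h)
      · omega
      · have := hN _ _ h.2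
        omega
      · have := hN' _ _ h.2
        omega
    · rintro i j i' j' hi hj h
      rcases le_or_gt i' p with hi' | hi'
      · rcases le_or_gt j' q with hj' | hj'
        · exact Or.inl ⟨hi', hj'⟩
        · exact (hDR hj').2 (R.shape.up_left_mem hi (by omega) ((hDR (by omega)).1 h))
      · exact (hDL hi').2 (L.shape.up_left_mem (by omega) hj ((hDL (by omega)).1 h))
    · rintro i j (h | h | h)
      · exact Or.inl ⟨h.1, h.2.1⟩
      · exact Or.inr (Or.inl ⟨h.1, L.mem_shape_of_mem_points h.2⟩)
      · exact Or.inr (Or.inr ⟨h.1, R.mem_shape_of_mem_points h.2⟩)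
    · rintro a b (⟨ha, hb, h1, h2, h3⟩ | ⟨ha, h⟩ | ⟨hb, h⟩) h0
      · have e1 : (∃ i < a, P i b) ↔ ∃ i < rank ρ a, (i, rank κ b) ∈ M.points := by
          constructor
          · rintro ⟨i, hi, h⟩
            have h4 := (hPmid (by omega) hb).1 h
            exact ⟨rank ρ i, rank_lt_rank h4.1 hi, h4.2.2⟩
          · rintro ⟨i, hi, h⟩
            obtain ⟨i, hi', h4, rfl⟩ := exists_rank_eq ρ hi
            exact ⟨i, hi', (hPmid (by omega) hb).2 ⟨h4, h2, h⟩⟩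
        have e2 : (∃ j < b, P a j) ↔ ∃ j < rank κ b, (rank ρ a, j) ∈ M.points := by
          constructor
          · rintro ⟨j, hj, h⟩
            have h4 := (hPmid ha (by omega)).1 h
            exact ⟨rank κ j, rank_lt_rank h4.2.1 hj, h4.2.2⟩
          · rintro ⟨j, hj, h⟩
            obtain ⟨j, hj', h4, rfl⟩ := exists_rank_eq κ hj
            exact ⟨j, hj', (hPmid ha (by omega)).2 ⟨h1, h4, h⟩⟩
        rw [e1, e2]
        refine M.parent _ _ h3 fun h => h0 ?_
        simp only [Prod.mk.injEq] at h ⊢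
        exact ⟨rank_inj h1 hρ0 (h.1.trans (rank_zero ρ).symm),
          rank_inj h2 hκ0 (h.2.trans (rank_zero κ).symm)⟩
      · have hb := hLq (L.mem_shape_of_mem_points h)
        rw [habove ha hb]
        simp only [hPL ha]
        refine L.parent _ _ h ?_
        simp only [ne_eq, Prod.mk.injEq]
        omega
      · have ha := hRp (R.mem_shape_of_mem_points h)
        rw [hleft ha hb]
        simp only [hPR hb]
        refine R.parent _ _ h ?_
        simp only [ne_eq, Prod.mk.injEq]
        omega
    · intro a b h
      rcases le_or_gt a p with ha | ha
      · by_cases h1 : ρ a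
        · obtain ⟨b, -, h⟩ := (hrowmid a ha).2 h1
          exact ⟨b, h⟩
        -- A row that is empty in the middle is unpointed in the first column of `R`, so its point
        -- in `R` lies further right and belongs to `T`.
        · have ha' : a < p := ha.lt_of_ne (by rintro rfl; exact h1 hρp)
          obtain ⟨_ | j, hj⟩ := R.row_nonempty a 0 ((hp a).2 ha')
          · exact (h1 ((hρ' a ha').2 hj)).elim
          · refine ⟨q + (j + 1), (hPR (by omega)).2 ?_⟩
            rwa [Nat.add_sub_cancel_left]
      · obtain ⟨j, hj⟩ := L.row_nonempty _ _ ((hDL ha).1 h)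
        exact ⟨j, (hPL ha).2 hj⟩
    · intro a b h
      rcases le_or_gt b q with hb | hb
      · by_cases h1 : κ b
        · obtain ⟨a, -, h⟩ := (hcolmid b hb).2 h1
          exact ⟨a, h⟩
        · have hb' : b < q := hb.lt_of_ne (by rintro rfl; exact h1 hκq)
          obtain ⟨_ | i, hi⟩ := L.col_nonempty 0 b ((hq b).2 hb')
          · exact (h1 ((hκ' b hb').2 hi)).elim
          · refine ⟨p + (i + 1), (hPL (by omega)).2 ?_⟩
            rwa [Nat.add_sub_cancel_left]
      · obtain ⟨i, hi⟩ := R.col_nonempty _ _ ((hDR hb).1 h)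
        exact ⟨i, (hPR hb).2 hi⟩
  refine ⟨T, p, q, ⟨?_, ?_, ?_⟩, ⟨hq, fun a b => ?_, fun b => ?_, fun a b => ?_⟩,
    ⟨hp, fun a b => ?_, fun a => ?_, fun a b => ?_⟩, fun x y => ?_⟩
  · exact (hD _ _).2 (Or.inl ⟨le_rfl, le_rfl⟩)
  · intro h
    have := hLq ((hDL (Nat.lt_succ_self p)).1 ((hD _ _).1 h))
    omega
  · intro h
    have := hRp ((hDR (Nat.lt_succ_self q)).1 ((hD _ _).1 h))
    omega
  · rw [hD, hDL (by omega), show p + 1 + a - p = a + 1 by omega]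
  · simp only [hP]
    constructor
    · intro h
      have hb := hLq (L.mem_shape_of_mem_points h)
      exact ⟨hb, (hcolmid b hb.le).2 ((hκ' b hb).2 h)⟩
    · rintro ⟨hb, h⟩
      exact (hκ' b hb).1 ((hcolmid b hb.le).1 h)
  · rw [hP, hPL (by omega), show p + 1 + a - p = a + 1 by omega]
  · rw [hD, hDR (by omega), show q + 1 + b - q = b + 1 by omega]
  · simp only [hP]
    constructor
    · intro h
      have ha := hRp (R.mem_shape_of_mem_points h)
      exact ⟨ha, (hrowmid a ha.le).2 ((hρ' a ha).2 h)⟩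
    · rintro ⟨ha, h⟩
      exact (hρ' a ha).1 ((hrowmid a ha.le).1 h)
  · rw [hP, hPR (by omega), show q + 1 + b - q = b + 1 by omega]
  · simp only [hP]
    constructor
    · intro h
      have hs := (hM _ _).1 (M.mem_shape_of_mem_points h)
      obtain ⟨a, ha, h1, rfl⟩ := exists_rank_eq_of_le hρp hs.1
      obtain ⟨b, hb, h2, rfl⟩ := exists_rank_eq_of_le hκq hs.2
      exact ⟨a, ha, b, hb, (hPmid ha hb).2 ⟨h1, h2, h⟩,
        rank_congr fun x hx => hrowmid x (by omega), rank_congr fun x hx => hcolmid x (by omega)⟩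
    · rintro ⟨a, ha, b, hb, h, rfl, rfl⟩
      rw [rank_congr fun x hx => hrowmid x (by omega),
        rank_congr fun x hx => hcolmid x (by omega)]
      exact ((hPmid ha hb).1 h).2.2

theorem exists_cutEquiv (n : ℕ) : ∃ cut : Corners n ≃ Triple n,
    ∀ c : Corners n, IsCut c.1.1 c.1.2 (cut c) := by
  refine exists_equiv_of_rel (fun (c : Corners n) (t : Triple n) => IsCut c.1.1 c.1.2 t)
    ?_ ?_ ?_ ?_
  · rintro ⟨⟨T, p, q⟩, hn, hc⟩
    obtain ⟨L, hL⟩ := exists_isLeftPart hc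
    obtain ⟨R, hR⟩ := exists_isRightPart hc
    obtain ⟨M, hM, hs⟩ := exists_isMiddlePart hc
    rw [← hR.firstCol_eq, ← hL.firstRow_eq] at hs
    exact ⟨⟨L, R, ⟨M, hs⟩, (size_of_parts hc hL hR hM hs).trans hn⟩,
      (isCut_iff _ _ _).2 ⟨hL, hR, hM⟩⟩
  · rintro ⟨L, R, ⟨M, hs⟩, hn⟩
    obtain ⟨T, p, q, hc, hL, hR, hM⟩ := exists_glue L R M hs
    exact ⟨⟨⟨T, p, q⟩, (size_of_parts hc hL hR hM hs).symm.trans hn, hc⟩,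
      (isCut_iff _ _ _).2 ⟨hL, hR, hM⟩⟩
  · rintro ⟨⟨T, p, q⟩, hn, hc⟩ ⟨L, R, ⟨M, hs⟩, h⟩ ⟨L', R', ⟨M', hs'⟩, h'⟩ h₁ h₂
    obtain ⟨hL, hR, hM⟩ := (isCut_iff _ _ _).1 h₁
    obtain ⟨hL', hR', hM'⟩ := (isCut_iff _ _ _).1 h₂
    obtain rfl : L = L' := hL.unique hL'
    obtain rfl : R = R' := hR.unique hR'
    obtain rfl : M = M' := ext_mem (fun i j => by rw [hs, hs']) (fun i j => by
      have h1 := hM i j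
      have h2 := hM' i j
      exact h1.trans h2.symm)
    rfl
  · rintro ⟨⟨T, p, q⟩, hn, hc⟩ ⟨⟨T', p', q'⟩, hn', hc'⟩ t h₁ h₂
    obtain ⟨hL, hR, hM⟩ := (isCut_iff _ _ _).1 h₁
    obtain ⟨hL', hR', hM'⟩ := (isCut_iff _ _ _).1 h₂
    obtain ⟨rfl, rfl, rfl⟩ := eq_of_parts hc hc' hL hR hM hL' hR' hM'
    rfl

end TreeLike

namespace TreeLike

/-! ### Enumeration of runs of size one -/

section Letters

variable {n : ℕ} (σ : Equiv.Perm (Fin n))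

theorem letter_zero : letter σ 0 = n + 1 := rfl

theorem letter_succ (i : Fin n) : letter σ (i + 1) = (σ i : ℕ) + 1 := by
  simp [letter]

theorem letter_of_lt {k : ℕ} (h : n < k) : letter σ k = 0 := by
  rw [letter, if_neg (by omega), dif_neg (by omega)]

theorem isAscendingRun_one_iff (k : ℕ) : IsAscendingRun σ k 1 ↔
    1 ≤ k ∧ k ≤ n ∧ letter σ k < letter σ (k - 1) ∧ letter σ (k + 1) < letter σ k := by
  unfold IsAscendingRun
  simp only [le_refl, true_and, Nat.add_sub_cancel]
  refine and_congr_right fun _ => and_congr_right fun _ => and_congr_right fun _ => ?_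
  exact ⟨fun h => h.2, fun h => ⟨fun i h1 h2 => by omega, h⟩⟩

theorem oneLine_eq : oneLine σ = List.ofFn fun i => (σ i : ℕ) + 1 := by
  rw [oneLine, List.ofFn_eq_map, ← List.map_coe_finRange_eq_range, List.map_map]
  exact List.map_congr_left fun i _ => letter_succ σ i

end Letters

/-- The positions of runs of size one. -/
def runsOneEquiv (n : ℕ) : RunsOne n ≃ Σ i : Fin n, {σ : Equiv.Perm (Fin n) //
    letter σ (i + 1) < letter σ i ∧ letter σ (i + 2) < letter σ (i + 1)} where
  toFun r := ⟨⟨r.1.2 - 1, by have := (isAscendingRun_one_iff _ _).1 r.2; omega⟩, r.1.1, by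
    obtain ⟨h1, h2, h3, h4⟩ := (isAscendingRun_one_iff _ _).1 r.2
    obtain ⟨k, hk⟩ := Nat.exists_eq_add_of_le' h1
    simp only [hk, Nat.add_sub_cancel] at h3 h4 ⊢
    exact ⟨h3, h4⟩⟩
  invFun x := ⟨(x.2.1, x.1 + 1), (isAscendingRun_one_iff _ _).2
    ⟨by omega, x.1.2, x.2.2⟩⟩
  left_inv r := by
    obtain ⟨h1, h2, h3, h4⟩ := (isAscendingRun_one_iff _ _).1 r.2
    apply Subtype.ext
    apply Prod.ext
    · rfl
    · simp only
      omega
  right_inv x := rfl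

/-! ### Permutations with a prescribed order of two or three values -/

section Orders

variable {α : Type*} [Fintype α] [LinearOrder α]

/-- Composition with the transposition of `a` and `b` exchanges the two possible orders. -/
theorem two_mul_card_perm_lt {a b : α} (h : a ≠ b) :
    2 * (Finset.univ.filter fun σ : Equiv.Perm α => σ a < σ b).card = (Fintype.card α).factorial := by
  have h1 : (Finset.univ.filter fun σ : Equiv.Perm α => σ a < σ b).card =
      (Finset.univ.filter fun σ : Equiv.Perm α => ¬ σ a < σ b).card := by
    refine Finset.card_equiv (Equiv.mulRight (Equiv.swap a b)) fun σ => ?_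
    have := σ.injective.ne h
    simp only [Finset.mem_filter, Finset.mem_univ, true_and, Equiv.coe_mulRight,
      Equiv.Perm.mul_apply, Equiv.swap_apply_left, Equiv.swap_apply_right, not_lt]
    exact ⟨fun h => h.le, fun h => h.lt_of_ne this⟩
  have h2 := Finset.card_filter_add_card_filter_not (s := Finset.univ)
    fun σ : Equiv.Perm α => σ a < σ b
  rw [Finset.card_univ, Fintype.card_perm] at h2
  omega

theorem card_perm_lt_lt_congr (τ : Equiv.Perm α) (a b c : α) :
    (Finset.univ.filter fun σ : Equiv.Perm α => σ (τ a) < σ (τ b) ∧ σ (τ b) < σ (τ c)).card =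
      (Finset.univ.filter fun σ : Equiv.Perm α => σ a < σ b ∧ σ b < σ c).card := by
  refine Finset.card_equiv (Equiv.mulRight τ) fun σ => ?_
  simp

/-- Given σ a < σ b, the value at `c` lies above, between or below. Relabelling shows that the three
cases are equally frequent, so each is a third of a half. -/
theorem six_mul_card_perm_lt_lt {a b c : α} (hab : a ≠ b) (hac : a ≠ c) (hbc : b ≠ c) :
    6 * (Finset.univ.filter fun σ : Equiv.Perm α => σ a < σ b ∧ σ b < σ c).card =
      (Fintype.card α).factorial := by
  have h1 := card_perm_lt_lt_congr (Equiv.swap b c) a b c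
  have h2 := card_perm_lt_lt_congr (Equiv.swap a c) a c b
  rw [Equiv.swap_apply_left, Equiv.swap_apply_right, Equiv.swap_apply_of_ne_of_ne hab hac] at h1
  rw [Equiv.swap_apply_left, Equiv.swap_apply_right,
    Equiv.swap_apply_of_ne_of_ne hab.symm hbc, h1] at h2
  have h3 := two_mul_card_perm_lt hab
  have h4 : (Finset.univ.filter fun σ : Equiv.Perm α => σ a < σ b) =
      ((Finset.univ.filter fun σ : Equiv.Perm α => σ a < σ b ∧ σ b < σ c) ∪
        (Finset.univ.filter fun σ : Equiv.Perm α => σ a < σ c ∧ σ c < σ b)) ∪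
        (Finset.univ.filter fun σ : Equiv.Perm α => σ c < σ a ∧ σ a < σ b) := by
    ext σ
    have n1 := σ.injective.ne hac
    have n2 := σ.injective.ne hbc
    simp only [Finset.mem_filter, Finset.mem_univ, true_and, Finset.mem_union]
    constructor
    · intro h
      rcases lt_or_gt_of_ne n2 with h5 | h5
      · exact Or.inl (Or.inl ⟨h, h5⟩)
      · rcases lt_or_gt_of_ne n1 with h6 | h6
        · exact Or.inl (Or.inr ⟨h6, h5⟩)
        · exact Or.inr ⟨h6, h⟩
    · rintro ((h | h) | h)
      · exact h.1
      · exact h.1.trans h.2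
      · exact h.2
  have h5 : (Finset.univ.filter fun σ : Equiv.Perm α => σ a < σ b).card = 3 *
      (Finset.univ.filter fun σ : Equiv.Perm α => σ a < σ b ∧ σ b < σ c).card := by
    rw [h4, Finset.card_union_of_disjoint, Finset.card_union_of_disjoint, h1, h2]
    · ring
    · rw [Finset.disjoint_left]
      intro σ
      simp only [Finset.mem_filter, Finset.mem_univ, true_and]
      exact fun h h' => lt_asymm h.2 h'.2
    · rw [Finset.disjoint_left]
      intro σ
      simp only [Finset.mem_filter, Finset.mem_univ, true_and, Finset.mem_union]
      rintro (h | h) h'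
      · exact lt_asymm (h.1.trans h.2) h'.1
      · exact lt_asymm h.1 h'.1
  omega

end Orders

theorem card_runsOne_one : Nat.card (RunsOne 1) = 1 := by
  have : Unique (RunsOne 1) :=
    { default := ⟨(1, 1), by rw [isAscendingRun_one_iff]; decide⟩
      uniq := by
        rintro ⟨⟨σ, k⟩, h⟩
        have := (isAscendingRun_one_iff _ _).1 h
        apply Subtype.ext
        apply Prod.ext
        · exact Subsingleton.elim _ _
        · simp only at this ⊢
          omega }
  exact Nat.card_unique

section RunsAt

variable {n : ℕ} (i : Fin n)

/-- The convention σ_0 = n + 1 makes the first descent automatic, so one comparison remains; `2 ≤ n`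
ensures that a second letter exists. At the last position the convention σ_{n+1} = 0 plays the same
role, and inside three letters have to decrease. -/
theorem two_mul_card_runs_first (hn : 2 ≤ n) (hi : (i : ℕ) = 0) :
    2 * (Finset.univ.filter fun σ : Equiv.Perm (Fin n) =>
      letter σ (i + 1) < letter σ i ∧ letter σ (i + 2) < letter σ (i + 1)).card = n.factorial := by
  have h := two_mul_card_perm_lt (a := (⟨i + 1, by omega⟩ : Fin n)) (b := i) (by simp [Fin.ext_iff])
  rw [Fintype.card_fin] at h
  rw [← h]
  congr 2
  ext σ
  have h1 := letter_succ σ ⟨i + 1, by omega⟩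
  simp only at h1
  simp only [Finset.mem_filter, Finset.mem_univ, true_and]
  have h2 : letter σ i = n + 1 := by rw [hi, letter_zero]
  rw [letter_succ, h1, h2, Fin.lt_def]
  have := (σ i).2
  omega

theorem two_mul_card_runs_last (hn : 2 ≤ n) (hi : (i : ℕ) + 1 = n) :
    2 * (Finset.univ.filter fun σ : Equiv.Perm (Fin n) =>
      letter σ (i + 1) < letter σ i ∧ letter σ (i + 2) < letter σ (i + 1)).card = n.factorial := by
  have h := two_mul_card_perm_lt (a := i) (b := (⟨i - 1, by omega⟩ : Fin n))
    (by simp only [ne_eq, Fin.ext_iff]; omega)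
  rw [Fintype.card_fin] at h
  rw [← h]
  congr 2
  ext σ
  have h1 := letter_succ σ ⟨i - 1, by omega⟩
  simp only [show (i : ℕ) - 1 + 1 = i by omega] at h1
  simp only [Finset.mem_filter, Finset.mem_univ, true_and]
  rw [letter_succ, h1, letter_of_lt σ (by omega), Fin.lt_def]
  omega

theorem six_mul_card_runs_middle (hi : 0 < (i : ℕ)) (hi' : (i : ℕ) + 1 < n) :
    6 * (Finset.univ.filter fun σ : Equiv.Perm (Fin n) =>
      letter σ (i + 1) < letter σ i ∧ letter σ (i + 2) < letter σ (i + 1)).card = n.factorial := by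
  have h := six_mul_card_perm_lt_lt (a := (⟨i + 1, hi'⟩ : Fin n)) (b := i)
    (c := (⟨i - 1, by omega⟩ : Fin n)) (by simp [Fin.ext_iff])
    (by simp only [ne_eq, Fin.ext_iff]; omega) (by simp only [ne_eq, Fin.ext_iff]; omega)
  rw [Fintype.card_fin] at h
  rw [← h]
  congr 2
  ext σ
  have h1 := letter_succ σ ⟨i - 1, by omega⟩
  have h2 := letter_succ σ ⟨i + 1, hi'⟩
  simp only [show (i : ℕ) - 1 + 1 = i by omega] at h1 h2
  simp only [Finset.mem_filter, Finset.mem_univ, true_and]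
  rw [letter_succ, h1, h2, Fin.lt_def, Fin.lt_def]
  omega

end RunsAt

/-- With n = m + 2 the two ends contribute n! together and the m inner positions m n!/6; the sum is
n! (m + 6)/6. -/
theorem card_runsOne {n : ℕ} (hn : 2 ≤ n) :
    (Nat.card (RunsOne n) : ℚ) = (n.factorial : ℚ) * ((n : ℚ) + 4) / 6 := by
  obtain ⟨m, rfl⟩ := Nat.exists_eq_add_of_le' hn
  rw [Nat.card_congr (runsOneEquiv _), Nat.card_eq_fintype_card, Fintype.card_sigma]
  simp only [Fintype.card_subtype]
  obtain ⟨f, hf⟩ : ∃ f : Fin (m + 2) → ℕ, ∀ i, f i =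
      (Finset.univ.filter fun σ : Equiv.Perm (Fin (m + 2)) =>
        letter σ (i + 1) < letter σ i ∧ letter σ (i + 2) < letter σ (i + 1)).card :=
    ⟨_, fun _ => rfl⟩
  have h0 : 2 * f 0 = (m + 2).factorial := by
    rw [hf]
    exact two_mul_card_runs_first (0 : Fin (m + 2)) hn rfl
  have h1 : 2 * f (Fin.last (m + 1)) = (m + 2).factorial := by
    rw [hf]
    exact two_mul_card_runs_last (Fin.last (m + 1)) hn (by simp)
  have h2 : ∀ i : Fin m, 6 * f i.castSucc.succ = (m + 2).factorial := fun i => by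
    rw [hf]
    exact six_mul_card_runs_middle (i.castSucc.succ : Fin (m + 2)) (by simp) (by simp)
  rw [← Finset.sum_congr rfl fun i _ => hf i]
  rw [Fin.sum_univ_succ, Fin.sum_univ_castSucc, Fin.succ_last]
  have h3 : 6 * ∑ i : Fin m, f i.castSucc.succ = m * (m + 2).factorial := by
    rw [Finset.mul_sum, Finset.sum_congr rfl fun i _ => h2 i]
    simp
  have h4 : (6 * (f 0 + (∑ i : Fin m, f i.castSucc.succ + f (Fin.last (m + 1)))) : ℚ) =
      (m + 2).factorial * (m + 6) := by
    have h0' : (2 * f 0 : ℚ) = (m + 2).factorial := by exact_mod_cast h0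
    have h1' : (2 * f (Fin.last (m + 1)) : ℚ) = (m + 2).factorial := by exact_mod_cast h1
    have h3' : (6 * ∑ i : Fin m, (f i.castSucc.succ : ℚ)) = m * (m + 2).factorial := by
      exact_mod_cast h3
    push_cast
    linear_combination 3 * h0' + 3 * h1' + h3'
  push_cast at h4 ⊢
  linear_combination h4 / 6

end TreeLike

namespace TreeLike

/-! ### Decomposition of a word into pieces -/

section Pieces

variable {γ : Type*} (c : ℕ → γ)

/-- A piece: a non-empty word that starts with its maximum, all letters having the same class. -/
def IsPiece (p : List ℕ) : Prop := p ≠ [] ∧ ∀ y ∈ p.tail, y < p.headD 0 ∧ c y = c (p.headD 0)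

/-- Pieces of the same class have increasing first letters. -/
def PieceRel (p q : List ℕ) : Prop := c (p.headD 0) = c (q.headD 0) → p.headD 0 < q.headD 0

/-- The decompositions of words at the left-to-right maxima of their blocks of letters of
the same class. -/
def IsPieces (ps : List (List ℕ)) : Prop := (∀ p ∈ ps, IsPiece c p) ∧ ps.IsChain (PieceRel c)

variable {c}

theorem isPiece_singleton (y : ℕ) : IsPiece c [y] := ⟨by simp, by simp⟩

theorem IsPiece.class_eq {p : List ℕ} (h : IsPiece c p) {y : ℕ} (hy : y ∈ p) :
    c y = c (p.headD 0) := by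
  rcases p with _ | ⟨x, t⟩
  · simp at hy
  · rcases List.mem_cons.1 hy with rfl | hy
    · rfl
    · exact (h.2 y hy).2

theorem isPiece_append_singleton_iff {p : List ℕ} (hp : p ≠ []) {y : ℕ} :
    IsPiece c (p ++ [y]) ↔ IsPiece c p ∧ y < p.headD 0 ∧ c y = c (p.headD 0) := by
  rcases p with _ | ⟨x, t⟩
  · exact (hp rfl).elim
  · simp only [IsPiece, List.cons_append, List.tail_cons, List.mem_append, List.mem_singleton,
      List.headD_cons]
    constructor
    · rintro ⟨-, h⟩
      exact ⟨⟨by simp, fun z hz => h z (Or.inl hz)⟩, h y (Or.inr rfl)⟩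
    · rintro ⟨⟨-, h⟩, h'⟩
      refine ⟨by simp, ?_⟩
      rintro z (hz | rfl)
      · exact h z hz
      · exact h'

theorem isPieces_append_singleton_iff {ps : List (List ℕ)} {p : List ℕ} :
    IsPieces c (ps ++ [p]) ↔ IsPieces c ps ∧ IsPiece c p ∧ ∀ q ∈ ps.getLast?, PieceRel c q p := by
  simp only [IsPieces, List.mem_append, List.mem_singleton, List.isChain_append,
    List.head?_cons, Option.mem_def, Option.some.injEq, forall_eq', or_imp, forall_and, forall_eq,
    List.isChain_singleton, true_and]
  tauto

theorem headD_append {p q : List ℕ} (hp : p ≠ []) : (p ++ q).headD 0 = p.headD 0 := by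
  rcases p with _ | ⟨x, t⟩
  · exact (hp rfl).elim
  · rfl

theorem pieceRel_append_right {p q r : List ℕ} (hq : q ≠ []) :
    PieceRel c p (q ++ r) ↔ PieceRel c p q := by
  rw [PieceRel, headD_append hq, PieceRel]

/-- A letter appended to the word extends the last piece if it has the same class and is smaller
than the head, and starts a new piece otherwise. Distinctness excludes equality with the head. -/
theorem exists_isPieces {w : List ℕ} (hw : w.Nodup) : ∃ ps, IsPieces c ps ∧ ps.flatten = w := by
  induction w using List.reverseRecOn with
  | nil => exact ⟨[], ⟨by simp, by simp⟩, rfl⟩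
  | append_singleton w y ih =>
    obtain ⟨ps, hps, rfl⟩ := ih (List.nodup_append.1 hw).1
    rcases ps.eq_nil_or_concat' with rfl | ⟨ps, p, rfl⟩
    · refine ⟨[[y]], ⟨?_, by simp⟩, rfl⟩
      simpa using isPiece_singleton y
    · have h := isPieces_append_singleton_iff.1 hps
      by_cases hy : y < p.headD 0 ∧ c y = c (p.headD 0)
      · refine ⟨ps ++ [p ++ [y]], isPieces_append_singleton_iff.2 ⟨h.1,
          (isPiece_append_singleton_iff h.2.1.1).2 ⟨h.2.1, hy⟩, fun q hq => ?_⟩, by simp⟩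
        rw [pieceRel_append_right h.2.1.1]
        exact h.2.2 q hq
      · refine ⟨(ps ++ [p]) ++ [[y]], isPieces_append_singleton_iff.2 ⟨hps,
          isPiece_singleton y, ?_⟩, by simp⟩
        intro q hq hc
        simp only [List.getLast?_append, List.getLast?_singleton, Option.some_or, Option.mem_def,
          Option.some.injEq] at hq
        subst hq
        refine lt_of_le_of_ne (not_lt.1 fun hlt => hy ⟨hlt, hc.symm⟩) fun heq => ?_
        have hmem : p.headD 0 ∈ (ps ++ [p]).flatten := by
          rcases p with _ | ⟨x, t⟩
          · exact (h.2.1.1 rfl).elim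
          · simp
        exact (List.nodup_append.1 hw).2.2 _ hmem y (by simp) heq

/-- Induction on the last letter. Whether it extends the last piece or starts a new one is forced by
comparison with the head of that piece. -/
theorem IsPieces.unique {ps qs : List (List ℕ)} (hp : IsPieces c ps) (hq : IsPieces c qs)
    (h : ps.flatten = qs.flatten) : ps = qs := by
  obtain ⟨w, hw⟩ : ∃ w, qs.flatten = w := ⟨_, rfl⟩
  rw [hw] at h
  induction w using List.reverseRecOn generalizing ps qs with
  | nil =>
    have key : ∀ {ps : List (List ℕ)}, IsPieces c ps → ps.flatten = [] → ps = [] := by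
      intro ps hp h
      rcases ps with _ | ⟨p, ps⟩
      · rfl
      · have := (hp.1 p (by simp)).1
        simp_all
    rw [key hp h, key hq hw]
  | append_singleton w y ih =>
    have key : ∀ {ps : List (List ℕ)}, IsPieces c ps → ps.flatten = w ++ [y] →
        ∃ ps' p', ps = ps' ++ [p' ++ [y]] ∧ (ps' ++ [p']).flatten = w := by
      intro ps hp h
      rcases ps.eq_nil_or_concat' with rfl | ⟨ps, p, rfl⟩
      · simp at h
      · rcases p.eq_nil_or_concat' with rfl | ⟨p, z, rfl⟩
        · exact ((hp.1 [] (by simp)).1 rfl).elim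
        · rw [List.flatten_append, List.flatten_singleton, ← List.append_assoc] at h
          obtain ⟨h1, h2⟩ := List.append_inj' h rfl
          obtain rfl : z = y := by simpa using h2
          exact ⟨ps, p, rfl, by simpa using h1⟩
    obtain ⟨ps, p, rfl, hps⟩ := key hp h
    obtain ⟨qs, q, rfl, hqs⟩ := key hq hw
    rw [isPieces_append_singleton_iff] at hp hq
    have key2 : ∀ {ps : List (List ℕ)} {p : List ℕ}, p ≠ [] → IsPieces c ps →
        IsPiece c (p ++ [y]) → (∀ q ∈ ps.getLast?, PieceRel c q (p ++ [y])) →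
        IsPieces c (ps ++ [p]) := by
      intro ps p h h1 h2 h3
      refine isPieces_append_singleton_iff.2 ⟨h1, ((isPiece_append_singleton_iff h).1 h2).1, ?_⟩
      simpa only [pieceRel_append_right h] using h3
    -- If `y` continues the piece `p`, it is smaller than the head of `p` and of its class; if it
    -- starts a new piece after the same `p`, it would have to be larger.
    have key3 : ∀ {ps qs : List (List ℕ)} {p : List ℕ}, p ≠ [] → IsPiece c (p ++ [y]) →
        (∀ q ∈ qs.getLast?, PieceRel c q [y]) → qs = ps ++ [p] → False := by
      rintro ps _ p hne h1 h2 rfl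
      have h3 := h2 p (by simp)
      have h4 := ((isPiece_append_singleton_iff hne).1 h1).2
      exact lt_asymm h4.1 (h3 h4.2.symm)
    by_cases hp0 : p = [] <;> by_cases hq0 : q = []
    · subst hp0 hq0
      rw [ih hp.1 hq.1 (by simpa using hps) (by simpa using hqs)]
    · subst hp0
      exact (key3 hq0 hq.2.1 hp.2.2
        (ih hp.1 (key2 hq0 hq.1 hq.2.1 hq.2.2) (by simpa using hps) hqs)).elim
    · subst hq0
      exact (key3 hp0 hp.2.1 hq.2.2
        (ih (key2 hp0 hp.1 hp.2.1 hp.2.2) hq.1 hps (by simpa using hqs)).symm).elim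
    · have h1 := ih (key2 hp0 hp.1 hp.2.1 hp.2.2) (key2 hq0 hq.1 hq.2.1 hq.2.2) hps hqs
      obtain ⟨h2, h3⟩ := List.append_inj' h1 rfl
      rw [h2, List.singleton_injective h3]

end Pieces

/-! ### Words of distinct numbers as permutations -/

theorem exists_perm_of_nodup {s m : ℕ} {w : List ℕ} (hw : w.Nodup)
    (hmem : ∀ v, v ∈ w ↔ s < v ∧ v ≤ s + m) :
    ∃ σ : Equiv.Perm (Fin m), w = List.ofFn fun i => s + (σ i : ℕ) + 1 := by
  have hperm : w.Perm ((List.finRange m).map fun i : Fin m => s + (i : ℕ) + 1) := by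
    refine (List.perm_ext_iff_of_nodup hw ((List.nodup_finRange m).map fun i j h => ?_)).2 ?_
    · simpa [Fin.ext_iff] using h
    · intro v
      rw [hmem]
      simp only [List.mem_map, List.mem_finRange, true_and]
      constructor
      · rintro ⟨h1, h2⟩
        exact ⟨⟨v - s - 1, by omega⟩, by simp only; omega⟩
      · rintro ⟨i, rfl⟩
        omega
  have hlen : w.length = m := by rw [hperm.length_eq]; simp
  subst hlen
  have hb : ∀ i : Fin w.length, s < w[i] ∧ w[i] ≤ s + w.length := fun i =>
    (hmem _).1 (List.getElem_mem _)
  let f : Fin w.length → Fin w.length := fun i => ⟨w[i] - s - 1, by have := hb i; omega⟩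
  have hf : Function.Injective f := by
    intro i j h
    have h1 := hb i
    have h2 := hb j
    simp only [f, Fin.mk.injEq] at h
    apply Fin.ext
    exact (List.Nodup.getElem_inj_iff hw).1 (show w[i] = w[j] by omega)
  refine ⟨Equiv.ofBijective f (Finite.injective_iff_bijective.1 hf), ?_⟩
  apply List.ext_getElem
  · simp
  · intro i h1 h2
    have := hb ⟨i, h1⟩
    simp only [Fin.getElem_fin] at this
    simp [f]
    omega

theorem ofFn_perm_injective {s m : ℕ} {σ τ : Equiv.Perm (Fin m)}
    (h : (List.ofFn fun i => s + (σ i : ℕ) + 1) = List.ofFn fun i => s + (τ i : ℕ) + 1) :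
    σ = τ := by
  ext i
  have : s + (σ i : ℕ) + 1 = s + τ i + 1 := congrFun (List.ofFn_injective h) i
  omega

/-! ### Cycle words -/

section CycleWords

variable {m : ℕ} (π : Equiv.Perm (Fin m))

/-- The word `M, π(M), π(π(M)), …`, with all values shifted by `s`. -/
noncomputable def cycleWord (s : ℕ) (M : Fin m) : List ℕ :=
  (List.range (Function.minimalPeriod π M)).map fun t => s + (((π ^ t) M : Fin m) : ℕ) + 1

open Classical in
/-- The maxima of the cycles. -/
noncomputable def cycleMaxima : List (Fin m) :=
  (List.finRange m).filter fun M => ∀ x, π.SameCycle M x → x ≤ M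

theorem cycleWords_eq (s : ℕ) : cycleWords s π = (cycleMaxima π).map (cycleWord π s) := rfl

theorem mem_cycleMaxima {M : Fin m} : M ∈ cycleMaxima π ↔ ∀ x, π.SameCycle M x → x ≤ M := by
  simp [cycleMaxima]

theorem minimalPeriod_pos (M : Fin m) : 0 < Function.minimalPeriod π M := by
  apply Function.minimalPeriod_pos_of_mem_periodicPts
  refine ⟨orderOf π, orderOf_pos π, ?_⟩
  rw [Function.IsPeriodicPt, Function.IsFixedPt, Equiv.Perm.iterate_eq_pow, pow_orderOf_eq_one]
  rfl

theorem pow_mod_minimalPeriod (M : Fin m) (t : ℕ) :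
    (π ^ (t % Function.minimalPeriod π M)) M = (π ^ t) M := by
  rw [← Equiv.Perm.iterate_eq_pow, ← Equiv.Perm.iterate_eq_pow,
    Function.iterate_mod_minimalPeriod_eq]

theorem pow_eq_iff_of_lt {M : Fin m} {t t' : ℕ} (h : t < Function.minimalPeriod π M)
    (h' : t' < Function.minimalPeriod π M) : (π ^ t) M = (π ^ t') M ↔ t = t' := by
  rw [← Equiv.Perm.iterate_eq_pow, ← Equiv.Perm.iterate_eq_pow]
  exact Function.iterate_eq_iterate_iff_of_lt_minimalPeriod h h'

theorem exists_pow_eq_of_sameCycle {M x : Fin m} (h : π.SameCycle M x) :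
    ∃ t < Function.minimalPeriod π M, (π ^ t) M = x := by
  obtain ⟨t, -, ht⟩ := h.exists_pow_eq'
  exact ⟨_, Nat.mod_lt t (minimalPeriod_pos π M), (pow_mod_minimalPeriod π M t).trans ht⟩

theorem mem_cycleWord {s : ℕ} {M : Fin m} {v : ℕ} :
    v ∈ cycleWord π s M ↔ ∃ x, π.SameCycle M x ∧ v = s + x + 1 := by
  rw [cycleWord, List.mem_map]
  constructor
  · rintro ⟨t, -, rfl⟩
    exact ⟨_, ⟨t, rfl⟩, rfl⟩
  · rintro ⟨x, hx, rfl⟩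
    obtain ⟨t, ht, rfl⟩ := exists_pow_eq_of_sameCycle π hx
    exact ⟨t, List.mem_range.2 ht, rfl⟩

theorem nodup_cycleWord (s : ℕ) (M : Fin m) : (cycleWord π s M).Nodup := by
  refine List.Nodup.map_on ?_ List.nodup_range
  intro t ht t' ht' h
  rw [List.mem_range] at ht ht'
  rw [← pow_eq_iff_of_lt π ht ht']
  ext
  omega

theorem headD_cycleWord (s : ℕ) (M : Fin m) : (cycleWord π s M).headD 0 = s + M + 1 := by
  obtain ⟨k, hk⟩ := Nat.exists_eq_add_of_le' (minimalPeriod_pos π M)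
  rw [cycleWord, hk, List.range_succ_eq_map]
  simp

theorem cycleWord_ne_nil (s : ℕ) (M : Fin m) : cycleWord π s M ≠ [] := by
  rw [cycleWord, ne_eq, List.map_eq_nil_iff, List.range_eq_nil]
  exact (minimalPeriod_pos π M).ne'

theorem eq_of_mem_cycleMaxima {M M' : Fin m} (hM : M ∈ cycleMaxima π) (hM' : M' ∈ cycleMaxima π)
    (h : π.SameCycle M M') : M = M' :=
  le_antisymm ((mem_cycleMaxima π).1 hM' _ h.symm) ((mem_cycleMaxima π).1 hM _ h)

theorem exists_mem_cycleMaxima (x : Fin m) : ∃ M ∈ cycleMaxima π, π.SameCycle M x := by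
  classical
  obtain ⟨M, hM, hmax⟩ := (Finset.univ.filter fun y => π.SameCycle x y).exists_max_image id
    ⟨x, by simp [Equiv.Perm.SameCycle.refl]⟩
  simp only [Finset.mem_filter, Finset.mem_univ, true_and, id] at hM hmax
  exact ⟨M, (mem_cycleMaxima π).2 fun y hy => hmax y (hM.trans hy), hM.symm⟩

theorem isPieces_cycleWords {γ : Type*} {c : ℕ → γ} {s : ℕ}
    (hc : ∀ x y : Fin m, c (s + x + 1) = c (s + y + 1)) : IsPieces c (cycleWords s π) := by
  rw [cycleWords_eq]
  constructor
  · intro p hp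
    obtain ⟨M, hM, rfl⟩ := List.mem_map.1 hp
    have hM' := (mem_cycleMaxima π).1 hM
    refine ⟨cycleWord_ne_nil π s M, fun y hy => ?_⟩
    rw [headD_cycleWord]
    obtain ⟨x, hx, rfl⟩ := (mem_cycleWord π).1 (List.mem_of_mem_tail hy)
    refine ⟨?_, hc _ _⟩
    have h1 := hM' x hx
    have h2 : x ≠ M := by
      rintro rfl
      have h3 := nodup_cycleWord π s x
      have h4 := headD_cycleWord π s x
      rcases h5 : cycleWord π s x with _ | ⟨z, t⟩
      · exact cycleWord_ne_nil π s x h5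
      · rw [h5] at h3 h4 hy
        rw [List.headD_cons] at h4
        rw [List.tail_cons, ← h4] at hy
        exact (List.nodup_cons.1 h3).1 hy
    have h3 := lt_of_le_of_ne h1 h2
    rw [Fin.lt_def] at h3
    omega
  · rw [List.isChain_map]
    have h1 : (cycleMaxima π).Pairwise (· < ·) :=
      ((List.pairwise_lt_finRange m).filter _)
    refine h1.isChain.imp fun M M' h _ => ?_
    rw [headD_cycleWord, headD_cycleWord]
    rw [Fin.lt_def] at h
    omega

theorem mem_flatten_cycleWords {s v : ℕ} :
    v ∈ (cycleWords s π).flatten ↔ s < v ∧ v ≤ s + m := by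
  simp only [cycleWords_eq, List.mem_flatten, List.mem_map, exists_exists_and_eq_and, mem_cycleWord]
  constructor
  · rintro ⟨M, -, x, -, rfl⟩
    omega
  · rintro ⟨h1, h2⟩
    obtain ⟨M, hM, h⟩ := exists_mem_cycleMaxima π ⟨v - s - 1, by omega⟩
    exact ⟨M, hM, _, h, by simp only; omega⟩

theorem nodup_flatten_cycleWords (s : ℕ) : (cycleWords s π).flatten.Nodup := by
  rw [cycleWords_eq, List.nodup_flatten]
  constructor
  · intro p hp
    obtain ⟨M, hM, rfl⟩ := List.mem_map.1 hp
    exact nodup_cycleWord π s M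
  · rw [List.pairwise_map]
    have h1 : (cycleMaxima π).Pairwise (· < ·) :=
      ((List.pairwise_lt_finRange m).filter _)
    refine h1.imp_of_mem fun {M M'} hM hM' h v hv hv' => ?_
    obtain ⟨x, hx, rfl⟩ := (mem_cycleWord π).1 hv
    obtain ⟨x', hx', h'⟩ := (mem_cycleWord π).1 hv'
    obtain rfl : x = x' := by ext; omega
    exact h.ne (eq_of_mem_cycleMaxima π hM hM' (hx.trans hx'.symm))

theorem length_cycleWords (s : ℕ) : (cycleWords s π).length = numCycles π := by
  classical
  rw [cycleWords_eq, List.length_map, numCycles]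
  have hn : (cycleMaxima π).Nodup := (List.nodup_finRange m).filter _
  rw [← List.toFinset_card_of_nodup hn, ← Nat.card_eq_finsetCard]
  refine Nat.card_eq_of_bijective
    (fun M : (cycleMaxima π).toFinset => Quotient.mk (Equiv.Perm.SameCycle.setoid π) M.1) ⟨?_, ?_⟩
  · rintro ⟨M, hM⟩ ⟨M', hM'⟩ h
    rw [List.mem_toFinset] at hM hM'
    exact Subtype.ext (eq_of_mem_cycleMaxima π hM hM' (Quotient.exact h))
  · intro q
    induction q using Quotient.inductionOn with
    | h x =>
      obtain ⟨M, hM, h⟩ := exists_mem_cycleMaxima π x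
      exact ⟨⟨M, List.mem_toFinset.2 hM⟩, Quotient.sound h⟩

/-- Every cycle occurs among the words, its head identifies its maximum, its length the period, and
its letters the successive images. -/
theorem cycleWords_injective {s : ℕ} {π π' : Equiv.Perm (Fin m)}
    (h : cycleWords s π = cycleWords s π') : π = π' := by
  ext x
  obtain ⟨M, hM, hx⟩ := exists_mem_cycleMaxima π x
  have hw : cycleWord π s M ∈ cycleWords s π' := by
    rw [← h, cycleWords_eq]
    exact List.mem_map_of_mem hM
  rw [cycleWords_eq, List.mem_map] at hw
  obtain ⟨M', -, hw⟩ := hw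
  have hMM : M' = M := by
    have := congrArg (fun l => l.headD 0) hw
    simp only [headD_cycleWord] at this
    ext
    omega
  subst hMM
  have hp : Function.minimalPeriod π M' = Function.minimalPeriod π' M' := by
    have := congrArg List.length hw
    simpa [cycleWord] using this.symm
  have hpow : ∀ t, (π ^ t) M' = (π' ^ t) M' := by
    intro t
    rw [← pow_mod_minimalPeriod π, ← pow_mod_minimalPeriod π', ← hp]
    have ht := Nat.mod_lt t (minimalPeriod_pos π M')
    generalize t % Function.minimalPeriod π M' = k at *
    rw [cycleWord, cycleWord, ← hp, List.map_inj_left] at hw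
    have := hw k (List.mem_range.2 ht)
    ext
    omega
  obtain ⟨t, -, rfl⟩ := exists_pow_eq_of_sameCycle π hx
  have h1 := hpow (t + 1)
  rw [pow_succ', pow_succ', Equiv.Perm.mul_apply, Equiv.Perm.mul_apply, ← hpow t] at h1
  rw [h1]

/-- Foata's correspondence: erasing the cuts between cycle words loses nothing, as the decomposition
into pieces is unique. This gives an injection of a finite set of permutations into itself, so it is
surjective and no explicit inverse is needed. -/
theorem exists_cycleWords_eq {γ : Type*} {c : ℕ → γ} {s m : ℕ}
    (hc : ∀ x y : Fin m, c (s + x + 1) = c (s + y + 1)) {L : List (List ℕ)} (hL : IsPieces c L)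
    (hn : L.flatten.Nodup) (hmem : ∀ v, v ∈ L.flatten ↔ s < v ∧ v ≤ s + m) :
    ∃ π : Equiv.Perm (Fin m), cycleWords s π = L := by
  have hF : ∀ π : Equiv.Perm (Fin m), ∃ σ : Equiv.Perm (Fin m),
      (cycleWords s π).flatten = List.ofFn fun i => s + (σ i : ℕ) + 1 := fun π =>
    exists_perm_of_nodup (nodup_flatten_cycleWords π s) fun v => mem_flatten_cycleWords π
  choose F hF using hF
  have hinj : Function.Injective F := fun π π' h => by
    have h1 := hF π
    rw [h, ← hF π'] at h1
    exact cycleWords_injective ((isPieces_cycleWords π hc).unique (isPieces_cycleWords π' hc) h1)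
  obtain ⟨σ, hσ⟩ := exists_perm_of_nodup hn hmem
  obtain ⟨π, rfl⟩ := Finite.surjective_of_injective hinj σ
  exact ⟨π, (isPieces_cycleWords π hc).unique hL ((hF π).trans hσ.symm)⟩

end CycleWords

end TreeLike

namespace TreeLike

/-! ### Substitution of pieces for letters -/

theorem exists_map_eq_of_perm {α β : Type*} {f : α → β} {l : List α} {ps : List β}
    (h : ps.Perm (l.map f)) : ∃ m : List α, m.Perm l ∧ m.map f = ps := by
  induction ps generalizing l with
  | nil =>
    refine ⟨[], ?_, rfl⟩
    rw [List.map_eq_nil_iff.1 h.nil_eq.symm]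
  | cons p ps ih =>
    obtain ⟨x, hx, rfl⟩ := List.mem_map.1 (h.subset (List.mem_cons_self))
    obtain ⟨l₁, l₂, rfl⟩ := List.append_of_mem hx
    have h1 : (f x :: ps).Perm (f x :: (l₁ ++ l₂).map f) := by
      refine h.trans ?_
      rw [List.map_append, List.map_cons, List.map_append]
      exact List.perm_middle
    obtain ⟨m, hm, rfl⟩ := ih h1.cons_inv
    exact ⟨x :: m, (hm.cons x).trans List.perm_middle.symm, rfl⟩

theorem nodup_of_nodup_flatten {α : Type*} {ps : List (List α)} (h : ps.flatten.Nodup)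
    (hne : ∀ p ∈ ps, p ≠ []) : ps.Nodup := by
  rw [List.nodup_flatten] at h
  refine h.2.imp_of_mem fun {p q} hp _ hd heq => ?_
  subst heq
  obtain ⟨x, hx⟩ := List.exists_mem_of_ne_nil _ (hne p hp)
  exact hd hx hx

theorem eq_of_perm_of_pairwise_head {L L' : List (List ℕ)} (h : L.Perm L')
    (hL : L.Pairwise fun p q => p.headD 0 < q.headD 0)
    (hL' : L'.Pairwise fun p q => p.headD 0 < q.headD 0) : L = L' :=
  h.eq_of_pairwise (fun _ _ _ _ h1 h2 => (lt_asymm h1 h2).elim) hL hL'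

/-- The class of a number: smaller than, equal to, or larger than `s`. -/
def cls (s v : ℕ) : Ordering := compare v s

theorem cls_eq_cls_iff {s v w : ℕ} : cls s v = cls s w ↔ (v < s ↔ w < s) ∧ (v = s ↔ w = s) := by
  have key : ∀ v, (v < s ∧ cls s v = .lt) ∨ (v = s ∧ cls s v = .eq) ∨ (s < v ∧ cls s v = .gt) := by
    intro v
    rcases lt_trichotomy v s with h | h | h
    · exact Or.inl ⟨h, compare_lt_iff_lt.2 h⟩
    · exact Or.inr (Or.inl ⟨h, compare_eq_iff_eq.2 h⟩)
    · exact Or.inr (Or.inr ⟨h, compare_gt_iff_gt.2 h⟩)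
  rcases key v with ⟨h, h1⟩ | ⟨h, h1⟩ | ⟨h, h1⟩ <;> rcases key w with ⟨h', h2⟩ | ⟨h', h2⟩ | ⟨h', h2⟩ <;>
  · rw [h1, h2]
    simp only [reduceCtorEq, true_iff, false_iff]
    omega

theorem pairwise_head_of_isPieces {s : ℕ} {L : List (List ℕ)} (h : IsPieces (cls s) L)
    (hc : ∀ p ∈ L, ∀ q ∈ L, cls s (p.headD 0) = cls s (q.headD 0)) :
    L.Pairwise fun p q => p.headD 0 < q.headD 0 := by
  have : IsTrans (List ℕ) fun p q => p.headD 0 < q.headD 0 := ⟨fun _ _ _ h h' => lt_trans h h'⟩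
  have h1 : L.IsChain fun p q => p.headD 0 < q.headD 0 :=
    h.2.imp_of_mem_imp fun p q hp hq hpq => hpq (hc p hp q hq)
  exact h1.pairwise

/-- The letters that occur in a word, in increasing order, the red ones first. -/
def allLetters (p q : ℕ) : List Letter :=
  Letter.red 0 :: ((List.range q).map (fun i => Letter.red (i + 1)) ++
    (List.range p).map fun i => Letter.blue (i + 1))

/-- The word that is substituted for a letter. -/
def letterWord (s : ℕ) (L R : List (List ℕ)) : Letter → List ℕ
  | Letter.red 0 => [s]
  | Letter.red (i + 1) => L.getD i []
  | Letter.blue i => R.getD (i - 1) []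

theorem substitute_eq (s : ℕ) (L R : List (List ℕ)) (m : List Letter) :
    substitute s L R m = (m.map (letterWord s L R)).flatten := by
  rw [substitute, List.flatMap_def]
  congr 2

theorem map_letterWord_allLetters (s : ℕ) (L R : List (List ℕ)) :
    (allLetters R.length L.length).map (letterWord s L R) = [s] :: (L ++ R) := by
  have h : ∀ L : List (List ℕ), (List.range L.length).map (fun i => L.getD i []) = L := by
    intro L
    apply List.ext_getElem
    · simp
    · intro i h1 h2
      simp [h2]
  rw [allLetters, List.map_cons, List.map_append, List.map_map, List.map_map]
  conv_rhs => rw [← h L, ← h R]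
  rfl

/-- Consecutive letters of the same colour increase, and no blue letter follows the red `0`. -/
def StarRel (x y : Letter) : Prop := LetterRel x y ∧ (x = Letter.red 0 → y.isRed = true)

/-- The relation on pieces that corresponds to `StarRel`. -/
def StarPiece (s : ℕ) (p q : List ℕ) : Prop :=
  PieceRel (cls s) p q ∧ (q.headD 0 = s → s < p.headD 0) ∧ (p.headD 0 = s → q.headD 0 < s)

/-- The relation between consecutive letters of a permutation that has a run of size one at
the letter `s`. -/
def RunRel (s x y : ℕ) : Prop := (y = s → s < x) ∧ (x = s → y < s)

/-- Two lists of pieces, with letters smaller and larger than `s`. -/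
structure IsFrame (s : ℕ) (L R : List (List ℕ)) : Prop where
  left : IsPieces (cls s) L
  right : IsPieces (cls s) R
  lt : ∀ p ∈ L, p.headD 0 < s
  gt : ∀ p ∈ R, s < p.headD 0

namespace IsFrame

variable {s : ℕ} {L R : List (List ℕ)}

theorem pairwise_left (h : IsFrame s L R) : L.Pairwise fun p q => p.headD 0 < q.headD 0 :=
  pairwise_head_of_isPieces h.left fun p hp q hq => by
    have := h.lt p hp
    have := h.lt q hq
    rw [cls_eq_cls_iff]
    omega

theorem pairwise_right (h : IsFrame s L R) : R.Pairwise fun p q => p.headD 0 < q.headD 0 :=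
  pairwise_head_of_isPieces h.right fun p hp q hq => by
    have := h.gt p hp
    have := h.gt q hq
    rw [cls_eq_cls_iff]
    omega

theorem head_lt_head_iff (h : L.Pairwise fun p q => p.headD 0 < q.headD 0) {i j : ℕ}
    (hi : i < L.length) (hj : j < L.length) :
    (L[i]).headD 0 < (L[j]).headD 0 ↔ i < j := by
  rw [List.pairwise_iff_getElem] at h
  constructor
  · intro hlt
    by_contra hij
    rcases (not_lt.1 hij).lt_or_eq with h' | rfl
    · exact lt_asymm hlt (h j i hj hi h')
    · exact lt_irrefl _ hlt
  · exact h i j hi hj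

theorem letterWord_cases (h : IsFrame s L R) {x : Letter}
    (hx : x ∈ allLetters R.length L.length) :
    (x = Letter.red 0 ∧ letterWord s L R x = [s]) ∨
    (∃ i, ∃ hi : i < L.length, x = Letter.red (i + 1) ∧ letterWord s L R x = L[i] ∧
      (L[i]).headD 0 < s) ∨
    ∃ i, ∃ hi : i < R.length, x = Letter.blue (i + 1) ∧ letterWord s L R x = R[i] ∧
      s < (R[i]).headD 0 := by
  simp only [allLetters, List.mem_cons, List.mem_append, List.mem_map, List.mem_range] at hx
  rcases hx with rfl | ⟨i, hi, rfl⟩ | ⟨i, hi, rfl⟩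
  · exact Or.inl ⟨rfl, rfl⟩
  · exact Or.inr (Or.inl ⟨i, hi, rfl, by simp [letterWord, hi], h.lt _ (List.getElem_mem _)⟩)
  · exact Or.inr (Or.inr ⟨i, hi, rfl, by simp [letterWord, hi], h.gt _ (List.getElem_mem _)⟩)

/-- Red stands for the classes below and equal to `s`, blue for the class above, and the heads in
`L` and in `R` increase with the index. Before red 0 only blue can stand, because no red number is
smaller than 0; this is the middle condition of `StarPiece`. -/
theorem starRel_iff (h : IsFrame s L R) {x y : Letter}
    (hx : x ∈ allLetters R.length L.length) (hy : y ∈ allLetters R.length L.length) :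
    StarRel x y ↔ StarPiece s (letterWord s L R x) (letterWord s L R y) := by
  unfold StarRel StarPiece LetterRel PieceRel
  rw [cls_eq_cls_iff]
  rcases h.letterWord_cases hx with ⟨rfl, h1⟩ | ⟨i, hi, rfl, h1, h2⟩ | ⟨i, hi, rfl, h1, h2⟩ <;>
  rcases h.letterWord_cases hy with ⟨rfl, h3⟩ | ⟨j, hj, rfl, h3, h4⟩ | ⟨j, hj, rfl, h3, h4⟩ <;>
  simp only [h1, h3, Letter.isRed, Letter.val, List.headD_cons, Letter.red.injEq,
    reduceCtorEq, Bool.false_eq_true, Bool.true_eq_false, false_imp_iff, true_imp_iff, and_true,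
    Nat.add_lt_add_iff_right, and_false, true_iff, iff_true, false_iff]
  · omega
  · omega
  · omega
  · omega
  · rw [← head_lt_head_iff h.pairwise_left hi hj]
    omega
  · omega
  · omega
  · omega
  · rw [← head_lt_head_iff h.pairwise_right hi hj]
    omega

theorem isPiece (h : IsFrame s L R) {p : List ℕ} (hp : p ∈ [s] :: (L ++ R)) :
    IsPiece (cls s) p := by
  rcases List.mem_cons.1 hp with rfl | hp
  · exact isPiece_singleton s
  · rcases List.mem_append.1 hp with hp | hp
    · exact h.left.1 p hp
    · exact h.right.1 p hp

theorem map_perm {m : List Letter} (hm : m.Perm (allLetters R.length L.length)) :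
    (m.map (letterWord s L R)).Perm ([s] :: (L ++ R)) := by
  rw [← map_letterWord_allLetters]
  exact hm.map _

theorem isChain_iff (h : IsFrame s L R) {m : List Letter}
    (hm : m.Perm (allLetters R.length L.length)) :
    m.IsChain StarRel ↔ (m.map (letterWord s L R)).IsChain (StarPiece s) := by
  rw [List.isChain_map]
  constructor
  · exact fun hc => hc.imp_of_mem_imp fun x y hx hy hxy =>
      (h.starRel_iff (hm.subset hx) (hm.subset hy)).1 hxy
  · exact fun hc => hc.imp_of_mem_imp fun x y hx hy hxy =>
      (h.starRel_iff (hm.subset hx) (hm.subset hy)).2 hxy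

theorem isPieces_map (h : IsFrame s L R) {m : List Letter}
    (hm : m.Perm (allLetters R.length L.length)) (hc : m.IsChain StarRel) :
    IsPieces (cls s) (m.map (letterWord s L R)) :=
  ⟨fun _ hp => h.isPiece ((map_perm hm).subset hp),
    ((h.isChain_iff hm).1 hc).imp fun _ _ h => h.1⟩

theorem eq_left {L' R' : List (List ℕ)} (h : IsFrame s L R) (h' : IsFrame s L' R')
    (hp : ([s] :: (L ++ R)).Perm ([s] :: (L' ++ R'))) : L = L' ∧ R = R' := by
  have h1 := hp.cons_inv
  have key : ∀ {L R : List (List ℕ)}, IsFrame s L R →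
      (L ++ R).filter (fun p => p.headD 0 < s) = L ∧
        (L ++ R).filter (fun p => s < p.headD 0) = R := by
    intro L R h
    rw [List.filter_append, List.filter_append]
    constructor
    · rw [List.filter_eq_self.2 fun p hp => by simpa using h.lt p hp,
        List.filter_eq_nil_iff.2 fun p hp => by simpa using (h.gt p hp).le, List.append_nil]
    · rw [List.filter_eq_nil_iff.2 fun p hp => by simpa using (h.lt p hp).le,
        List.filter_eq_self.2 fun p hp => by simpa using h.gt p hp, List.nil_append]
  have h2 := h1.filter fun p => p.headD 0 < s
  have h3 := h1.filter fun p => s < p.headD 0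
  rw [(key h).1, (key h').1] at h2
  rw [(key h).2, (key h').2] at h3
  exact ⟨eq_of_perm_of_pairwise_head h2 h.pairwise_left h'.pairwise_left,
    eq_of_perm_of_pairwise_head h3 h.pairwise_right h'.pairwise_right⟩

end IsFrame

/-- A piece containing `s` is `[s]` alone, so `RunRel` is a condition at the boundaries between
pieces only. There the last letter of a piece lies on the same side of `s` as its head. -/
theorem isChain_runRel_iff {s : ℕ} {ps : List (List ℕ)} (h : IsPieces (cls s) ps) :
    ps.flatten.IsChain (RunRel s) ↔ ps.IsChain (StarPiece s) := by
  have hne : [] ∉ ps := fun hm => (h.1 _ hm).1 rfl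
  have hcls : ∀ p ∈ ps, ∀ y ∈ p, (y < s ↔ p.headD 0 < s) ∧ (y = s ↔ p.headD 0 = s) :=
    fun p hp y hy => cls_eq_cls_iff.1 ((h.1 p hp).class_eq hy)
  rw [List.isChain_flatten hne]
  have key : ∀ p q, p ∈ ps → q ∈ ps → ((∀ x ∈ p.getLast?, ∀ y ∈ q.head?, RunRel s x y) ↔
      (q.headD 0 = s → s < p.headD 0) ∧ (p.headD 0 = s → q.headD 0 < s)) := by
    intro p q hp hq
    obtain ⟨p', x, rfl⟩ := p.eq_nil_or_concat'.resolve_left (h.1 p hp).1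
    rcases q with _ | ⟨y, q⟩
    · exact ((h.1 _ hq).1 rfl).elim
    · have h1 := hcls _ hp x (by simp)
      simp only [List.getLast?_append, List.getLast?_singleton, Option.some_or, Option.mem_def,
        Option.some.injEq, forall_eq', List.head?_cons, List.headD_cons, RunRel]
      omega
  constructor
  · rintro ⟨-, h2⟩
    have h3 : ps.IsChain fun p q => PieceRel (cls s) p q ∧
        ∀ x ∈ p.getLast?, ∀ y ∈ q.head?, RunRel s x y :=
      List.isChain_iff_getElem.2 fun i hi =>
        ⟨List.isChain_iff_getElem.1 h.2 i hi, List.isChain_iff_getElem.1 h2 i hi⟩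
    exact h3.imp_of_mem_imp fun p q hp hq hpq => ⟨hpq.1, (key p q hp hq).1 hpq.2⟩
  · intro hc
    refine ⟨fun p hp => ?_, hc.imp_of_mem_imp fun p q hp hq hpq => (key p q hp hq).2 hpq.2⟩
    by_cases hs : p.headD 0 = s
    · obtain ⟨y, t, rfl⟩ := List.exists_cons_of_ne_nil (h.1 p hp).1
      rcases t with _ | ⟨z, t⟩
      · simp
      · have h1 : z < y := ((h.1 _ hp).2 z (by simp)).1
        have h2 : z = s := (hcls _ hp z (by simp)).2.2 hs
        have h3 : y = s := hs
        omega
    · have hns : ∀ y ∈ p, y ≠ s := fun y hy => fun hys => hs ((hcls p hp y hy).2.1 hys)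
      have h1 : p.IsChain fun _ _ => True := by
        rw [List.isChain_iff_getElem]
        simp
      exact h1.imp_of_mem_imp fun x y hx hy _ => ⟨fun h => (hns y hy h).elim, fun h => (hns x hx h).elim⟩

end TreeLike

namespace TreeLike

/-! ### Permutations with a marked run and their pieces -/

theorem eq_of_map_eq {α β : Type*} {f : α → β} {l m m' : List α}
    (hf : ∀ x ∈ l, ∀ y ∈ l, f x = f y → x = y) (hm : m ⊆ l) (hm' : m' ⊆ l)
    (h : m.map f = m'.map f) : m = m' := by
  have hlen : m.length = m'.length := by simpa using congrArg List.length h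
  refine List.ext_getElem hlen fun i h1 h2 => ?_
  refine hf _ (hm (List.getElem_mem h1)) _ (hm' (List.getElem_mem h2)) ?_
  have := List.getElem_of_eq h (i := i) (by simpa using h1)
  simpa using this

section

variable {a b : ℕ}

theorem isFrame_cycleWords (l : Equiv.Perm (Fin a)) (r : Equiv.Perm (Fin b)) :
    IsFrame (a + 1) (cycleWords 0 l) (cycleWords (a + 1) r) := by
  have hhead : ∀ {m s : ℕ} (π : Equiv.Perm (Fin m)), ∀ p ∈ cycleWords s π,
      s < p.headD 0 ∧ p.headD 0 ≤ s + m := by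
    intro m s π p hp
    rw [cycleWords_eq] at hp
    obtain ⟨M, -, rfl⟩ := List.mem_map.1 hp
    rw [headD_cycleWord]
    omega
  refine ⟨isPieces_cycleWords l fun x y => ?_, isPieces_cycleWords r fun x y => ?_,
    fun p hp => ?_, fun p hp => ?_⟩
  · rw [cls_eq_cls_iff]
    omega
  · rw [cls_eq_cls_iff]
    omega
  · have := hhead l p hp
    omega
  · exact (hhead r p hp).1

variable {l : Equiv.Perm (Fin a)} {r : Equiv.Perm (Fin b)} {μ : List Letter}

theorem perm_allLetters_length (h : μ.Perm (allLetters (numCycles r) (numCycles l))) :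
    μ.Perm (allLetters (cycleWords (a + 1) r).length (cycleWords 0 l).length) := by
  rwa [length_cycleWords, length_cycleWords]

theorem substitute_perm (h : μ.Perm (allLetters (numCycles r) (numCycles l))) :
    (substitute (a + 1) (cycleWords 0 l) (cycleWords (a + 1) r) μ).Perm
      ((a + 1) :: ((cycleWords 0 l).flatten ++ (cycleWords (a + 1) r).flatten)) := by
  rw [substitute_eq]
  refine (IsFrame.map_perm (perm_allLetters_length h)).flatten.trans ?_
  simp

theorem nodup_substitute (h : μ.Perm (allLetters (numCycles r) (numCycles l))) :
    (substitute (a + 1) (cycleWords 0 l) (cycleWords (a + 1) r) μ).Nodup := by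
  rw [(substitute_perm h).nodup_iff, List.nodup_cons, List.nodup_append]
  refine ⟨?_, nodup_flatten_cycleWords l 0, nodup_flatten_cycleWords r (a + 1), ?_⟩
  · rw [List.mem_append, mem_flatten_cycleWords, mem_flatten_cycleWords]
    omega
  · intro v hv w hw
    rw [mem_flatten_cycleWords] at hv hw
    omega

theorem mem_substitute (h : μ.Perm (allLetters (numCycles r) (numCycles l))) {v : ℕ} :
    v ∈ substitute (a + 1) (cycleWords 0 l) (cycleWords (a + 1) r) μ ↔ 0 < v ∧ v ≤ a + b + 1 := by
  rw [(substitute_perm h).mem_iff, List.mem_cons, List.mem_append, mem_flatten_cycleWords,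
    mem_flatten_cycleWords]
  omega

theorem isChain_substitute (h : μ.Perm (allLetters (numCycles r) (numCycles l)))
    (hc : μ.IsChain StarRel) :
    (substitute (a + 1) (cycleWords 0 l) (cycleWords (a + 1) r) μ).IsChain (RunRel (a + 1)) := by
  have h' := perm_allLetters_length h
  have hf := isFrame_cycleWords l r
  rw [substitute_eq, isChain_runRel_iff (hf.isPieces_map h' hc)]
  exact (hf.isChain_iff h').1 hc

/-- The assembled word determines its pieces; their heads sort them into the two families of cycles,
and these determine the permutations. Distinct letters receive distinct pieces, as the pieces are
non-empty and disjoint, so the word of letters is recovered too. -/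
theorem substitute_injective {l' : Equiv.Perm (Fin a)} {r' : Equiv.Perm (Fin b)} {μ' : List Letter}
    (h : μ.Perm (allLetters (numCycles r) (numCycles l))) (hc : μ.IsChain StarRel)
    (h' : μ'.Perm (allLetters (numCycles r') (numCycles l'))) (hc' : μ'.IsChain StarRel)
    (heq : substitute (a + 1) (cycleWords 0 l) (cycleWords (a + 1) r) μ =
      substitute (a + 1) (cycleWords 0 l') (cycleWords (a + 1) r') μ') :
    l = l' ∧ r = r' ∧ μ = μ' := by
  have hf := isFrame_cycleWords l r
  have hf' := isFrame_cycleWords l' r'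
  have hp := perm_allLetters_length h
  have hp' := perm_allLetters_length h'
  rw [substitute_eq, substitute_eq] at heq
  have hm := (hf.isPieces_map hp hc).unique (hf'.isPieces_map hp' hc') heq
  have hperm := (IsFrame.map_perm hp).symm.trans (hm ▸ IsFrame.map_perm hp')
  obtain ⟨hl, hr⟩ := hf.eq_left hf' hperm
  obtain rfl := cycleWords_injective hl
  obtain rfl := cycleWords_injective hr
  refine ⟨rfl, rfl, ?_⟩
  have hnd : ((allLetters (cycleWords (a + 1) r).length (cycleWords 0 l).length).map
      (letterWord (a + 1) (cycleWords 0 l) (cycleWords (a + 1) r))).Nodup := by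
    rw [map_letterWord_allLetters]
    refine nodup_of_nodup_flatten ?_ fun p hp => (hf.isPiece hp).1
    have := (substitute_perm h).nodup_iff.1 (nodup_substitute h)
    simpa using this
  exact eq_of_map_eq (fun x hx y hy hxy => List.inj_on_of_nodup_map hnd hx hy hxy)
    hp.subset hp'.subset hm

end

/-- The pieces on each side of `s` are sorted by their heads. These heads are distinct since the
pieces are disjoint, so the sorted lists satisfy the chain condition strictly. -/
theorem exists_frame {s : ℕ} {ps : List (List ℕ)} (h : IsPieces (cls s) ps)
    (hn : ps.flatten.Nodup) (hs : s ∈ ps.flatten) :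
    ∃ L R, IsFrame s L R ∧ ps.Perm ([s] :: (L ++ R)) := by
  have hnd : ps.Nodup := nodup_of_nodup_flatten hn fun p hp => (h.1 p hp).1
  have hhead : ∀ p ∈ ps, p.headD 0 ∈ p := fun p hp => by
    obtain ⟨x, t, rfl⟩ := List.exists_cons_of_ne_nil (h.1 p hp).1
    simp
  have hinj : ∀ p ∈ ps, ∀ q ∈ ps, ∀ v, v ∈ p → v ∈ q → p = q := by
    intro p hp q hq v hvp hvq
    by_contra hne
    have hpw := (List.nodup_flatten.1 hn).2
    have : Std.Symm (List.Disjoint (α := ℕ)) := ⟨fun _ _ h => h.symm⟩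
    exact hpw.forall hp hq hne hvp hvq
  have hsing : ∀ p ∈ ps, p.headD 0 = s → p = [s] := by
    intro p hp hps
    obtain ⟨x, t, rfl⟩ := List.exists_cons_of_ne_nil (h.1 p hp).1
    obtain rfl : x = s := hps
    rcases t with _ | ⟨y, t⟩
    · rfl
    · have h1 := (h.1 _ hp).2 y (by simp)
      have h2 : y < x ∧ cls x y = cls x x := h1
      rw [cls_eq_cls_iff] at h2
      omega
  have hmem : [s] ∈ ps := by
    obtain ⟨p, hp, hsp⟩ := List.mem_flatten.1 hs
    have h1 := cls_eq_cls_iff.1 ((h.1 p hp).class_eq hsp)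
    rwa [← hsing p hp (by omega)]
  have key : ∀ (P : ℕ → Bool), ∃ L : List (List ℕ), L.Perm (ps.filter fun p => P (p.headD 0)) ∧
      IsPieces (cls s) L := by
    intro P
    have hle : ∀ p q : List ℕ, (decide (p.headD 0 ≤ q.headD 0) ||
        decide (q.headD 0 ≤ p.headD 0)) = true := by
      intro p q
      simpa using le_total (p.headD 0) (q.headD 0)
    refine ⟨(ps.filter fun p => P (p.headD 0)).mergeSort fun p q => p.headD 0 ≤ q.headD 0,
      List.mergeSort_perm _ _, fun p hp => ?_, ?_⟩
    · rw [(List.mergeSort_perm _ _).mem_iff, List.mem_filter] at hp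
      exact h.1 p hp.1
    · have h1 := List.pairwise_mergeSort (le := fun p q : List ℕ => decide (p.headD 0 ≤ q.headD 0))
        (fun p q r hpq hqr => by
          rw [decide_eq_true_eq] at *
          exact hpq.trans hqr) hle (ps.filter fun p => P (p.headD 0))
      have h2 : ((ps.filter fun p => P (p.headD 0)).mergeSort
          fun p q => p.headD 0 ≤ q.headD 0).Nodup :=
        (List.mergeSort_perm _ _).nodup_iff.2 (hnd.filter _)
      refine List.Pairwise.isChain ?_
      refine (h1.and h2).imp_of_mem fun {p q} hp hq hpq _ => ?_
      rw [(List.mergeSort_perm _ _).mem_iff, List.mem_filter] at hp hq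
      refine lt_of_le_of_ne (of_decide_eq_true hpq.1) fun he => hpq.2 ?_
      exact hinj p hp.1 q hq.1 _ (hhead p hp.1) (he ▸ hhead q hq.1)
  obtain ⟨L, hL, hL'⟩ := key fun x => x < s
  obtain ⟨R, hR, hR'⟩ := key fun x => s < x
  have hmL : ∀ p, p ∈ L ↔ p ∈ ps ∧ p.headD 0 < s := fun p => by
    rw [hL.mem_iff, List.mem_filter, decide_eq_true_eq]
  have hmR : ∀ p, p ∈ R ↔ p ∈ ps ∧ s < p.headD 0 := fun p => by
    rw [hR.mem_iff, List.mem_filter, decide_eq_true_eq]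
  refine ⟨L, R, ⟨hL', hR', fun p hp => ((hmL p).1 hp).2, fun p hp => ((hmR p).1 hp).2⟩, ?_⟩
  refine (List.perm_ext_iff_of_nodup hnd ?_).2 fun p => ?_
  · rw [List.nodup_cons, List.mem_append, hmL, hmR, List.nodup_append, hL.nodup_iff, hR.nodup_iff]
    refine ⟨?_, hnd.filter _, hnd.filter _, fun p hp q hq hpq => ?_⟩
    · rintro (⟨-, h⟩ | ⟨-, h⟩) <;> exact lt_irrefl _ h
    · subst hpq
      exact lt_asymm ((hmL p).1 hp).2 ((hmR p).1 hq).2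
  · rw [List.mem_cons, List.mem_append, hmL, hmR]
    constructor
    · intro hp
      rcases lt_trichotomy (p.headD 0) s with h | h | h
      · exact Or.inr (Or.inl ⟨hp, h⟩)
      · exact Or.inl (hsing p hp h)
      · exact Or.inr (Or.inr ⟨hp, h⟩)
    · rintro (rfl | h | h)
      exacts [hmem, h.1, h.1]

/-- The inverse of substitution: after sorting, the pieces on either side of `s` are the cycle words
of a permutation, and the original order of the pieces is the word of letters. -/
theorem exists_substitute_eq {a b : ℕ} {w : List ℕ} (hn : w.Nodup)
    (hmem : ∀ v, v ∈ w ↔ 0 < v ∧ v ≤ a + b + 1) (hc : w.IsChain (RunRel (a + 1))) :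
    ∃ (l : Equiv.Perm (Fin a)) (r : Equiv.Perm (Fin b)) (μ : List Letter),
      μ.Perm (allLetters (numCycles r) (numCycles l)) ∧ μ.IsChain StarRel ∧
        substitute (a + 1) (cycleWords 0 l) (cycleWords (a + 1) r) μ = w := by
  obtain ⟨ps, hps, rfl⟩ := exists_isPieces (c := cls (a + 1)) hn
  obtain ⟨L, R, hf, hperm⟩ := exists_frame hps hn ((hmem _).2 (by omega))
  have hn' := hperm.flatten.nodup_iff.1 hn
  rw [List.flatten_cons, List.flatten_append, List.singleton_append, List.nodup_cons,
    List.nodup_append] at hn'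
  have hclass : ∀ {L : List (List ℕ)}, IsPieces (cls (a + 1)) L → ∀ v, v ∈ L.flatten →
      ∃ p ∈ L, (v < a + 1 ↔ p.headD 0 < a + 1) ∧ (v = a + 1 ↔ p.headD 0 = a + 1) := by
    intro L hL v hv
    obtain ⟨p, hp, hv⟩ := List.mem_flatten.1 hv
    exact ⟨p, hp, cls_eq_cls_iff.1 ((hL.1 p hp).class_eq hv)⟩
  have hLlt : ∀ v ∈ L.flatten, v < a + 1 := fun v hv => by
    obtain ⟨p, hp, h⟩ := hclass hf.left v hv
    exact h.1.2 (hf.lt p hp)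
  have hRgt : ∀ v ∈ R.flatten, a + 1 < v := fun v hv => by
    obtain ⟨p, hp, h⟩ := hclass hf.right v hv
    have := hf.gt p hp
    omega
  have hsplit : ∀ v, 0 < v ∧ v ≤ a + b + 1 ↔ v = a + 1 ∨ v ∈ L.flatten ∨ v ∈ R.flatten := by
    intro v
    rw [← hmem, hperm.flatten.mem_iff]
    simp [List.mem_append]
  obtain ⟨l, hl⟩ := exists_cycleWords_eq (c := cls (a + 1)) (s := 0) (m := a)
    (fun x y => by rw [cls_eq_cls_iff]; omega) hf.left hn'.2.1 fun v => by
      have h1 := hsplit v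
      have h2 := hLlt v
      have h3 := hRgt v
      constructor
      · intro h
        have := h2 h
        have := h1.2 (Or.inr (Or.inl h))
        omega
      · intro h
        rcases h1.1 (by omega) with h | h | h
        · omega
        · exact h
        · have := h3 h
          omega
  obtain ⟨r, hr⟩ := exists_cycleWords_eq (c := cls (a + 1)) (s := a + 1) (m := b)
    (fun x y => by rw [cls_eq_cls_iff]; omega) hf.right hn'.2.2.1 fun v => by
      have h1 := hsplit v
      have h2 := hLlt v
      have h3 := hRgt v
      constructor
      · intro h
        have := h3 h
        have := h1.2 (Or.inr (Or.inr h))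
        omega
      · intro h
        rcases h1.1 (by omega) with h | h | h
        · omega
        · have := h2 h
          omega
        · exact h
  subst hl hr
  rw [← map_letterWord_allLetters] at hperm
  obtain ⟨μ, hμ, rfl⟩ := exists_map_eq_of_perm hperm
  refine ⟨l, r, μ, ?_, (hf.isChain_iff hμ).2 ((isChain_runRel_iff hps).1 hc), substitute_eq ..⟩
  rwa [length_cycleWords, length_cycleWords] at hμ

end TreeLike

namespace TreeLike

/-! ### The exchange of blocks -/

/-- `Swapped c v v'`: the word `v` consists of blocks of colours `c`, `!c`, `c`, …, `!c`, and `v'`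
is obtained by exchanging the two blocks in each pair. -/
inductive Swapped (c : Bool) : List Letter → List Letter → Prop
  | nil : Swapped c [] []
  | cons {a b v v' : List Letter} (ha : a ≠ []) (hb : b ≠ []) (hac : ∀ x ∈ a, x.isRed = c)
      (hbc : ∀ x ∈ b, x.isRed = !c) (h : Swapped c v v') : Swapped c (a ++ (b ++ v)) (b ++ (a ++ v'))

namespace Swapped

variable {c : Bool} {v v' : List Letter}

theorem symm (h : Swapped c v v') : Swapped (!c) v' v := by
  induction h with
  | nil => exact nil
  | cons ha hb hac hbc _ ih => exact cons hb ha hbc (by simpa using hac) ih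

theorem perm (h : Swapped c v v') : v'.Perm v := by
  induction h with
  | nil => exact .nil
  | @cons a b v v' _ _ _ _ _ ih =>
    rw [← List.append_assoc, ← List.append_assoc]
    exact List.perm_append_comm.append ih

theorem head_color (h : Swapped c v v') {x : Letter} (hx : x ∈ v.head?) : x.isRed = c := by
  cases h with
  | nil => simp at hx
  | @cons a b v v' ha hb hac hbc h =>
    obtain ⟨y, a, rfl⟩ := List.exists_cons_of_ne_nil ha
    obtain rfl : y = x := by simpa using hx
    exact hac y (by simp)

theorem last_color (h : Swapped c v v') {x : Letter} (hx : x ∈ v.getLast?) : x.isRed = !c := by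
  induction h with
  | nil => simp at hx
  | @cons a b v v' ha hb hac hbc h ih =>
    rw [List.getLast?_append, List.getLast?_append] at hx
    rcases v.eq_nil_or_concat' with rfl | ⟨v, y, rfl⟩
    · obtain ⟨b, y, rfl⟩ := b.eq_nil_or_concat'.resolve_left hb
      obtain rfl : y = x := by simpa using hx
      exact hbc y (by simp)
    · exact ih (by simpa using hx)

/-- Blocks are moved as a whole, and blocks that become neighbours have opposite colours, so the new
boundaries carry no condition. -/
theorem isChain (h : Swapped c v v') (hv : v.IsChain LetterRel) : v'.IsChain LetterRel := by
  induction h with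
  | nil => exact hv
  | @cons a b v v' ha hb hac hbc h ih =>
    simp only [List.isChain_append] at hv ⊢
    refine ⟨hv.2.1.1, ⟨hv.1, ih hv.2.1.2.1, fun x hx y hy hxy => ?_⟩, fun x hx y hy hxy => ?_⟩
    · rw [hac x (List.mem_of_mem_getLast? hx), h.symm.head_color hy] at hxy
      simp at hxy
    · obtain ⟨z, a, rfl⟩ := List.exists_cons_of_ne_nil ha
      obtain rfl : z = y := by simpa using hy
      rw [hbc x (List.mem_of_mem_getLast? hx), hac z (by simp)] at hxy
      simp at hxy

/-- The blocks of the inductive relation are the maximal monochromatic ones, so `splitBy` finds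
them. This connects the relation with the function and makes the relation functional. -/
theorem flatten_swapPairs (h : Swapped c v v') :
    (swapPairs (v.splitBy fun x y => x.isRed == y.isRed)).flatten = v' := by
  induction h with
  | nil => rfl
  | @cons a b v v' ha hb hac hbc h ih =>
    have hcol : ∀ {a : List Letter} {c : Bool}, a ≠ [] → (∀ x ∈ a, x.isRed = c) →
        a.splitBy (fun x y => x.isRed == y.isRed) = [a] := by
      intro a c ha hac
      refine List.splitBy_of_isChain ha (List.isChain_iff_getElem.2 fun i hi => ?_)
      rw [hac _ (List.getElem_mem _), hac _ (List.getElem_mem _), beq_self_eq_true]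
    rw [List.splitBy_append fun x hx y hy => ?_, List.splitBy_append fun x hx y hy => ?_,
      hcol ha hac, hcol hb hbc, List.singleton_append, List.singleton_append, swapPairs,
      List.flatten_cons, List.flatten_cons, ih]
    · rw [hbc x (List.mem_of_mem_getLast? hx), h.head_color hy]
      simp
    · obtain ⟨z, b, rfl⟩ := List.exists_cons_of_ne_nil hb
      obtain rfl : z = y := by simpa using hy
      rw [hac x (List.mem_of_mem_getLast? hx), hbc z (by simp)]
      simp

theorem unique {v'' : List Letter} {c' : Bool} (h : Swapped c v v') (h' : Swapped c' v v'') :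
    v' = v'' :=
  h.flatten_swapPairs.symm.trans h'.flatten_swapPairs

end Swapped

/-- Two maximal blocks are removed at a time; as the word ends in the other colour, a second block
always exists. -/
theorem exists_swapped {c : Bool} {v : List Letter} (hh : ∀ x ∈ v.head?, x.isRed = c)
    (hl : ∀ x ∈ v.getLast?, x.isRed = !c) : ∃ v', Swapped c v v' := by
  induction hn : v.length using Nat.strong_induction_on generalizing v with
  | _ n ih =>
    rcases eq_or_ne v [] with rfl | hv
    · exact ⟨[], .nil⟩
    have hsplit : ∀ (c : Bool) (v : List Letter), v ≠ [] → (∀ x ∈ v.head?, x.isRed = c) →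
        ∃ a w, v = a ++ w ∧ a ≠ [] ∧ (∀ x ∈ a, x.isRed = c) ∧ ∀ x ∈ w.head?, x.isRed = !c := by
      intro c v hv hh
      refine ⟨v.takeWhile fun x => x.isRed == c, v.dropWhile fun x => x.isRed == c,
        List.takeWhile_append_dropWhile.symm, ?_, fun x hx => ?_, fun x hx => ?_⟩
      · obtain ⟨x, t, rfl⟩ := List.exists_cons_of_ne_nil hv
        have := hh x rfl
        simp [this]
      · simpa using List.mem_takeWhile_imp hx
      · have h1 := List.head?_dropWhile_not (fun x : Letter => x.isRed == c) v
        rw [Option.mem_def.1 hx] at h1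
        exact Bool.eq_not.2 (by simpa using h1)
    obtain ⟨a, w, rfl, ha, hac, hw⟩ := hsplit c v hv hh
    have hw0 : w ≠ [] := by
      rintro rfl
      obtain ⟨a, y, rfl⟩ := a.eq_nil_or_concat'.resolve_left ha
      have h1 := hl y (by simp)
      rw [hac y (by simp)] at h1
      simp at h1
    obtain ⟨b, w, rfl, hb, hbc, hw⟩ := hsplit (!c) w hw0 hw
    have ha' := List.length_pos_of_ne_nil ha
    simp only [List.length_append] at hn
    obtain ⟨w', h'⟩ := ih w.length (by omega) (by simpa using hw) (fun x hx => hl x (by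
      rw [List.getLast?_append, List.getLast?_append, Option.mem_def.1 hx]
      rfl)) rfl
    exact ⟨_, .cons ha hb hac hbc h'⟩

theorem swapBlocks_append {u v : List Letter} (hu : Letter.red 0 ∉ u) :
    swapBlocks (u ++ Letter.red 0 :: v) = match v with
      | Letter.blue _ :: _ =>
        u ++ Letter.red 0 :: (swapPairs (v.splitBy fun x y => x.isRed == y.isRed)).flatten
      | _ => u ++ Letter.red 0 :: v := by
  have h1 : (u ++ Letter.red 0 :: v).takeWhile (fun x => x ≠ Letter.red 0) = u := by
    rw [List.takeWhile_append_of_pos fun x hx => by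
      simpa using fun h : x = Letter.red 0 => hu (h ▸ hx)]
    simp
  have h2 : (u ++ Letter.red 0 :: v).dropWhile (fun x => x ≠ Letter.red 0) = Letter.red 0 :: v := by
    rw [List.dropWhile_append_of_pos fun x hx => by
      simpa using fun h : x = Letter.red 0 => hu (h ▸ hx)]
    simp
  rcases v with _ | ⟨_ | _, v⟩ <;> simp only [swapBlocks, h1, h2, List.tail_cons]

theorem swapBlocks_of_red {u v : List Letter} (hu : Letter.red 0 ∉ u)
    (hv : ∀ x ∈ v.head?, x.isRed = true) :
    swapBlocks (u ++ Letter.red 0 :: v) = u ++ Letter.red 0 :: v := by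
  rw [swapBlocks_append hu]
  rcases v with _ | ⟨_ | _, v⟩
  · rfl
  · have := hv _ rfl
    simp [Letter.isRed] at this
  · rfl

theorem swapBlocks_of_swapped {u v v' : List Letter} (hu : Letter.red 0 ∉ u)
    (hv : Swapped false v v') :
    swapBlocks (u ++ Letter.red 0 :: v) = u ++ Letter.red 0 :: v' := by
  rw [swapBlocks_append hu]
  rcases v with _ | ⟨_ | _, v⟩
  · rw [← hv.flatten_swapPairs]
    rfl
  · rw [← hv.flatten_swapPairs]
  · have := hv.head_color rfl
    simp [Letter.isRed] at this

/-- The words that encode non-ambiguous trees. -/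
structure IsTreeWord (p q : ℕ) (m : List Letter) : Prop where
  perm : m.Perm (allLetters p q)
  isChain : m.IsChain LetterRel
  last : ∀ x ∈ m.getLast?, x.isRed = true

/-- The words obtained from those that encode non-ambiguous trees by the exchange of blocks. -/
structure IsStarWord (p q : ℕ) (m : List Letter) : Prop where
  perm : m.Perm (allLetters p q)
  isChain : m.IsChain StarRel

theorem exists_eq_append_of_perm {p q : ℕ} {m : List Letter} (h : m.Perm (allLetters p q)) :
    ∃ u v, m = u ++ Letter.red 0 :: v ∧ Letter.red 0 ∉ u ∧ Letter.red 0 ∉ v := by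
  have h0 : (Letter.red 0) ∈ m := h.symm.subset (by simp [allLetters])
  obtain ⟨u, v, rfl⟩ := List.append_of_mem h0
  have h1 := List.perm_middle.symm.trans h
  have h2 := h1.cons_inv.mem_iff (a := Letter.red 0)
  simp only [List.mem_append, List.mem_map, Letter.red.injEq, Nat.succ_ne_zero, and_false,
    exists_false, reduceCtorEq, or_self, iff_false, not_or] at h2
  exact ⟨u, v, rfl, h2⟩

/-- Red 0 is the smallest red letter, so it restricts only what precedes it. The tail can therefore
be rearranged independently of `u`. -/
theorem isChain_letterRel_append {u v : List Letter} (hv : Letter.red 0 ∉ v) :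
    (u ++ Letter.red 0 :: v).IsChain LetterRel ↔
      (u ++ [Letter.red 0]).IsChain LetterRel ∧ v.IsChain LetterRel := by
  rw [List.isChain_split, List.isChain_cons]
  refine and_congr_right fun _ => and_iff_right_of_imp fun _ y hy h => ?_
  rcases y with i | i
  · simp [Letter.isRed] at h
  · have : i ≠ 0 := by
      rintro rfl
      exact hv (List.mem_of_mem_head? hy)
    exact Nat.pos_of_ne_zero this

theorem isChain_starRel_append {u v : List Letter} (hu : Letter.red 0 ∉ u)
    (hv : Letter.red 0 ∉ v) : (u ++ Letter.red 0 :: v).IsChain StarRel ↔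
      ((u ++ [Letter.red 0]).IsChain LetterRel ∧ v.IsChain LetterRel) ∧
        ∀ x ∈ v.head?, x.isRed = true := by
  rw [← isChain_letterRel_append hv]
  constructor
  · intro h
    refine ⟨h.imp fun _ _ h => h.1, fun x hx => ?_⟩
    rw [List.isChain_split, List.isChain_cons] at h
    exact (h.2.1 x hx).2 rfl
  · rintro ⟨h, h1⟩
    have key : ∀ w : List Letter, Letter.red 0 ∉ w → w.IsChain LetterRel → w.IsChain StarRel :=
      fun w hw hc => hc.imp_of_mem_imp fun x y hx _ hxy => ⟨hxy, fun h => (hw (h ▸ hx)).elim⟩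
    rw [List.isChain_append, List.isChain_cons] at h ⊢
    exact ⟨key u hu h.1, ⟨fun y hy => ⟨h.2.1.1 y hy, fun _ => h1 y hy⟩, key v hv h.2.1.2⟩,
      fun x hx y hy => ⟨h.2.2 x hx y hy, fun h => (hu (h ▸ List.mem_of_mem_getLast? hx)).elim⟩⟩

theorem getLast_append_cons {u v : List Letter} {y : Letter} :
    (∀ x ∈ (u ++ y :: v).getLast?, x.isRed = true) ↔
      (v = [] → y.isRed = true) ∧ ∀ x ∈ v.getLast?, x.isRed = true := by
  rcases v.eq_nil_or_concat' with rfl | ⟨v, z, rfl⟩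
  · simp
  · rw [← List.cons_append, ← List.append_assoc, List.getLast?_concat, List.getLast?_concat]
    simp

/-- The two cases of the exchange of blocks. -/
theorem swapBlocks_cases {u v : List Letter} (hu : Letter.red 0 ∉ u)
    (hl : ∀ x ∈ v.getLast?, x.isRed = true) :
    ∃ v', swapBlocks (u ++ Letter.red 0 :: v) = u ++ Letter.red 0 :: v' ∧
      ((v' = v ∧ ∀ x ∈ v.head?, x.isRed = true) ∨ v ≠ [] ∧ Swapped false v v') := by
  by_cases hh : ∀ x ∈ v.head?, x.isRed = true
  · exact ⟨v, swapBlocks_of_red hu hh, Or.inl ⟨rfl, hh⟩⟩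
  · obtain ⟨v', h⟩ := exists_swapped (c := false) (v := v) (fun x hx => by
      simp only [not_forall] at hh
      obtain ⟨y, hy, h⟩ := hh
      rw [Option.mem_unique hx hy]
      simpa using h) hl
    refine ⟨v', swapBlocks_of_swapped hu h, Or.inr ⟨?_, h⟩⟩
    rintro rfl
    simp at hh

theorem IsTreeWord.swapBlocks {p q : ℕ} {m : List Letter} (h : IsTreeWord p q m) :
    IsStarWord p q (swapBlocks m) := by
  obtain ⟨u, v, rfl, hu, hv⟩ := exists_eq_append_of_perm h.perm
  have hc := (isChain_letterRel_append hv).1 h.isChain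
  have hl := (getLast_append_cons.1 h.last).2
  obtain ⟨v', heq, ⟨rfl, hh⟩ | ⟨-, hs⟩⟩ := swapBlocks_cases hu hl
  · rw [heq]
    exact ⟨h.perm, (isChain_starRel_append hu hv).2 ⟨hc, hh⟩⟩
  · rw [heq]
    have hv' : Letter.red 0 ∉ v' := fun h => hv (hs.perm.subset h)
    exact ⟨((hs.perm.cons _).append_left u).trans h.perm, (isChain_starRel_append hu hv').2
      ⟨⟨hc.1, hs.isChain hc.2⟩, fun x hx => hs.symm.head_color hx⟩⟩

theorem eq_and_eq_of_append_cons_eq {α : Type*} {u u' v v' : List α} {x : α} (hu : x ∉ u)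
    (hu' : x ∉ u') (h : u ++ x :: v = u' ++ x :: v') : u = u' ∧ v = v' := by
  induction u generalizing u' with
  | nil =>
    rcases u' with _ | ⟨y, u'⟩
    · simpa using h
    · obtain ⟨rfl, -⟩ := List.cons.inj h
      simp at hu'
  | cons y u ih =>
    rcases u' with _ | ⟨z, u'⟩
    · obtain ⟨rfl, -⟩ := List.cons.inj h
      simp at hu
    · obtain ⟨rfl, h1⟩ := List.cons.inj h
      obtain ⟨rfl, rfl⟩ := ih (fun h => hu (.tail _ h)) (fun h => hu' (.tail _ h)) h1
      exact ⟨rfl, rfl⟩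

/-- The last letter tells the two cases apart: an exchanged non-empty tail ends in blue, an
unchanged tail does not. -/
theorem IsTreeWord.swapBlocks_injective {p q : ℕ} {m m' : List Letter} (h : IsTreeWord p q m)
    (h' : IsTreeWord p q m') (heq : TreeLike.swapBlocks m = TreeLike.swapBlocks m') : m = m' := by
  obtain ⟨u, v, rfl, hu, hv⟩ := exists_eq_append_of_perm h.perm
  obtain ⟨u', v', rfl, hu', hv'⟩ := exists_eq_append_of_perm h'.perm
  have hl := (getLast_append_cons.1 h.last).2
  have hl' := (getLast_append_cons.1 h'.last).2
  have hblue : ∀ {v w : List Letter}, v ≠ [] → Swapped false v w →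
      (∀ x ∈ w.getLast?, x.isRed = true) → False := by
    intro v w hv hs hw
    obtain ⟨w, x, rfl⟩ := w.eq_nil_or_concat'.resolve_left fun h => hv (by
      have := hs.perm
      rw [h] at this
      exact this.nil_eq.symm)
    have h1 := hw x (by simp)
    have h2 := hs.symm.last_color (x := x) (by simp)
    simp [h1] at h2
  obtain ⟨w, hw, hcase⟩ := swapBlocks_cases hu hl
  obtain ⟨w', hw', hcase'⟩ := swapBlocks_cases hu' hl'
  rw [hw, hw'] at heq
  have hnotmem : ∀ {v w : List Letter}, Letter.red 0 ∉ v →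
      ((w = v ∧ ∀ x ∈ v.head?, x.isRed = true) ∨ v ≠ [] ∧ Swapped false v w) →
      Letter.red 0 ∉ w := by
    rintro v w hv (⟨rfl, -⟩ | ⟨-, hs⟩)
    · exact hv
    · exact fun h => hv (hs.perm.subset h)
  obtain ⟨rfl, rfl⟩ := eq_and_eq_of_append_cons_eq hu hu' heq
  rcases hcase with ⟨rfl, -⟩ | ⟨h1, h2⟩ <;> rcases hcase' with ⟨rfl, -⟩ | ⟨h3, h4⟩
  · rfl
  · exact (hblue h3 h4 hl).elim
  · exact (hblue h1 h2 hl').elim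
  · rw [h2.symm.unique h4.symm]

theorem IsStarWord.exists_swapBlocks_eq {p q : ℕ} {m : List Letter} (h : IsStarWord p q m) :
    ∃ m', IsTreeWord p q m' ∧ swapBlocks m' = m := by
  obtain ⟨u, v, rfl, hu, hv⟩ := exists_eq_append_of_perm h.perm
  obtain ⟨hc, hh⟩ := (isChain_starRel_append hu hv).1 h.isChain
  by_cases hl : ∀ x ∈ v.getLast?, x.isRed = true
  · exact ⟨_, ⟨h.perm, (isChain_letterRel_append hv).2 hc,
      getLast_append_cons.2 ⟨fun _ => rfl, hl⟩⟩, swapBlocks_of_red hu hh⟩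
  · obtain ⟨v', hs⟩ := exists_swapped (c := true) hh fun x hx => by
      simp only [not_forall] at hl
      obtain ⟨y, hy, h⟩ := hl
      rw [Option.mem_unique hx hy]
      simpa using h
    have hv' : Letter.red 0 ∉ v' := fun h => hv (hs.perm.subset h)
    exact ⟨u ++ Letter.red 0 :: v', ⟨((hs.perm.cons _).append_left u).trans h.perm,
      (isChain_letterRel_append hv').2 ⟨hc.1, hs.isChain hc.2⟩,
      getLast_append_cons.2 ⟨fun _ => rfl, fun x hx => hs.symm.last_color hx⟩⟩,
      swapBlocks_of_swapped hu hs.symm⟩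

theorem nodup_allLetters (p q : ℕ) : (allLetters p q).Nodup := by
  rw [allLetters, List.nodup_cons, List.nodup_append]
  refine ⟨by simp, List.nodup_range.map fun i j h => by simpa using h,
    List.nodup_range.map fun i j h => by simpa using h, fun x hx y hy => ?_⟩
  simp only [List.mem_map] at hx hy
  obtain ⟨i, -, rfl⟩ := hx
  obtain ⟨j, -, rfl⟩ := hy
  simp

theorem isTreeWord_iff {p q : ℕ} {m : List Letter} : IsTreeWord p q m ↔
    m.Nodup ∧ (∀ i, Letter.blue i ∈ m ↔ 1 ≤ i ∧ i ≤ p) ∧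
      (∀ i, Letter.red i ∈ m ↔ i ≤ q) ∧ (∃ i, m.getLast? = some (Letter.red i)) ∧
      m.IsChain fun x y => x.isRed = y.isRed → x.val < y.val := by
  have hblue : ∀ i, Letter.blue i ∈ allLetters p q ↔ 1 ≤ i ∧ i ≤ p := by
    intro i
    simp only [allLetters, List.mem_cons, List.mem_append, List.mem_map, List.mem_range,
      reduceCtorEq, and_false, exists_false, false_or, Letter.blue.injEq]
    constructor
    · rintro ⟨j, hj, rfl⟩
      omega
    · exact fun h => ⟨i - 1, by omega, by omega⟩
  have hred : ∀ i, Letter.red i ∈ allLetters p q ↔ i ≤ q := by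
    intro i
    simp only [allLetters, List.mem_cons, List.mem_append, List.mem_map, List.mem_range,
      reduceCtorEq, and_false, exists_false, or_false, Letter.red.injEq]
    constructor
    · rintro (rfl | ⟨j, hj, rfl⟩) <;> omega
    · rcases i with _ | i
      · exact fun _ => Or.inl rfl
      · exact fun h => Or.inr ⟨i, by omega, rfl⟩
  constructor
  · intro h
    refine ⟨h.perm.nodup_iff.2 (nodup_allLetters p q), fun i => by rw [h.perm.mem_iff, hblue],
      fun i => by rw [h.perm.mem_iff, hred], ?_, h.isChain⟩
    rcases m.eq_nil_or_concat' with rfl | ⟨m, x, rfl⟩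
    · exact absurd h.perm.nil_eq (by simp [allLetters])
    · have h1 := h.last x (by simp)
      rcases x with i | i
      · simp [Letter.isRed] at h1
      · exact ⟨i, by simp⟩
  · rintro ⟨h1, h2, h3, ⟨i, h4⟩, h5⟩
    refine ⟨(List.perm_ext_iff_of_nodup h1 (nodup_allLetters p q)).2 fun x => ?_, h5, ?_⟩
    · rcases x with i | i
      · rw [h2, hblue]
      · rw [h3, hred]
    · rw [h4]
      rintro x ⟨⟩
      rfl

end TreeLike

namespace TreeLike

/-! ### Runs of size one -/

/-- The chain condition concerns adjacent letters inside the word. At the ends the missing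
comparison holds by the conventions n + 1 and 0. -/
theorem isAscendingRun_one_iff_isChain {n : ℕ} (σ : Equiv.Perm (Fin n)) (i : Fin n) :
    IsAscendingRun σ (i + 1) 1 ↔ (oneLine σ).IsChain (RunRel (σ i + 1)) := by
  have hinj : ∀ j : Fin n, (σ j : ℕ) + 1 = σ i + 1 ↔ (j : ℕ) = i := fun j => by
    rw [Nat.add_right_cancel_iff, ← Fin.ext_iff, ← Fin.ext_iff, σ.apply_eq_iff_eq]
  rw [isAscendingRun_one_iff, oneLine_eq, List.isChain_iff_getElem, Nat.add_sub_cancel, letter_succ]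
  simp only [List.length_ofFn, List.getElem_ofFn, RunRel, hinj]
  constructor
  · rintro ⟨-, -, h1, h2⟩ j hj
    constructor
    · intro hji
      rw [← hji] at h1
      have := letter_succ σ ⟨j, by omega⟩
      simp only at this
      rwa [this] at h1
    · intro hji
      rw [← hji] at h2
      have := letter_succ σ ⟨j + 1, hj⟩
      simp only at this
      rwa [this] at h2
  · intro h
    refine ⟨by omega, i.2, ?_, ?_⟩
    · rcases Nat.eq_zero_or_pos (i : ℕ) with h0 | h0
      · rw [h0, letter_zero]
        have := (σ i).2
        omega
      · obtain ⟨k, hk⟩ := Nat.exists_eq_add_of_le' h0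
        have h1 := (h k (by omega)).1 hk.symm
        have h2 := letter_succ σ ⟨k, by omega⟩
        simp only at h2
        rwa [hk, h2]
    · by_cases hn : (i : ℕ) + 1 < n
      · have h1 := (h i hn).2 rfl
        have h2 := letter_succ σ ⟨i + 1, hn⟩
        simp only at h2
        rwa [h2]
      · rw [letter_of_lt _ (by omega)]
        omega

/-- The data from which a permutation with a run of size one is assembled. -/
structure RunData (n : ℕ) where
  a : ℕ
  b : ℕ
  l : Equiv.Perm (Fin a)
  r : Equiv.Perm (Fin b)
  word : List Letter
  isTreeWord : IsTreeWord (numCycles r) (numCycles l) word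
  add_eq : a + b + 1 = n

theorem oneLine_injective {n : ℕ} {σ τ : Equiv.Perm (Fin n)} (h : oneLine σ = oneLine τ) :
    σ = τ := by
  refine ofFn_perm_injective (s := 0) ?_
  simpa [oneLine_eq] using h

theorem RunsOne.exists_eq_succ {n : ℕ} (x : RunsOne n) : ∃ i : Fin n, x.1.2 = i + 1 := by
  obtain ⟨h1, h2, -⟩ := (isAscendingRun_one_iff _ _).1 x.2
  exact ⟨⟨x.1.2 - 1, by omega⟩, by simp only; omega⟩

/-- The marked letter is a + 1, so the run determines `a`, and then `b`; conversely the word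
determines the permutation and the letter a + 1 the position. -/
theorem exists_assembleEquiv (n : ℕ) : ∃ e : RunData n ≃ RunsOne n, ∀ d,
    oneLine (e d).1.1 = assemble d.l d.r d.word ∧ letter (e d).1.1 (e d).1.2 = d.a + 1 := by
  refine exists_equiv_of_rel (fun (d : RunData n) (x : RunsOne n) =>
    oneLine x.1.1 = assemble d.l d.r d.word ∧ letter x.1.1 x.1.2 = d.a + 1) ?_ ?_ ?_ ?_
  · rintro ⟨a, b, l, r, m, hm, rfl⟩
    have hs := hm.swapBlocks
    obtain ⟨σ, hσ⟩ := exists_perm_of_nodup (s := 0) (m := a + b + 1) (nodup_substitute hs.perm)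
      fun v => by rw [mem_substitute hs.perm, Nat.zero_add]
    have h1 : oneLine σ = assemble l r m := by
      rw [assemble, hσ, oneLine_eq]
      simp
    obtain ⟨i, hi⟩ := σ.surjective ⟨a, by omega⟩
    have hi' : (σ i : ℕ) = a := congrArg Fin.val hi
    refine ⟨⟨(σ, i + 1), (isAscendingRun_one_iff_isChain σ i).2 ?_⟩, h1, ?_⟩
    · rw [h1, hi']
      exact isChain_substitute hs.perm hs.isChain
    · rw [letter_succ, hi']
  · intro x
    obtain ⟨i, hi⟩ := x.exists_eq_succ
    obtain ⟨⟨σ, k⟩, hx⟩ := x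
    obtain rfl : k = i + 1 := hi
    obtain ⟨b, hb⟩ : ∃ b, (σ i : ℕ) + b + 1 = n := ⟨n - 1 - σ i, by omega⟩
    obtain ⟨l, r, μ, hμ, hc, hw⟩ := exists_substitute_eq (a := σ i) (b := b) (w := oneLine σ)
      (by
        rw [oneLine_eq, List.nodup_ofFn]
        intro j k hjk
        exact σ.injective (Fin.ext (Nat.add_right_cancel hjk)))
      (fun v => by
        rw [hb, oneLine_eq, List.mem_ofFn]
        constructor
        · rintro ⟨j, rfl⟩
          omega
        · rintro ⟨h1, h2⟩
          obtain ⟨j, hj⟩ := σ.surjective ⟨v - 1, by omega⟩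
          refine ⟨j, ?_⟩
          rw [hj]
          simp only
          omega)
      ((isAscendingRun_one_iff_isChain σ i).1 hx)
    obtain ⟨m, hm, rfl⟩ := IsStarWord.exists_swapBlocks_eq ⟨hμ, hc⟩
    exact ⟨⟨_, b, l, r, m, hm, hb⟩, hw.symm, letter_succ σ i⟩
  · rintro d x y ⟨h1, h2⟩ ⟨h3, h4⟩
    obtain ⟨i, hi⟩ := x.exists_eq_succ
    obtain ⟨j, hj⟩ := y.exists_eq_succ
    have h5 := oneLine_injective (h1.trans h3.symm)
    refine Subtype.ext (Prod.ext h5 ?_)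
    rw [← h4, h5, hi, hj, letter_succ, letter_succ] at h2
    rw [hi, hj, y.1.1.injective (Fin.ext (Nat.add_right_cancel h2))]
  · rintro ⟨a, b, l, r, m, hm, rfl⟩ ⟨a', b', l', r', m', hm', h⟩ x ⟨h1, h2⟩ ⟨h3, h4⟩
    obtain rfl : a = a' := Nat.add_right_cancel (h2.symm.trans h4)
    obtain rfl : b = b' := by omega
    have hs := hm.swapBlocks
    have hs' := hm'.swapBlocks
    obtain ⟨rfl, rfl, h5⟩ := substitute_injective hs.perm hs.isChain hs'.perm hs'.isChain
      (h1.symm.trans h3)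
    obtain rfl := hm.swapBlocks_injective hm' h5
    rfl

/-! ### Triples -/

/-- Keeping a permutation together with its degree allows equalities between data of a priori
different sizes to be resolved in one step. -/
theorem bijective_sigma_size (e : ∀ m : ℕ, Tableaux m ≃ Equiv.Perm (Fin m)) :
    Function.Bijective fun T : Tableau =>
      (⟨T.size, e T.size ⟨T, rfl⟩⟩ : Σ m, Equiv.Perm (Fin m)) :=
  ((Equiv.sigmaFiberEquiv Tableau.size).symm.trans (Equiv.sigmaCongrRight e)).bijective

theorem isTreeWord_numCycles_iff {perml permr : ∀ m : ℕ, Tableaux m ≃ Equiv.Perm (Fin m)}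
    (hl : ∀ (m : ℕ) (T : Tableaux m), numCycles (perml m T) = T.1.firstRow)
    (hr : ∀ (m : ℕ) (T : Tableaux m), numCycles (permr m T) = T.1.firstCol) (T T' : Tableau)
    (m : List Letter) :
    IsTreeWord (numCycles (permr _ ⟨T', rfl⟩)) (numCycles (perml _ ⟨T, rfl⟩)) m ↔
      IsTreeWord T'.firstCol T.firstRow m :=
  iff_of_eq (congrArg₂ (fun p q => IsTreeWord p q m) (hr _ ⟨T', rfl⟩) (hl _ ⟨T, rfl⟩))

theorem exists_runDataEquiv (n : ℕ) (perml permr : ∀ m : ℕ, Tableaux m ≃ Equiv.Perm (Fin m))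
    (word : ∀ h w : ℕ, NonAmbiguousTree h w ≃ Words h w)
    (hl : ∀ (m : ℕ) (T : Tableaux m), numCycles (perml m T) = T.1.firstRow)
    (hr : ∀ (m : ℕ) (T : Tableaux m), numCycles (permr m T) = T.1.firstCol) :
    ∃ e : Triple n ≃ RunData n, ∀ t, e t = ⟨_, _, perml _ ⟨t.left, rfl⟩, permr _ ⟨t.right, rfl⟩,
      (word _ _ t.tree).1, (isTreeWord_numCycles_iff hl hr _ _ _).2 (isTreeWord_iff.2 (word _ _ t.tree).2),
      t.size_add⟩ := by
  refine ⟨Equiv.ofBijective _ ⟨?_, ?_⟩, fun t => rfl⟩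
  · rintro ⟨T, T', N, h⟩ ⟨U, U', N', h'⟩ heq
    rw [RunData.mk.injEq] at heq
    obtain ⟨h1, h2, h3, h4, h5⟩ := heq
    obtain rfl : T = U := (bijective_sigma_size perml).1 (Sigma.ext h1 h3)
    obtain rfl : T' = U' := (bijective_sigma_size permr).1 (Sigma.ext h2 h4)
    obtain rfl : N = N' := (word _ _).injective (Subtype.ext h5)
    rfl
  · rintro ⟨a, b, l, r, m, hm, h⟩
    obtain ⟨T, hT⟩ := (bijective_sigma_size perml).2 ⟨a, l⟩
    obtain ⟨T', hT'⟩ := (bijective_sigma_size permr).2 ⟨b, r⟩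
    cases hT
    cases hT'
    have hm' := (isTreeWord_numCycles_iff hl hr _ _ _).1 hm
    refine ⟨⟨T, T', (word _ _).symm ⟨m, isTreeWord_iff.1 hm'⟩, h⟩, ?_⟩
    simp only [RunData.mk.injEq, heq_eq_eq, true_and]
    exact congrArg Subtype.val ((word _ _).apply_symm_apply _)

end TreeLike

/-! ### Composition of the bijections -/

theorem mainTheorem3 (n : ℕ) (hn : 1 ≤ n) :
    -- cutting at a corner is a bijection from the corners onto the triples
    (∃ cut : Corners n ≃ Triple n, (∀ c : Corners n, IsCut c.1.1 c.1.2 (cut c)) ∧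
      -- there are bijections that encode the components of the triples
      ∃ (perml : ∀ m : ℕ, Tableaux m ≃ Equiv.Perm (Fin m))
        (permr : ∀ m : ℕ, Tableaux m ≃ Equiv.Perm (Fin m))
        (word : ∀ h w : ℕ, NonAmbiguousTree h w ≃ Words h w),
        (∀ (m : ℕ) (T : Tableaux m), numCycles (perml m T) = T.1.firstRow) ∧
        (∀ (m : ℕ) (T : Tableaux m), numCycles (permr m T) = T.1.firstCol) ∧
        -- and the run assembled from the triple of a corner gives the bijection
        ∃ Φ : Corners n ≃ RunsOne n, ∀ c : Corners n,
          oneLine (Φ c).1.1 =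
              assemble (perml _ ⟨(cut c).left, rfl⟩) (permr _ ⟨(cut c).right, rfl⟩)
                (word _ _ (cut c).tree).1 ∧
            letter (Φ c).1.1 (Φ c).1.2 = (cut c).left.size + 1) ∧
    -- the number of corners
    (n = 1 → Nat.card (Corners n) = 1) ∧
    (2 ≤ n → (Nat.card (Corners n) : ℚ) = (n.factorial : ℚ) * ((n : ℚ) + 4) / 6) := by
  obtain ⟨cut, hcut⟩ := exists_cutEquiv n
  -- Assembling uses nothing about these bijections beyond the numbers of cycles, so arbitrary
  -- choices serve.
  choose perml hl using exists_perm_equiv_firstRow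
  choose permr hr using exists_perm_equiv_firstCol
  have word := fun h w => (exists_word_equiv h w).some
  obtain ⟨e, he⟩ := exists_runDataEquiv n perml permr word hl hr
  obtain ⟨f, hf⟩ := exists_assembleEquiv n
  have hcard : Nat.card (Corners n) = Nat.card (RunsOne n) :=
    Nat.card_congr ((cut.trans e).trans f)
  refine ⟨⟨cut, hcut, perml, permr, word, hl, hr, (cut.trans e).trans f, fun c => ?_⟩, ?_, ?_⟩
  · have h := hf (e (cut c))
    rw [he] at h
    rw [Equiv.trans_apply, Equiv.trans_apply, he]
    exact h
  · rintro rfl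
    rw [hcard, card_runsOne_one]
  · intro h
    rw [hcard, card_runsOne h]
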